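/- Let $\mathbb{F}_q$ be a finite field of odd characteristic $p$, let $m\ge 1$ and $n=2m$, and let $S_m=\mathbb{F}_q[y_1,\dots,y_m,x_m,\dots,x_1]$. Let $\mathrm{GL}_n(\mathbb{F}_q)$ act on $S_m$ from the right by $\mathbb{F}_q$-algebra automorphisms, where the variables, in the order $y_1,\dots,y_m,x_m,\dots,x_1$, are identified with the standard basis row vectors. Put $$\xi_0=\sum_{i=1}^m y_ix_i,\qquad \xi_k=\sum_{i=1}^m\left(y_i^{q^k}x_i+y_ix_i^{q^k}\right)\quad(k\ge 1),$$ let $\mathrm{O}^+_{2m}(\mathbb{F}_q)=\{g\in \mathrm{GL}_n(\mathbb{F}_q)\mid \xi_0\cdot g=\xi_0\}$, and let $P_m$ be the Sylow $p$-subgroup of $\mathrm{O}^+_{2m}(\mathbb{F}_q)$ consisting of its upper triangular unipotent matrices. For a variable $v$, let $N(v)$ be its orbit product, that is, the product of the distinct elements of the $P_m$-orbit of $v$, and let $\mathcal{H}_0=\{N(y_i),N(x_i)\mid 1\le i\le m\}$. Then: 1. the ring of invariants $S_m^{P_m}$ is Cohen–Macaulay; 2. the $n$ elements of $\mathcal{H}_0$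 are algebraically independent over $\mathbb{F}_q$, and $S_m^{P_m}$ is a free module of finite rank over the algebra $\mathbb{F}_q[\mathcal{H}_0]$; 3. $S_m^{P_m}$ is generated as an $\mathbb{F}_q$-algebra by $\mathcal{H}_0$ together with the $\xi_k$ for $0\le k\le n-3$ (no $\xi_k$ is needed if $m=1$). -/

import Mathlib

open MvPolynomial

namespace OrthPlus

section GroupAction

variable {F : Type*} [Field F] {n : ℕ}

/-- The right action of `GL_n(F)` on the polynomial ring `F[X_0, …, X_{n-1}]`: the variable `X_i` is
identified with the `i`-th standard row vector, so that `X_i · g = ∑ j, g i j X_j`; the action is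
extended to algebra endomorphisms. -/
noncomputable def act (g : GL (Fin n) F) : MvPolynomial (Fin n) F →ₐ[F] MvPolynomial (Fin n) F :=
  aeval fun i => ∑ j, C ((g : Matrix (Fin n) (Fin n) F) i j) * X j

theorem act_X (g : GL (Fin n) F) (i : Fin n) :
    act g (X i) = ∑ j, C ((g : Matrix (Fin n) (Fin n) F) i j) * X j := by
  simp [act]

theorem act_one (f : MvPolynomial (Fin n) F) : act (1 : GL (Fin n) F) f = f := by
  have : act (1 : GL (Fin n) F) = AlgHom.id F _ := by
    ext1 i
    simp [act_X, Matrix.one_apply]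
  simp [this]

theorem act_mul (g h : GL (Fin n) F) (f : MvPolynomial (Fin n) F) :
    act (g * h) f = act h (act g f) := by
  have : act (g * h) = (act h).comp (act g) := by
    ext1 i
    simp only [act_X, AlgHom.comp_apply, map_sum, map_mul, algHom_C, algebraMap_eq,
      Units.val_mul, Matrix.mul_apply, Finset.sum_mul, Finset.mul_sum]
    rw [Finset.sum_comm]
    simp only [mul_assoc]
  simp [this]

/-- The ring of invariants of a subgroup `G` of `GL_n(F)`. -/
noncomputable def invariants (G : Subgroup (GL (Fin n) F)) :
    Subalgebra F (MvPolynomial (Fin n) F) where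
  carrier := {f | ∀ g ∈ G, act g f = f}
  mul_mem' ha hb g hg := by simp [ha g hg, hb g hg]
  add_mem' ha hb g hg := by simp [ha g hg, hb g hg]
  algebraMap_mem' r g _ := by simp

/-- The orbit of a polynomial under `G`. -/
def orbit (G : Subgroup (GL (Fin n) F)) (f : MvPolynomial (Fin n) F) :
    Set (MvPolynomial (Fin n) F) :=
  {h | ∃ g ∈ G, act g f = h}

/-- The orbit product `N(f)`: the product of the distinct elements of the orbit of `f`
(orbits are finite when `F` is finite). -/
noncomputable def orbitProduct (G : Subgroup (GL (Fin n) F)) (f : MvPolynomial (Fin n) F) :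
    MvPolynomial (Fin n) F :=
  ∏ᶠ h ∈ orbit G f, h

theorem orbit_finite [Finite F] (G : Subgroup (GL (Fin n) F)) (f : MvPolynomial (Fin n) F) :
    (orbit G f).Finite := by
  have : orbit G f = (fun g => act g f) '' (G : Set (GL (Fin n) F)) := rfl
  rw [this]
  exact (Set.toFinite _).image _

theorem act_injective (g : GL (Fin n) F) : Function.Injective (act g) := by
  intro a b h
  have := congrArg (act g⁻¹) h
  rwa [← act_mul, ← act_mul, mul_inv_cancel, act_one, act_one] at this

theorem orbitProduct_mem [Finite F] (G : Subgroup (GL (Fin n) F)) (f : MvPolynomial (Fin n) F) :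
    orbitProduct G f ∈ invariants G := by
  intro g hg
  have himg : act g '' orbit G f = orbit G f := by
    ext h
    constructor
    · rintro ⟨_, ⟨k, hk, rfl⟩, rfl⟩
      exact ⟨k * g, G.mul_mem hk hg, act_mul k g f⟩
    · rintro ⟨k, hk, rfl⟩
      refine ⟨_, ⟨k * g⁻¹, G.mul_mem hk (G.inv_mem hg), rfl⟩, ?_⟩
      rw [← act_mul, inv_mul_cancel_right]
  have h1 : act g (∏ᶠ h ∈ orbit G f, h) = ∏ᶠ h ∈ orbit G f, act g h :=
    (act g : MvPolynomial (Fin n) F →* MvPolynomial (Fin n) F).map_finprod_mem _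
      (orbit_finite G f)
  have h2 : ∏ᶠ h ∈ act g '' orbit G f, h = ∏ᶠ h ∈ orbit G f, act g h :=
    finprod_mem_image (f := fun h => h) (act_injective g).injOn
  show act g (∏ᶠ h ∈ orbit G f, h) = ∏ᶠ h ∈ orbit G f, h
  rw [h1, ← h2, himg]

/-- The orbit product of the `i`-th variable, as an element of the ring of invariants. -/
noncomputable def variableNorm [Finite F] (G : Subgroup (GL (Fin n) F)) (i : Fin n) :
    invariants G :=
  ⟨orbitProduct G (X i), orbitProduct_mem G (X i)⟩

end GroupAction

/-- The group of upper triangular unipotent matrices in `GL_n(F)`. -/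
def upperUnipotent (n : ℕ) (F : Type*) [Field F] : Subgroup (GL (Fin n) F) where
  carrier := {g | (∀ i j, j < i → (g : Matrix (Fin n) (Fin n) F) i j = 0) ∧
    ∀ i, (g : Matrix (Fin n) (Fin n) F) i i = 1}
  one_mem' := ⟨fun i j h => by simp [h.ne'], fun i => by simp⟩
  mul_mem' := by
    rintro a b ⟨ha, ha'⟩ ⟨hb, hb'⟩
    refine ⟨fun i j hij => ?_, fun i => ?_⟩
    · rw [Units.val_mul, Matrix.mul_apply]
      refine Finset.sum_eq_zero fun k _ => ?_
      rcases lt_or_ge k i with h | h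
      · rw [ha i k h, zero_mul]
      · rw [hb k j (hij.trans_le h), mul_zero]
    · rw [Units.val_mul, Matrix.mul_apply, Finset.sum_eq_single i, ha', hb', one_mul]
      · intro k _ hk
        rcases lt_or_gt_of_ne hk with h | h
        · rw [ha i k h, zero_mul]
        · rw [hb k i h, mul_zero]
      · simp
  inv_mem' := by
    rintro a ⟨ha, ha'⟩
    have htri : Matrix.BlockTriangular (a : Matrix (Fin n) (Fin n) F) id := fun i j h => ha i j h
    have hinv : ∀ i j, j < i → (a⁻¹ : GL (Fin n) F).val i j = 0 := by
      intro i j h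
      rw [Matrix.coe_units_inv]
      have : Invertible (a : Matrix (Fin n) (Fin n) F) := a.invertible
      exact Matrix.blockTriangular_inv_of_blockTriangular htri h
    refine ⟨hinv, fun i => ?_⟩
    have h1 : ((a : Matrix (Fin n) (Fin n) F) * (a⁻¹ : GL (Fin n) F).val) i i = 1 := by
      rw [← Units.val_mul, mul_inv_cancel]; simp
    rw [Matrix.mul_apply, Finset.sum_eq_single i, ha', one_mul] at h1
    · exact h1
    · intro k _ hk
      rcases lt_or_gt_of_ne hk with h | h
      · rw [ha i k h, zero_mul]
      · rw [hinv k i h, mul_zero]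
    · simp

/-- Position of the variable `y_{i+1}` in the ordered list `y_1, …, y_m, x_m, …, x_1`. -/
def yIdx {m : ℕ} (i : Fin m) : Fin (2 * m) := Fin.castLE (by omega) i

/-- Position of the variable `x_{i+1}` in the ordered list `y_1, …, y_m, x_m, …, x_1`. -/
def xIdx {m : ℕ} (i : Fin m) : Fin (2 * m) := Fin.rev (yIdx i)

/-- `ξ_0 = ∑ y_i x_i`, and `ξ_k = ∑ (y_i ^ (q^k) x_i + y_i x_i ^ (q^k))` for `k > 0`, where
`q = |F|`. -/
noncomputable def xi (m : ℕ) (F : Type*) [Field F] [Fintype F] (k : ℕ) :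
    MvPolynomial (Fin (2 * m)) F :=
  if k = 0 then ∑ i : Fin m, X (yIdx i) * X (xIdx i)
  else ∑ i : Fin m, (X (yIdx i) ^ (Fintype.card F ^ k) * X (xIdx i) +
    X (yIdx i) * X (xIdx i) ^ (Fintype.card F ^ k))

/-- The orthogonal group of plus type `O⁺_{2m}(F)`: the stabiliser of the quadratic form `ξ_0`. -/
noncomputable def orthogonalPlus (m : ℕ) (F : Type*) [Field F] [Fintype F] :
    Subgroup (GL (Fin (2 * m)) F) where
  carrier := {g | act g (xi m F 0) = xi m F 0}
  one_mem' := act_one _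
  mul_mem' {a b} ha hb := by
    simp only [Set.mem_ofPred_eq] at ha hb ⊢
    rw [act_mul, ha, hb]
  inv_mem' {a} ha := by
    simp only [Set.mem_ofPred_eq] at ha ⊢
    conv_lhs => rw [← ha]
    rw [← act_mul, mul_inv_cancel, act_one]

/-- The Sylow `p`-subgroup `P_m` of `O⁺_{2m}(F)` (`p = char F`): the intersection of `O⁺_{2m}(F)`
with the group of upper triangular unipotent matrices. -/
noncomputable def sylow (m : ℕ) (F : Type*) [Field F] [Fintype F] :
    Subgroup (GL (Fin (2 * m)) F) :=
  orthogonalPlus m F ⊓ upperUnipotent (2 * m) F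

/-- A commutative ring is Cohen–Macaulay if it is Noetherian and its localization at each maximal
ideal has depth equal to its Krull dimension. As the depth of a Noetherian local ring never
exceeds its dimension, the latter means that there is a regular sequence whose length is the
dimension. (`IsRegular` requires the sequence to generate a proper ideal, so its members lie in
the maximal ideal of the local ring.) -/
def IsCohenMacaulayRing (R : Type*) [CommRing R] : Prop :=
  IsNoetherianRing R ∧ ∀ (M : Ideal R) [M.IsMaximal],
    ∃ rs : List (Localization.AtPrime M),
      RingTheory.Sequence.IsRegular (Localization.AtPrime M) rs ∧
        (rs.length : WithBot ℕ∞) = ringKrullDim (Localization.AtPrime M)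

end OrthPlus

/-! Write q = |F|, S = S_m and P = P_m. The theorem follows from a sharper statement, `HasXiBasis`:
S^P is free over the polynomials in the orbit products, with a basis of monomials in the ξ_k, k ≤ 2m
− 3. This is proved by induction on m.

For the step from m to m + 1 let x = x_1, a fixed variable of the larger group. Two maps link the
levels: the reduction ρ modulo x, from S_{m+1} to S_m[y_1], and the homomorphism φ from S_m to
S_{m+1} with w ↦ w^q − x^{q−1}w = ∏_c (w + cx). The map φ is equivariant, carries the orbit products
of S_m to those of the middle variables, and satisfies ρφ(f) = f^q; moreover ρ(ξ_k) = ξ_k, and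
ρN(y_1) is monic of degree q^{2m} in y_1. The core is that ρ sends every invariant to a polynomial
in ρN(y_1) with coefficients in the algebra B generated by the q-th powers of S_m^P and ξ_0, …,
ξ_{2m−1} (`exists_rho_eq_sum`). Over the q-th powers, B has the basis ξ^d with all d_k < q. Hence a
basis ξ^e at level m yields the basis ξ^{qe+d} at level m + 1: independence follows by repeatedly
dividing a relation by x, spanning from a graded Nakayama argument.

That the ξ^d with 0 ≤ d_k < q are independent over S^q and that their S^q-span contains F[ξ_0, ξ_1,
…] rests on a duality. Let κ be the Cartier-type map `cartier`, which reads off the coefficient of ∏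
X_i^{q−1} over q-th powers, and let L be the Moore determinant. As κ commutes with GL_n and a
reflection negates L, κ(Lf) is negated by all reflections when f is a polynomial in the ξ_k. It is
therefore divisible by every anisotropic linear form; isotropic forms are reflections of variables,
for which a look at exponents suffices. So L divides κ(Lf), and a degree count makes ξ^d and
ξ^{q−1−c} dual under (f, g) ↦ κ(Lfg) up to a scalar multiple of L. The scalar is nonzero because
ξ_0, …, ξ_{2m−1} generate Frac S over q-th powers: a derivation killing them satisfies a linear
system with Moore matrix. The duality expresses the coefficients of an expansion through κ, and the
divisibility by L makes them polynomials.

To determine ρ on invariants, expand ξ_{2m} of S_m as ∑ b_d^q ξ^d; the b_d are invariant by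
uniqueness. Lifting with φ, ξ_{2m} − ∑ φ(b_d) ξ^d is x times an element z, with z monic of degree
q^{2m} in y_1 modulo x. Let A₀ be generated by x, z, φ(S_m^P) and ξ_0, …, ξ_{2m−1}. After inverting
x it contains all invariants, since ξ_0 can replace y_1 as a coordinate; and xg ∈ A₀ implies g ∈ A₀
by independence of the ξ^d. Thus A₀ contains all invariants, and comparing degrees lets N(y_1)
replace z.

Cohen–Macaulayness is formal: over a polynomial ring, a finite free algebra inherits regular
sequences by flatness. -/

namespace OrthPlus

set_option linter.unusedSectionVars false
set_option linter.unusedSimpArgs false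

/-! ### A Cartier operator and its equivariance under GL_n -/

section Cartier

variable {F : Type*} [Field F] [Fintype F] {n : ℕ}

/-- The linear substitution `X_i ↦ ∑ j, M i j X_j`. -/
noncomputable def linSubst (M : Matrix (Fin n) (Fin n) F) :
    MvPolynomial (Fin n) F →ₐ[F] MvPolynomial (Fin n) F :=
  aeval fun i => ∑ j, C (M i j) * X j

theorem linSubst_X (M : Matrix (Fin n) (Fin n) F) (i : Fin n) :
    linSubst M (X i) = ∑ j, C (M i j) * X j := by
  simp [linSubst]

theorem act_eq_linSubst (g : GL (Fin n) F) : act g = linSubst (g : Matrix (Fin n) (Fin n) F) := rfl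

theorem linSubst_mul (A B : Matrix (Fin n) (Fin n) F) :
    linSubst (A * B) = (linSubst B).comp (linSubst A) := by
  ext1 i
  simp only [linSubst_X, AlgHom.comp_apply, map_sum, map_mul, algHom_C, algebraMap_eq,
    Matrix.mul_apply, Finset.sum_mul, Finset.mul_sum]
  rw [Finset.sum_comm]
  simp only [mul_assoc]

theorem linear_isHomogeneous (a : Fin n → F) :
    (∑ j, C (a j) * X j : MvPolynomial (Fin n) F).IsHomogeneous 1 :=
  IsHomogeneous.sum _ _ _ fun j _ => by
    simpa using (isHomogeneous_C (Fin n) (a j)).mul (isHomogeneous_X F j)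

theorem linSubst_isHomogeneous (M : Matrix (Fin n) (Fin n) F) {f : MvPolynomial (Fin n) F} {d : ℕ}
    (hf : f.IsHomogeneous d) : (linSubst M f).IsHomogeneous d := by
  have := hf.aeval _ fun i => linear_isHomogeneous (M i)
  rwa [one_mul] at this

theorem pow_card_monomial (e : Fin n →₀ ℕ) (a : F) :
    (monomial e a) ^ Fintype.card F = monomial (Fintype.card F • e) a := by
  rw [monomial_pow, FiniteField.pow_card]

theorem add_pow_card {A : Type*} [CommRing A] [Algebra F A] (a b : A) :
    (a + b) ^ Fintype.card F = a ^ Fintype.card F + b ^ Fintype.card F :=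
  map_add (FiniteField.frobeniusAlgHom F A) a b

theorem sub_pow_card {A : Type*} [CommRing A] [Algebra F A] (a b : A) :
    (a - b) ^ Fintype.card F = a ^ Fintype.card F - b ^ Fintype.card F :=
  map_sub (FiniteField.frobeniusAlgHom F A) a b

theorem sum_pow_card {A ι : Type*} [CommRing A] [Algebra F A] (s : Finset ι) (a : ι → A) :
    (∑ i ∈ s, a i) ^ Fintype.card F = ∑ i ∈ s, a i ^ Fintype.card F :=
  map_sum (FiniteField.frobeniusAlgHom F A) a s

/-- The exponent all of whose entries are `q - 1`. -/
noncomputable def topExp (F : Type*) [Fintype F] (n : ℕ) : Fin n →₀ ℕ :=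
  Finsupp.equivFunOnFinite.symm fun _ => Fintype.card F - 1

@[simp] theorem topExp_apply (i : Fin n) : topExp F n i = Fintype.card F - 1 := rfl

theorem topExp_degree : (topExp F n).degree = n * (Fintype.card F - 1) := by
  simp [Finsupp.degree_eq_sum]

open Classical in
/-- The `F`-linear map extracting the coefficient of `∏ X_i ^ (q - 1)` in the expansion of a
polynomial over the ring of `q`-th powers, followed by extraction of the `q`-th root. -/
noncomputable def cartier : MvPolynomial (Fin n) F →ₗ[F] MvPolynomial (Fin n) F :=
  (basisMonomials (Fin n) F).constr F fun e =>
    if ∀ i, e i % Fintype.card F = Fintype.card F - 1 then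
      monomial (e.mapRange (· / Fintype.card F) (Nat.zero_div _)) 1 else 0

open Classical in
theorem cartier_monomial (e : Fin n →₀ ℕ) (a : F) :
    cartier (monomial e a) = if ∀ i, e i % Fintype.card F = Fintype.card F - 1 then
      monomial (e.mapRange (· / Fintype.card F) (Nat.zero_div _)) a else 0 := by
  have : monomial e a = a • basisMonomials (Fin n) F e := by simp [smul_monomial]
  rw [this, map_smul, cartier, Module.Basis.constr_basis]
  split_ifs <;> simp [smul_monomial]

theorem coeff_cartier (f : MvPolynomial (Fin n) F) (d : Fin n →₀ ℕ) :
    coeff d (cartier f) = coeff (Fintype.card F • d + topExp F n) f := by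
  classical
  have hq : 1 < Fintype.card F := Fintype.one_lt_card
  induction f using MvPolynomial.induction_on' with
  | add p r hp hr => simp [hp, hr]
  | monomial e a =>
    rw [cartier_monomial, coeff_monomial]
    by_cases h : e = Fintype.card F • d + topExp F n
    · have h1 : ∀ i, e i % Fintype.card F = Fintype.card F - 1 := by
        intro i
        simp only [h, Finsupp.add_apply, Finsupp.smul_apply, topExp_apply, smul_eq_mul,
          Nat.mul_add_mod]
        exact Nat.mod_eq_of_lt (by omega)
      have h2 : e.mapRange (· / Fintype.card F) (Nat.zero_div _) = d := by
        ext i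
        simp only [Finsupp.mapRange_apply, h, Finsupp.add_apply, Finsupp.smul_apply, topExp_apply,
          smul_eq_mul]
        rw [Nat.mul_add_div (by omega), Nat.div_eq_of_lt (by omega), add_zero]
      rw [if_pos h1, h2, coeff_monomial, if_pos rfl, if_pos h]
    · rw [if_neg h]
      split_ifs with h1
      · rw [coeff_monomial, if_neg]
        rintro rfl
        apply h
        ext i
        simp only [Finsupp.add_apply, Finsupp.smul_apply, topExp_apply, smul_eq_mul,
          Finsupp.mapRange_apply]
        rw [← h1 i, Nat.div_add_mod]
      · simp

/-- Multiplication by a q-th power shifts exponents by multiples of q and so does not touch their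
residues; coefficients in F are their own q-th powers. -/
theorem cartier_pow_mul (f g : MvPolynomial (Fin n) F) :
    cartier (f ^ Fintype.card F * g) = f * cartier g := by
  classical
  have hq : 1 < Fintype.card F := Fintype.one_lt_card
  induction f using MvPolynomial.induction_on' with
  | add p r hp hr => rw [add_pow_card, add_mul, map_add, hp, hr, add_mul]
  | monomial e a =>
    ext d
    rw [pow_card_monomial, coeff_cartier, coeff_monomial_mul', coeff_monomial_mul', coeff_cartier]
    have h : Fintype.card F • e ≤ Fintype.card F • d + topExp F n ↔ e ≤ d := by
      refine forall_congr' fun i => ?_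
      simp only [Finsupp.add_apply, Finsupp.smul_apply, topExp_apply, smul_eq_mul]
      constructor
      · intro h
        by_contra! h'
        have : Fintype.card F * (d i + 1) ≤ Fintype.card F * e i := Nat.mul_le_mul_left _ h'
        rw [Nat.mul_add] at this
        omega
      · intro h
        exact (Nat.mul_le_mul_left _ h).trans (Nat.le_add_right _ _)
    simp only [h]
    split_ifs with h1
    · congr 2
      ext i
      have := Nat.mul_le_mul_left (Fintype.card F) (h1 i)
      simp only [Finsupp.add_apply, Finsupp.smul_apply, topExp_apply, smul_eq_mul,
        Finsupp.tsub_apply, Nat.mul_sub]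
      omega
    · rfl

theorem totalDegree_cartier {f : MvPolynomial (Fin n) F} (hf : cartier f ≠ 0) :
    Fintype.card F * (cartier f).totalDegree + n * (Fintype.card F - 1) ≤ f.totalDegree := by
  obtain ⟨d, hd, hd'⟩ := Finset.exists_mem_eq_sup (cartier f).support (support_nonempty.mpr hf)
    (fun s => s.sum fun _ e => e)
  have h : (cartier f).totalDegree = d.sum fun _ e => e := hd'
  rw [mem_support_iff, coeff_cartier, ← mem_support_iff] at hd
  have h2 := le_totalDegree hd
  rw [h]
  refine le_trans (le_of_eq ?_) h2
  rw [← topExp_degree (F := F)]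
  change _ * Finsupp.degree d + _ = Finsupp.degree _
  simp [map_add, map_nsmul]

theorem cartier_eq_zero_of_totalDegree_lt {f : MvPolynomial (Fin n) F}
    (hf : f.totalDegree < n * (Fintype.card F - 1)) : cartier f = 0 := by
  by_contra h
  have := totalDegree_cartier h
  omega

theorem cartier_topExp : cartier (monomial (topExp F n) (1 : F)) = 1 := by
  ext d
  classical
  have hq : 1 < Fintype.card F := Fintype.one_lt_card
  rw [coeff_cartier, coeff_monomial, coeff_one]
  congr 1
  simp only [eq_iff_iff]
  constructor
  · intro h
    have : Fintype.card F • d = 0 := by simpa using h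
    ext i
    have := DFunLike.congr_fun this i
    simp only [Finsupp.smul_apply, smul_eq_mul, Finsupp.coe_zero, Pi.zero_apply, mul_eq_zero] at this
    simp only [Finsupp.coe_zero, Pi.zero_apply]
    omega
  · rintro rfl
    simp

/-- By `cartier_pow_mul` only monomials with all exponents below q need checking. Except for the top
one, these have degree less than n(q − 1), as do their images under a linear substitution, and the
operator kills everything of such degree. Only the top monomial remains. -/
theorem cartier_linSubst_of_topExp {M : Matrix (Fin n) (Fin n) F}
    (hM : cartier (linSubst M (monomial (topExp F n) 1)) = 1) (f : MvPolynomial (Fin n) F) :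
    cartier (linSubst M f) = linSubst M (cartier f) := by
  have hq : 1 < Fintype.card F := Fintype.one_lt_card
  induction f using MvPolynomial.induction_on' with
  | add p r hp hr => simp only [map_add, hp, hr]
  | monomial e a =>
    set a' := e.mapRange (· / Fintype.card F) (Nat.zero_div _) with ha'
    set b := e.mapRange (· % Fintype.card F) (Nat.zero_mod _) with hb
    have he : monomial e a = monomial a' a ^ Fintype.card F * monomial b 1 := by
      rw [pow_card_monomial, monomial_mul, mul_one]
      refine congrArg (fun e => monomial e a) ?_
      refine Finsupp.ext fun i => ?_
      simp [ha', hb, Nat.div_add_mod]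
    rw [he, map_mul, map_pow, cartier_pow_mul, cartier_pow_mul, map_mul]
    congr 1
    by_cases h : b = topExp F n
    · rw [h, hM, cartier_topExp, map_one]
    · have hlt : b.degree < n * (Fintype.card F - 1) := by
        rw [← topExp_degree, Finsupp.degree_eq_sum, Finsupp.degree_eq_sum]
        have hle : ∀ i, b i ≤ topExp F n i := fun i => by
          have := Nat.mod_lt (e i) (by omega : Fintype.card F > 0)
          simp [hb]; omega
        refine Finset.sum_lt_sum (fun i _ => hle i) ?_
        by_contra! h'
        exact h (Finsupp.ext fun i => le_antisymm (hle i) (h' i (Finset.mem_univ i)))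
      have hh : (monomial b (1 : F)).IsHomogeneous b.degree := isHomogeneous_monomial _ rfl
      rw [cartier_eq_zero_of_totalDegree_lt, cartier_eq_zero_of_totalDegree_lt, map_zero]
      · exact hh.totalDegree_le.trans_lt hlt
      · exact (linSubst_isHomogeneous M hh).totalDegree_le.trans_lt hlt

theorem monomial_topExp : monomial (topExp F n) (1 : F) = ∏ i, X i ^ (Fintype.card F - 1) := by
  rw [monomial_eq]
  simp [Finsupp.prod_fintype]

/-- A diagonal substitution fixes the top monomial, since nonzero scalars satisfy c^{q−1} = 1. -/
theorem cartier_linSubst_diagonal (D : Fin n → F) (hD : (Matrix.diagonal D).det ≠ 0)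
    (f : MvPolynomial (Fin n) F) :
    cartier (linSubst (Matrix.diagonal D) f) = linSubst (Matrix.diagonal D) (cartier f) := by
  apply cartier_linSubst_of_topExp
  have : linSubst (Matrix.diagonal D) (monomial (topExp F n) 1) = monomial (topExp F n) 1 := by
    rw [monomial_topExp, map_prod]
    refine Finset.prod_congr rfl fun i _ => ?_
    have hDi : D i ≠ 0 := by
      rw [Matrix.det_diagonal] at hD
      exact Finset.prod_ne_zero_iff.mp hD i (Finset.mem_univ i)
    have h1 : linSubst (Matrix.diagonal D) (X i) = C (D i) * X i := by
      rw [linSubst_X, Finset.sum_eq_single i]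
      · simp
      · intro j _ hj
        simp [Matrix.diagonal_apply_ne _ hj.symm]
      · simp
    rw [map_pow, h1, mul_pow, ← C_pow, FiniteField.pow_card_sub_one_eq_one _ hDi, C_1, one_mul]
  rw [this, cartier_topExp]

/-- Replacing X_i by X_i + cX_j changes the top monomial by a multiple of X_j^q. The cofactor has
degree at most n(q − 1) − q, which is too small to survive the operator. -/
theorem cartier_linSubst_transvection (t : Matrix.TransvectionStruct (Fin n) F)
    (f : MvPolynomial (Fin n) F) :
    cartier (linSubst t.toMatrix f) = linSubst t.toMatrix (cartier f) := by
  have hq : 1 < Fintype.card F := Fintype.one_lt_card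
  apply cartier_linSubst_of_topExp
  obtain ⟨i, j, hij, c⟩ := t
  have hk : ∀ k, linSubst (Matrix.TransvectionStruct.mk i j hij c).toMatrix (X k) =
      X k + if k = i then C c * X j else 0 := by
    intro k
    rw [linSubst_X]
    simp only [Matrix.TransvectionStruct.toMatrix_mk, Matrix.transvection, Matrix.add_apply, C_add,
      add_mul, Finset.sum_add_distrib]
    congr 1
    · rw [Finset.sum_eq_single k]
      · simp
      · intro l _ hl
        simp [Matrix.one_apply_ne hl.symm]
      · simp
    · split_ifs with h
      · subst h
        rw [Finset.sum_eq_single j]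
        · simp
        · intro l _ hl
          simp [Matrix.single_apply, hl.symm]
        · simp
      · refine Finset.sum_eq_zero fun l _ => ?_
        simp [Matrix.single_apply, Ne.symm h]
  set T := linSubst (Matrix.TransvectionStruct.mk i j hij c).toMatrix with hT
  set R : MvPolynomial (Fin n) F :=
    ∏ k ∈ (Finset.univ.erase i).erase j, X k ^ (Fintype.card F - 1) with hR
  have hj : j ∈ Finset.univ.erase i := by simp [hij.symm]
  have htop : monomial (topExp F n) (1 : F) =
      X i ^ (Fintype.card F - 1) * (X j ^ (Fintype.card F - 1) * R) := by
    rw [monomial_topExp, hR,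
      Finset.mul_prod_erase _ (fun k => (X k : MvPolynomial (Fin n) F) ^ (Fintype.card F - 1)) hj,
      Finset.mul_prod_erase _ (fun k => (X k : MvPolynomial (Fin n) F) ^ (Fintype.card F - 1))
        (Finset.mem_univ i)]
  have hTR : T R = R := by
    rw [hR, map_prod]
    refine Finset.prod_congr rfl fun k hk' => ?_
    simp only [Finset.mem_erase] at hk'
    rw [map_pow, hk, if_neg hk'.2.1, add_zero]
  obtain ⟨u, hu⟩ := sub_dvd_pow_sub_pow (X i + C c * X j : MvPolynomial (Fin n) F) (X i)
    (Fintype.card F - 1)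
  have hTt : T (monomial (topExp F n) 1) = monomial (topExp F n) 1 +
      X j ^ Fintype.card F * (C c * u * R) := by
    rw [htop, map_mul, map_mul, hTR, map_pow, map_pow, hk, hk, if_pos rfl, if_neg hij.symm,
      add_zero, eq_add_of_sub_eq hu]
    have : (X j : MvPolynomial (Fin n) F) ^ Fintype.card F = X j * X j ^ (Fintype.card F - 1) := by
      rw [← pow_succ', Nat.sub_add_cancel hq.le]
    rw [this]
    ring
  rw [hTt, map_add, cartier_topExp, cartier_pow_mul]
  suffices cartier (C c * u * R) = 0 by rw [this, mul_zero, add_zero]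
  by_cases h0 : C c * u * R = 0
  · rw [h0, map_zero]
  apply cartier_eq_zero_of_totalDegree_lt
  have hh : (monomial (topExp F n) (1 : F)).IsHomogeneous (n * (Fintype.card F - 1)) :=
    isHomogeneous_monomial _ topExp_degree
  have h1 : (X j ^ Fintype.card F * (C c * u * R)).totalDegree ≤ n * (Fintype.card F - 1) := by
    rw [← add_sub_cancel_left (monomial (topExp F n) (1 : F)) (_ * _), ← hTt]
    exact ((linSubst_isHomogeneous _ hh).sub hh).totalDegree_le
  rw [totalDegree_mul_of_isDomain (pow_ne_zero _ (X_ne_zero j)) h0, totalDegree_X_pow] at h1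
  omega

/-- The map `cartier` commutes with invertible linear substitutions. -/
theorem cartier_linSubst {M : Matrix (Fin n) (Fin n) F} (hM : M.det ≠ 0)
    (f : MvPolynomial (Fin n) F) : cartier (linSubst M f) = linSubst M (cartier f) := by
  revert f
  refine Matrix.diagonal_transvection_induction_of_det_ne_zero
    (fun M => ∀ f, cartier (linSubst M f) = linSubst M (cartier f)) M hM
    cartier_linSubst_diagonal cartier_linSubst_transvection ?_
  intro A B _ _ hA hB f
  rw [linSubst_mul, AlgHom.comp_apply, hB, hA, AlgHom.comp_apply]

end Cartier

/-! ### The bilinear form, invariance of the ξ_k, and reflections -/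

section Form

variable {F : Type*} [Field F] [Fintype F] {m : ℕ}

theorem sum_yIdx_add_xIdx {A : Type*} [AddCommMonoid A] (f : Fin (2 * m) → A) :
    ∑ j, f j = ∑ i : Fin m, (f (yIdx i) + f (xIdx i)) := by
  rw [Finset.sum_add_distrib]
  have hb : Function.Bijective (Sum.elim (yIdx (m := m)) xIdx) := by
    rw [Fintype.bijective_iff_injective_and_card]
    constructor
    · rintro (i | i) (j | j) h <;>
      · simp only [Sum.elim_inl, Sum.elim_inr, yIdx, xIdx, Fin.ext_iff, Fin.val_rev,
          Fin.val_castLE] at h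
        have := i.2
        have := j.2
        first
        | (exfalso; omega)
        | (congr 1; ext; omega)
    · simp; omega
  rw [← hb.sum_comp f, Fintype.sum_sum_type]
  rfl

@[simp] theorem rev_yIdx (i : Fin m) : (yIdx i).rev = xIdx i := rfl

@[simp] theorem rev_xIdx (i : Fin m) : (xIdx i).rev = yIdx i := Fin.rev_rev _

/-- The symmetric bilinear form attached to `ξ_0`. -/
def pairing {A : Type*} [CommRing A] (u v : Fin (2 * m) → A) : A := ∑ j, u j * v j.rev

theorem pairing_eq {A : Type*} [CommRing A] (u v : Fin (2 * m) → A) :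
    pairing u v = ∑ i : Fin m, (u (yIdx i) * v (xIdx i) + u (xIdx i) * v (yIdx i)) := by
  rw [pairing, sum_yIdx_add_xIdx]
  simp

theorem pairing_comm {A : Type*} [CommRing A] (u v : Fin (2 * m) → A) :
    pairing u v = pairing v u := by
  rw [pairing_eq, pairing_eq]
  exact Finset.sum_congr rfl fun i _ => by ring

theorem pairing_sub_left {A : Type*} [CommRing A] (u u' v : Fin (2 * m) → A) :
    pairing (u - u') v = pairing u v - pairing u' v := by
  simp [pairing, sub_mul]

theorem pairing_sub_right {A : Type*} [CommRing A] (u v v' : Fin (2 * m) → A) :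
    pairing u (v - v') = pairing u v - pairing u v' := by
  simp [pairing, mul_sub]

theorem xi_eq_pairing {k : ℕ} (hk : k ≠ 0) :
    xi m F k = pairing (fun j => X j ^ (Fintype.card F ^ k)) X := by
  rw [pairing_eq, xi, if_neg hk]
  exact Finset.sum_congr rfl fun i _ => by ring

theorem two_mul_xi_zero : 2 * xi m F 0 = pairing X X := by
  rw [pairing_eq, xi, if_pos rfl, Finset.mul_sum]
  exact Finset.sum_congr rfl fun i _ => by ring

theorem aeval_xi_zero {A : Type*} [CommRing A] [Algebra F A] (v : Fin (2 * m) → A) :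
    aeval v (xi m F 0) = ∑ i : Fin m, v (yIdx i) * v (xIdx i) := by
  simp [xi]

theorem aeval_xi_zero_add {A : Type*} [CommRing A] [Algebra F A] (u v : Fin (2 * m) → A) :
    aeval (u + v) (xi m F 0) = aeval u (xi m F 0) + aeval v (xi m F 0) + pairing u v := by
  rw [aeval_xi_zero, aeval_xi_zero, aeval_xi_zero, pairing_eq, ← Finset.sum_add_distrib,
    ← Finset.sum_add_distrib]
  exact Finset.sum_congr rfl fun i _ => by simp only [Pi.add_apply]; ring

theorem aeval_act {n : ℕ} {A : Type*} [CommRing A] [Algebra F A] (g : GL (Fin n) F)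
    (v : Fin n → A) (f : MvPolynomial (Fin n) F) :
    aeval v (act g f) =
      aeval (fun i => ∑ j, algebraMap F A ((g : Matrix (Fin n) (Fin n) F) i j) * v j) f := by
  rw [← AlgHom.comp_apply]
  congr 1
  ext1 i
  simp [act_X]

/-- Polarisation of the invariance of ξ_0. Vectors over any algebra are allowed, so that the
statement applies both to Frobenius powers of the variables and to standard basis vectors. -/
theorem pairing_orthogonal {g : GL (Fin (2 * m)) F} (hg : g ∈ orthogonalPlus m F) {A : Type*}
    [CommRing A] [Algebra F A] (u v : Fin (2 * m) → A) :
    pairing (fun i => ∑ j, algebraMap F A ((g : Matrix (Fin (2 * m)) (Fin (2 * m)) F) i j) * u j)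
      (fun i => ∑ j, algebraMap F A ((g : Matrix (Fin (2 * m)) (Fin (2 * m)) F) i j) * v j) =
      pairing u v := by
  have hg' : act g (xi m F 0) = xi m F 0 := hg
  have key : ∀ w : Fin (2 * m) → A, aeval (fun i => ∑ j, algebraMap F A
      ((g : Matrix (Fin (2 * m)) (Fin (2 * m)) F) i j) * w j) (xi m F 0) =
        aeval w (xi m F 0) := fun w => by
    rw [← aeval_act, hg']
  have h1 := aeval_xi_zero_add (F := F) (fun i => ∑ j, algebraMap F A
      ((g : Matrix (Fin (2 * m)) (Fin (2 * m)) F) i j) * u j) (fun i => ∑ j, algebraMap F A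
      ((g : Matrix (Fin (2 * m)) (Fin (2 * m)) F) i j) * v j)
  have h2 := key (u + v)
  have h3 : (fun i => ∑ j, algebraMap F A
      ((g : Matrix (Fin (2 * m)) (Fin (2 * m)) F) i j) * (u + v) j) = (fun i => ∑ j, algebraMap F A
      ((g : Matrix (Fin (2 * m)) (Fin (2 * m)) F) i j) * u j) + (fun i => ∑ j, algebraMap F A
      ((g : Matrix (Fin (2 * m)) (Fin (2 * m)) F) i j) * v j) := by
    ext i
    simp [mul_add, Finset.sum_add_distrib]
  rw [h3, h1, aeval_xi_zero_add, key, key] at h2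
  exact add_left_cancel h2

theorem act_X_pow {n : ℕ} (g : GL (Fin n) F) (i : Fin n) (k : ℕ) :
    act g (X i ^ (Fintype.card F ^ k)) =
      ∑ j, C ((g : Matrix (Fin n) (Fin n) F) i j) * X j ^ (Fintype.card F ^ k) := by
  induction k with
  | zero => simp [act_X]
  | succ k ih =>
    rw [pow_succ, pow_mul, map_pow, ih, sum_pow_card]
    refine Finset.sum_congr rfl fun j _ => ?_
    rw [mul_pow, ← C_pow, FiniteField.pow_card, ← pow_mul]

/-- All the `ξ_k` are invariant under the orthogonal group. -/
theorem act_xi {g : GL (Fin (2 * m)) F} (hg : g ∈ orthogonalPlus m F) (k : ℕ) :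
    act g (xi m F k) = xi m F k := by
  rcases eq_or_ne k 0 with rfl | hk
  · exact hg
  · rw [xi_eq_pairing hk]
    have h := pairing_orthogonal hg (fun j => (X j : MvPolynomial (Fin (2 * m)) F) ^
      (Fintype.card F ^ k)) X
    refine Eq.trans ?_ h
    rw [pairing, map_sum]
    exact Finset.sum_congr rfl fun j _ => by rw [map_mul, act_X_pow, act_X]; rfl

/-- Invariance of the pairing gives this relation for the columns, that is, a left inverse of the
matrix. It is also a right inverse, which is the relation for the rows. -/
theorem orthogonal_row {g : GL (Fin (2 * m)) F} (hg : g ∈ orthogonalPlus m F)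
    (i k : Fin (2 * m)) :
    pairing ((g : Matrix (Fin (2 * m)) (Fin (2 * m)) F) i)
      ((g : Matrix (Fin (2 * m)) (Fin (2 * m)) F) k) = if i = k.rev then 1 else 0 := by
  set M := (g : Matrix (Fin (2 * m)) (Fin (2 * m)) F) with hM
  set M' : Matrix (Fin (2 * m)) (Fin (2 * m)) F := Matrix.of fun a b => M b.rev a.rev with hM'
  have h1 : M' * M = 1 := by
    ext a b
    have h := pairing_orthogonal hg (Pi.single a.rev (1 : F)) (Pi.single b 1)
    simp only [Algebra.algebraMap_self, RingHom.id_apply, Pi.single_apply, mul_ite, mul_one,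
      mul_zero, Finset.sum_ite_eq', Finset.mem_univ, if_true] at h
    rw [Matrix.mul_apply, Matrix.one_apply, ← Equiv.sum_comp Fin.revPerm]
    simp only [pairing, Fin.revPerm_apply, hM', Matrix.of_apply, Fin.rev_rev] at h ⊢
    rw [h]
    rw [Finset.sum_eq_single a.rev]
    · simp [Pi.single_apply]
    · intro j _ hj
      simp [Pi.single_apply, hj]
    · simp
  have h2 := congrArg (fun N : Matrix _ _ F => N i k.rev) (mul_eq_one_comm.mp h1)
  rw [Matrix.mul_apply, Matrix.one_apply] at h2
  simpa [pairing, hM'] using h2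

/-- The linear form with coefficient vector `a`. -/
noncomputable def linForm {n : ℕ} (a : Fin n → F) : MvPolynomial (Fin n) F := ∑ j, C (a j) * X j

theorem act_linForm {n : ℕ} (g : GL (Fin n) F) (a : Fin n → F) :
    act g (linForm a) = linForm (Matrix.vecMul a (g : Matrix (Fin n) (Fin n) F)) := by
  simp only [linForm, map_sum, map_mul, act_X, algHom_C, algebraMap_eq, Matrix.vecMul, dotProduct,
    Finset.mul_sum, Finset.sum_mul]
  rw [Finset.sum_comm]
  simp only [mul_assoc]

/-- The matrix of the reflection in `a`. -/
noncomputable def reflMatrix (a : Fin (2 * m) → F) : Matrix (Fin (2 * m)) (Fin (2 * m)) F :=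
  1 - Matrix.vecMulVec (fun i => 2 / pairing a a * a i.rev) a

theorem det_reflMatrix {a : Fin (2 * m) → F} (ha : pairing a a ≠ 0) : (reflMatrix a).det = -1 := by
  have h : Matrix.vecMulVec (fun i : Fin (2 * m) => 2 / pairing a a * a i.rev) a =
      Matrix.replicateCol Unit (fun i : Fin (2 * m) => 2 / pairing a a * a i.rev) *
        Matrix.replicateRow Unit a := by
    rw [Matrix.vecMulVec_eq Unit]
  rw [reflMatrix, h, Matrix.det_one_sub_mul_comm, Matrix.det_unique]
  have : (Matrix.replicateRow Unit a * Matrix.replicateCol Unit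
      (fun i : Fin (2 * m) => 2 / pairing a a * a i.rev)) () () = 2 := by
    rw [Matrix.mul_apply]
    simp only [Matrix.replicateRow_apply, Matrix.replicateCol_apply]
    have : ∀ j, a j * (2 / pairing a a * a j.rev) = 2 / pairing a a * (a j * a j.rev) :=
      fun j => by ring
    simp only [this, ← Finset.mul_sum]
    exact div_mul_cancel₀ _ ha
  rw [Matrix.sub_apply]
  change (1 : Matrix Unit Unit F) () () - (Matrix.replicateRow Unit a * Matrix.replicateCol Unit
      (fun i : Fin (2 * m) => 2 / pairing a a * a i.rev)) () () = -1
  rw [this]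
  norm_num

/-- The reflection in an anisotropic vector `a`. -/
noncomputable def refl (a : Fin (2 * m) → F) (ha : pairing a a ≠ 0) : GL (Fin (2 * m)) F :=
  Matrix.GeneralLinearGroup.mkOfDetNeZero (reflMatrix a) (by
    rw [det_reflMatrix ha]; exact neg_ne_zero.mpr one_ne_zero)

theorem coe_refl (a : Fin (2 * m) → F) (ha : pairing a a ≠ 0) :
    (refl a ha : Matrix (Fin (2 * m)) (Fin (2 * m)) F) = reflMatrix a := rfl

theorem act_refl_X {a : Fin (2 * m) → F} (ha : pairing a a ≠ 0) (i : Fin (2 * m)) :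
    act (refl a ha) (X i) = X i - C (2 / pairing a a * a i.rev) * linForm a := by
  rw [act_X, coe_refl, reflMatrix]
  simp only [Matrix.sub_apply, C_sub, sub_mul, Finset.sum_sub_distrib, Matrix.vecMulVec_apply]
  congr 1
  · rw [Finset.sum_eq_single i]
    · simp
    · intro j _ hj
      simp [Matrix.one_apply_ne hj.symm]
    · simp
  · simp [linForm, Finset.mul_sum, mul_assoc]

theorem two_ne_zero_of_ringChar (hF : ringChar F ≠ 2) : (2 : F) ≠ 0 := Ring.two_ne_zero hF

theorem two_ne_zero_mvPolynomial (hF : ringChar F ≠ 2) {σ : Type*} :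
    (2 : MvPolynomial σ F) ≠ 0 := by
  rw [← map_ofNat C 2]
  exact (map_ne_zero_iff _ (C_injective _ _)).mpr (Ring.two_ne_zero hF)

theorem refl_mem (hF : ringChar F ≠ 2) {a : Fin (2 * m) → F} (ha : pairing a a ≠ 0) :
    refl a ha ∈ orthogonalPlus m F := by
  change act (refl a ha) (xi m F 0) = xi m F 0
  apply mul_left_cancel₀ (two_ne_zero_mvPolynomial hF)
  have h2 : act (refl a ha) (2 * xi m F 0) = 2 * act (refl a ha) (xi m F 0) := by
    rw [map_mul, map_ofNat]
  rw [← h2, two_mul_xi_zero, pairing, map_sum]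
  simp only [map_mul, act_refl_X, Fin.rev_rev]
  set N := pairing a a with hN
  have e1 : ∀ j : Fin (2 * m), (X j - C (2 / N) * C (a j.rev) * linForm a) *
      (X j.rev - C (2 / N) * C (a j) * linForm a) = X j * X j.rev -
      C (2 / N) * linForm a * (C (a j) * X j) -
      C (2 / N) * linForm a * (C (a j.rev) * X j.rev) +
      C (2 / N) ^ 2 * linForm a ^ 2 * C (a j * a j.rev) := by
    intro j
    simp only [C_mul]
    ring
  simp only [e1, Finset.sum_add_distrib, Finset.sum_sub_distrib, ← Finset.mul_sum]
  have e2 : ∑ j : Fin (2 * m), C (a j.rev) * X j.rev = linForm a :=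
    Equiv.sum_comp Fin.revPerm (fun j => C (a j) * X j)
  have e3 : ∑ j : Fin (2 * m), C (a j) * X j = linForm a := rfl
  have e4 : ∑ j, (C (a j * a j.rev) : MvPolynomial (Fin (2 * m)) F) = C N := by
    rw [hN, pairing, map_sum]
  have e5 : (C (2 / N) ^ 2 * C N : MvPolynomial (Fin (2 * m)) F) = 2 * C (2 / N) := by
    rw [← map_ofNat C 2, ← C_pow, ← C_mul, ← C_mul]
    congr 1
    field_simp
  rw [e2, e3, e4]
  linear_combination (linForm a) ^ 2 * e5

end Form

/-! ### The Moore determinant and divisibility of κ(Lf) by linear forms -/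

section Moore

variable {F : Type*} [Field F] [Fintype F] {n m : ℕ}

/-- The Moore matrix of the variables. -/
noncomputable def mooreMatrix (F : Type*) [Field F] [Fintype F] (n : ℕ) :
    Matrix (Fin n) (Fin n) (MvPolynomial (Fin n) F) :=
  Matrix.of fun i j => X i ^ (Fintype.card F ^ (j : ℕ))

/-- The Moore determinant of the variables. -/
noncomputable def mooreDet (F : Type*) [Field F] [Fintype F] (n : ℕ) : MvPolynomial (Fin n) F :=
  (mooreMatrix F n).det

/-- Entries of g are fixed by Frobenius, so g acts on the Moore matrix by left multiplication. -/
theorem act_mooreDet (g : GL (Fin n) F) :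
    act g (mooreDet F n) = C (g : Matrix (Fin n) (Fin n) F).det * mooreDet F n := by
  have h : (act g).mapMatrix (mooreMatrix F n) =
      (g : Matrix (Fin n) (Fin n) F).map C * mooreMatrix F n := by
    ext1 i j
    rw [AlgHom.mapMatrix_apply, Matrix.map_apply, mooreMatrix, Matrix.of_apply, act_X_pow,
      Matrix.mul_apply]
    rfl
  rw [mooreDet, AlgHom.map_det, h, Matrix.det_mul]
  congr 1
  exact (RingHom.map_det C _).symm

/-- The diagonal monomial ∏ X_j^{q^j} arises from the identity permutation alone. -/
theorem mooreDet_ne_zero : mooreDet F n ≠ 0 := by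
  classical
  have hq : 1 < Fintype.card F := Fintype.one_lt_card
  have hterm : ∀ σ : Equiv.Perm (Fin n), ∏ i, mooreMatrix F n (σ i) i =
      monomial (Finsupp.equivFunOnFinite.symm fun j => Fintype.card F ^ ((σ⁻¹ j : Fin n) : ℕ))
        (1 : F) := by
    intro σ
    rw [monomial_eq, C_1, one_mul, Finsupp.prod_fintype _ _ (by simp), ← Equiv.prod_comp σ (fun j => (X j : MvPolynomial (Fin n) F) ^ _)]
    refine Finset.prod_congr rfl fun i _ => ?_
    simp [mooreMatrix]
  have hc : coeff (Finsupp.equivFunOnFinite.symm fun j : Fin n => Fintype.card F ^ (j : ℕ))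
      (mooreDet F n) = 1 := by
    rw [mooreDet, Matrix.det_apply, coeff_sum, Finset.sum_eq_single 1]
    · rw [hterm]
      simp
    · intro σ _ hσ
      rw [hterm, Units.smul_def, zsmul_eq_mul, ← map_intCast (C : F →+* _), coeff_C_mul,
        coeff_monomial, if_neg, mul_zero]
      intro h
      apply hσ
      have : σ⁻¹ = 1 := by
        ext j
        have h2 := DFunLike.congr_fun h j
        simp only [Finsupp.equivFunOnFinite_symm_apply_apply] at h2
        simpa using Nat.pow_right_injective hq h2
      simpa using this
    · simp
  intro h
  rw [h] at hc
  simp at hc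

theorem mooreDet_isHomogeneous :
    (mooreDet F n).IsHomogeneous (∑ j : Fin n, Fintype.card F ^ (j : ℕ)) := by
  rw [mooreDet, Matrix.det_apply]
  refine IsHomogeneous.sum _ _ _ fun σ _ => ?_
  rw [Units.smul_def, zsmul_eq_mul, ← map_intCast (C : F →+* _), ← zero_add (∑ j : Fin n, _)]
  refine (isHomogeneous_C _ _).mul (IsHomogeneous.prod _ _ _ fun i _ => ?_)
  exact isHomogeneous_X_pow _ _

theorem linForm_pow_card (a : Fin n → F) (k : ℕ) :
    linForm a ^ (Fintype.card F ^ k) = ∑ j, C (a j) * X j ^ (Fintype.card F ^ k) := by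
  induction k with
  | zero => simp [linForm]
  | succ k ih =>
    rw [pow_succ, pow_mul, ih, sum_pow_card]
    refine Finset.sum_congr rfl fun j _ => ?_
    rw [mul_pow, ← C_pow, FiniteField.pow_card, ← pow_mul]

/-- The row vector a times the Moore matrix has entries ℓ^{q^j}, all divisible by ℓ. Multiplying by
the adjugate shows that ℓ divides a_k times the determinant, and some a_k is a unit. -/
theorem linForm_dvd_mooreDet {a : Fin n → F} (ha : a ≠ 0) : linForm a ∣ mooreDet F n := by
  have hq : 0 < Fintype.card F := Fintype.card_pos
  obtain ⟨k, hk⟩ := Function.ne_iff.mp ha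
  have hv : Matrix.vecMul (fun i => C (a i)) (mooreMatrix F n) =
      fun j : Fin n => linForm a ^ (Fintype.card F ^ (j : ℕ)) := by
    ext1 j
    rw [linForm_pow_card]
    rfl
  have h := congrFun (Matrix.vecMul_vecMul (fun i => C (a i)) (mooreMatrix F n)
    (mooreMatrix F n).adjugate) k
  rw [Matrix.mul_adjugate, Matrix.vecMul_smul, Matrix.vecMul_one, hv] at h
  have h1 : linForm a ∣ mooreDet F n * C (a k) := by
    change _ = mooreDet F n * C (a k) at h
    rw [← h]
    simp only [Matrix.vecMul, dotProduct]
    exact Finset.dvd_sum fun j _ =>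
      (dvd_pow_self (linForm a) (pow_ne_zero (j : ℕ) hq.ne')).mul_right _
  have hu : IsUnit (C (a k) : MvPolynomial (Fin n) F) := (IsUnit.mk0 _ hk).map C
  exact (hu.dvd_mul_right).mp h1

/-- Expansion along row j. The entry in column 0 is X_j and its minor consists of q-th powers, hence
is itself a q-th power; the other entries are divisible by X_j^q. -/
theorem mooreDet_expand (j : Fin n) : ∃ N R : MvPolynomial (Fin n) F,
    mooreDet F n = N ^ Fintype.card F * X j + X j ^ Fintype.card F * R := by
  cases n with
  | zero => exact j.elim0
  | succ k =>
    rw [mooreDet, Matrix.det_succ_row _ j, Fin.sum_univ_succ]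
    set D := Matrix.of fun (a b : Fin k) =>
      (X (j.succAbove a) ^ (Fintype.card F ^ (b : ℕ)) : MvPolynomial (Fin (k + 1)) F) with hD
    have h0 : (mooreMatrix F (k + 1)).submatrix j.succAbove (0 : Fin (k + 1)).succAbove =
        (FiniteField.frobeniusAlgHom F (MvPolynomial (Fin (k + 1)) F)).mapMatrix D := by
      ext1 a b
      simp [mooreMatrix, hD, pow_succ, pow_mul]
    have h1 : ∀ i : Fin k, ∃ r, (-1) ^ ((j : ℕ) + (i.succ : Fin (k + 1))) *
        mooreMatrix F (k + 1) j i.succ *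
        ((mooreMatrix F (k + 1)).submatrix j.succAbove i.succ.succAbove).det =
          X j ^ Fintype.card F * r := by
      intro i
      have hq : 0 < Fintype.card F := Fintype.card_pos
      obtain ⟨s, hs⟩ : (X j ^ Fintype.card F : MvPolynomial (Fin (k + 1)) F) ∣
          mooreMatrix F (k + 1) j i.succ := by
        simp only [mooreMatrix, Matrix.of_apply]
        refine pow_dvd_pow _ ?_
        rw [Fin.val_succ, pow_succ]
        exact Nat.le_mul_of_pos_left _ (pow_pos hq _)
      refine ⟨(-1) ^ ((j : ℕ) + (i.succ : Fin (k + 1))) * s *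
        ((mooreMatrix F (k + 1)).submatrix j.succAbove i.succ.succAbove).det, ?_⟩
      rw [hs]
      ring
    choose r hr using h1
    have hM : mooreMatrix F (k + 1) j 0 = X j := by simp [mooreMatrix]
    have hdet : ((mooreMatrix F (k + 1)).submatrix j.succAbove (0 : Fin (k + 1)).succAbove).det =
        D.det ^ Fintype.card F := by
      rw [h0, ← AlgHom.map_det, FiniteField.coe_frobeniusAlgHom]
    clear_value D
    refine ⟨C ((-1) ^ (j : ℕ)) * D.det, ∑ i, r i, ?_⟩
    have hs := Finset.sum_congr (rfl : (Finset.univ : Finset (Fin k)) = Finset.univ)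
      fun i _ => hr i
    rw [← Finset.mul_sum] at hs
    rw [hs, hM, hdet]
    congr 1
    rw [mul_pow, ← C_pow, FiniteField.pow_card, C_pow, C_neg, C_1, Fin.val_zero, add_zero]
    ring

theorem dvd_algHom_sub {σ A : Type*} [CommRing A] [Algebra F A] (φ ψ : MvPolynomial σ F →ₐ[F] A)
    (d : A) (h : ∀ i, d ∣ φ (X i) - ψ (X i)) (f : MvPolynomial σ F) : d ∣ φ f - ψ f := by
  have : (Ideal.Quotient.mkₐ F (Ideal.span {d})).comp φ =
      (Ideal.Quotient.mkₐ F (Ideal.span {d})).comp ψ := by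
    ext1 i
    rw [AlgHom.comp_apply, AlgHom.comp_apply, Ideal.Quotient.mkₐ_eq_mk, Ideal.Quotient.eq,
      Ideal.mem_span_singleton]
    exact h i
  have h2 := DFunLike.congr_fun this f
  rwa [AlgHom.comp_apply, AlgHom.comp_apply, Ideal.Quotient.mkₐ_eq_mk, Ideal.Quotient.eq,
    Ideal.mem_span_singleton] at h2

/-- The exponents `e` with `e j ≥ q - 1` or `e j.rev % q ≤ e j`. -/
def lowExponents (F : Type*) [Fintype F] (j : Fin n) : Set (Fin n →₀ ℕ) :=
  {e | Fintype.card F - 1 ≤ e j ∨ e j.rev % Fintype.card F ≤ e j}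

/-- The condition is stable under adding exponents and holds for each X_i^{q^k} X_{i.rev}. Its
purpose is to exclude exponents with e_j = q − 2 and e_{j.rev} ≡ −1 modulo q. -/
theorem support_subset_lowExponents (j : Fin (2 * m)) {f : MvPolynomial (Fin (2 * m)) F}
    (hf : f ∈ Algebra.adjoin F (Set.range (xi m F))) :
    (f.support : Set (Fin (2 * m) →₀ ℕ)) ⊆ lowExponents F j := by
  classical
  have hq : 1 < Fintype.card F := Fintype.one_lt_card
  have hadd : ∀ f g : MvPolynomial (Fin (2 * m)) F,
      (f.support : Set (Fin (2 * m) →₀ ℕ)) ⊆ lowExponents F j →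
      (g.support : Set (Fin (2 * m) →₀ ℕ)) ⊆ lowExponents F j →
      ((f + g).support : Set (Fin (2 * m) →₀ ℕ)) ⊆ lowExponents F j := by
    intro f g hf hg e he
    rcases Finset.mem_union.mp (support_add he) with h | h
    exacts [hf h, hg h]
  have hrev : ∀ i : Fin (2 * m), i.rev ≠ i := fun i h => by
    have h1 := congrArg Fin.val h
    have h2 := i.2
    rw [Fin.val_rev] at h1
    omega
  have hmon : ∀ (i : Fin (2 * m)) (k : ℕ),
      ((X i ^ (Fintype.card F ^ k) * X i.rev : MvPolynomial (Fin (2 * m)) F).support :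
        Set (Fin (2 * m) →₀ ℕ)) ⊆ lowExponents F j := by
    intro i k e he
    have h1 : (X i ^ (Fintype.card F ^ k) * X i.rev : MvPolynomial (Fin (2 * m)) F) =
        monomial (Finsupp.single i (Fintype.card F ^ k) + Finsupp.single i.rev 1) 1 := by
      rw [X_pow_eq_monomial, X, monomial_mul, mul_one]
    rw [h1] at he
    have he' := support_monomial_subset he
    rw [Finset.mem_singleton] at he'
    subst he'
    rw [lowExponents, Set.mem_ofPred_eq]
    simp only [Finsupp.add_apply, Finsupp.single_apply]
    by_cases hij : i = j
    · subst hij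
      rw [if_pos rfl, if_neg (hrev i), if_neg (hrev i).symm, if_pos rfl]
      rcases k with _ | k
      · right
        simp [Nat.mod_eq_of_lt hq]
      · left
        have := Nat.le_self_pow (Nat.succ_ne_zero k) (Fintype.card F)
        simp only [Nat.succ_eq_add_one] at this
        omega
    · rw [if_neg hij, if_neg (fun h => hij (Fin.rev_injective h))]
      right
      by_cases hij' : i = j.rev
      · subst hij'
        rw [if_pos rfl, Fin.rev_rev, if_pos rfl]
        rcases k with _ | k
        · simp [Nat.mod_eq_of_lt hq]
        · simp [pow_succ]
      · rw [if_neg hij']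
        simp
  have hsum : ∀ (k : ℕ), ∀ s : Finset (Fin (2 * m)),
      ((∑ i ∈ s, X i ^ (Fintype.card F ^ k) * X i.rev : MvPolynomial (Fin (2 * m)) F).support :
        Set (Fin (2 * m) →₀ ℕ)) ⊆ lowExponents F j := by
    intro k s
    induction s using Finset.induction_on with
    | empty => simp
    | insert a s ha ih =>
      rw [Finset.sum_insert ha]
      exact hadd _ _ (hmon a k) ih
  induction hf using Algebra.adjoin_induction with
  | mem f hf =>
    obtain ⟨k, rfl⟩ := hf
    rcases eq_or_ne k 0 with rfl | hk
    · have : xi m F 0 = ∑ i ∈ Finset.univ.image (yIdx : Fin m → Fin (2 * m)),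
          X i ^ (Fintype.card F ^ 0) * X i.rev := by
        rw [Finset.sum_image fun a _ b _ (h : yIdx a = yIdx b) => Fin.castLE_injective _ h, xi, if_pos rfl]
        simp
      rw [this]
      exact hsum 0 _
    · rw [xi_eq_pairing hk]
      exact hsum k _
  | algebraMap r =>
    intro e he
    rw [algebraMap_eq] at he
    have he' := support_monomial_subset (s := 0) (a := r) he
    rw [Finset.mem_singleton] at he'
    subst he'
    right
    simp
  | add f g _ _ hf hg => exact hadd f g hf hg
  | mul f g _ _ hf hg =>
    intro e he
    obtain ⟨a, ha, b, hb, rfl⟩ := Finset.mem_add.mp (support_mul f g he)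
    have h1 := hf ha
    have h2 := hg hb
    rw [lowExponents, Set.mem_ofPred_eq] at h1 h2 ⊢
    simp only [Finsupp.add_apply]
    rcases h1 with h1 | h1
    · left; omega
    rcases h2 with h2 | h2
    · left; omega
    right
    rw [Nat.add_mod]
    exact (Nat.mod_le _ _).trans (add_le_add h1 h2)

/-- By `mooreDet_expand` it suffices that X_j divides κ(X_j f). A term of κ(X_j f) free of X_j would
come from a term of f with exponent q − 2 at j and residue q − 1 at j.rev, which
`support_subset_lowExponents` forbids. -/
theorem X_dvd_cartier (j : Fin (2 * m)) {f : MvPolynomial (Fin (2 * m)) F}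
    (hf : f ∈ Algebra.adjoin F (Set.range (xi m F))) :
    X j ∣ cartier (mooreDet F (2 * m) * f) := by
  classical
  have hq : 1 < Fintype.card F := Fintype.one_lt_card
  obtain ⟨N, R, hNR⟩ := mooreDet_expand (F := F) j
  have h1 : X j ∣ cartier (X j * f) := by
    rw [X_dvd_iff_modMonomial_eq_zero]
    ext d
    rw [coeff_zero]
    by_cases hd : Finsupp.single j 1 ≤ d
    · exact coeff_modMonomial_of_le _ hd
    · rw [coeff_modMonomial_of_not_le _ hd, coeff_cartier, X, coeff_monomial_mul']
      have hd0 : d j = 0 := by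
        by_contra h
        exact hd (Finsupp.single_le_iff.mpr (Nat.one_le_iff_ne_zero.mpr h))
      split_ifs with hle
      · rw [one_mul]
        by_contra hne
        have hlow := support_subset_lowExponents j hf (mem_support_iff.mpr hne)
        rw [lowExponents, Set.mem_ofPred_eq] at hlow
        have hrev : j ≠ j.rev := fun h => by
          have h1 := congrArg Fin.val h
          have h2 := j.2
          rw [Fin.val_rev] at h1
          omega
        simp only [Finsupp.tsub_apply, Finsupp.add_apply, Finsupp.smul_apply, topExp_apply,
          Finsupp.single_apply, hd0, if_neg hrev, smul_eq_mul, if_true, mul_zero, zero_add,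
          Nat.sub_zero, Nat.mul_add_mod] at hlow
        rw [Nat.mod_eq_of_lt (by omega : Fintype.card F - 1 < Fintype.card F)] at hlow
        omega
      · rfl
  have h2 : mooreDet F (2 * m) * f =
      N ^ Fintype.card F * (X j * f) + X j ^ Fintype.card F * (R * f) := by
    rw [hNR]; ring
  rw [h2, map_add, cartier_pow_mul, cartier_pow_mul]
  exact dvd_add (h1.mul_left _) (dvd_mul_right _ _)

theorem act_eq_self_of_mem_adjoin_xi {g : GL (Fin (2 * m)) F} (hg : g ∈ orthogonalPlus m F)
    {f : MvPolynomial (Fin (2 * m)) F} (hf : f ∈ Algebra.adjoin F (Set.range (xi m F))) :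
    act g f = f := by
  induction hf using Algebra.adjoin_induction with
  | mem f hf =>
    obtain ⟨k, rfl⟩ := hf
    exact act_xi hg k
  | algebraMap r => simp
  | add f g _ _ hf hg => rw [map_add, hf, hg]
  | mul f g _ _ hf hg => rw [map_mul, hf, hg]

theorem act_refl_cartier (hF : ringChar F ≠ 2) {a : Fin (2 * m) → F} (ha : pairing a a ≠ 0)
    {f : MvPolynomial (Fin (2 * m)) F} (hf : f ∈ Algebra.adjoin F (Set.range (xi m F))) :
    act (refl a ha) (cartier (mooreDet F (2 * m) * f)) = -cartier (mooreDet F (2 * m) * f) := by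
  rw [act_eq_linSubst, ← cartier_linSubst, ← act_eq_linSubst, map_mul, act_mooreDet, coe_refl,
    det_reflMatrix ha, act_eq_self_of_mem_adjoin_xi (refl_mem hF ha) hf]
  · simp
  · rw [coe_refl, det_reflMatrix ha]
    exact neg_ne_zero.mpr one_ne_zero

theorem vecMul_refl {a : Fin (2 * m) → F} (ha : pairing a a ≠ 0) (b : Fin (2 * m) → F) :
    Matrix.vecMul b (refl a ha : Matrix (Fin (2 * m)) (Fin (2 * m)) F) =
      b - (2 / pairing a a * pairing b a) • a := by
  ext i
  rw [coe_refl, reflMatrix, Matrix.vecMul_sub, Matrix.vecMul_one, Pi.sub_apply, Pi.sub_apply]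
  congr 1
  simp only [Matrix.vecMul, dotProduct, Matrix.vecMulVec_apply, Pi.smul_apply, smul_eq_mul, pairing,
    Finset.mul_sum, Finset.sum_mul]
  exact Finset.sum_congr rfl fun k _ => by ring

theorem linForm_single {n : ℕ} (j : Fin n) (c : F) : linForm (Pi.single j c) = C c * X j := by
  rw [linForm, Finset.sum_eq_single j]
  · simp
  · intro i _ hi
    simp [Pi.single_apply, hi]
  · simp

theorem pairing_single_right {A : Type*} [CommRing A] (u : Fin (2 * m) → A) (j : Fin (2 * m))
    (c : A) : pairing u (Pi.single j c) = u j.rev * c := by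
  rw [pairing, Finset.sum_eq_single j.rev]
  · simp
  · intro i _ hi
    rw [Pi.single_apply, if_neg, mul_zero]
    rintro rfl
    simp at hi
  · simp

section Divisibility

variable (hF : ringChar F ≠ 2) {f : MvPolynomial (Fin (2 * m)) F}
  (hf : f ∈ Algebra.adjoin F (Set.range (xi m F)))

include hF hf

/-- The reflection in a changes any polynomial by a multiple of its linear form. Here it negates the
polynomial, so twice that polynomial is such a multiple, and 2 is a unit. -/
theorem linForm_dvd_cartier_of_anisotropic {a : Fin (2 * m) → F} (ha : pairing a a ≠ 0) :
    linForm a ∣ cartier (mooreDet F (2 * m) * f) := by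
  have h := dvd_algHom_sub (act (refl a ha)) (AlgHom.id F _) (linForm a) (fun i => by
    rw [act_refl_X, AlgHom.id_apply, sub_sub_cancel_left]
    exact (dvd_mul_left _ _).neg_right) (cartier (mooreDet F (2 * m) * f))
  rw [act_refl_cartier hF ha hf, AlgHom.id_apply, ← neg_add', dvd_neg, ← two_mul,
    ← map_ofNat C 2] at h
  have hu : IsUnit (C 2 : MvPolynomial (Fin (2 * m)) F) :=
    (IsUnit.mk0 _ (Ring.two_ne_zero hF)).map C
  exact hu.dvd_mul_left.mp h

/-- The reflection in a − c, which is anisotropic because ⟨a − c, a − c⟩ = −2⟨a, c⟩, carries c to a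
and preserves κ(Lf) up to sign. -/
theorem linForm_dvd_cartier_of_isotropic {a c : Fin (2 * m) → F} (ha : pairing a a = 0)
    (hc : pairing c c = 0) (hac : pairing a c ≠ 0)
    (h : linForm c ∣ cartier (mooreDet F (2 * m) * f)) :
    linForm a ∣ cartier (mooreDet F (2 * m) * f) := by
  have h2 := Ring.two_ne_zero hF
  have hN : pairing (a - c) (a - c) = -2 * pairing a c := by
    rw [pairing_sub_left, pairing_sub_right, pairing_sub_right, ha, hc, pairing_comm c a]
    ring
  have hv : pairing (a - c) (a - c) ≠ 0 := by
    rw [hN]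
    exact mul_ne_zero (neg_ne_zero.mpr h2) hac
  have h3 := map_dvd (act (refl (a - c) hv)) h
  rw [act_refl_cartier hF hv hf, dvd_neg, act_linForm, vecMul_refl] at h3
  have h4 : c - (2 / pairing (a - c) (a - c) * pairing c (a - c)) • (a - c) = a := by
    have : 2 / pairing (a - c) (a - c) * pairing c (a - c) = -1 := by
      rw [hN, pairing_sub_right, hc, sub_zero, pairing_comm c a]
      field_simp
    rw [this]
    simp
  rwa [h4] at h3

/-- An isotropic a with a_j ≠ 0 is not orthogonal to the isotropic basis vector at j.rev, whose
linear form is a variable; `X_dvd_cartier` handles that one. -/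
theorem linForm_dvd_cartier {a : Fin (2 * m) → F} (ha : a ≠ 0) :
    linForm a ∣ cartier (mooreDet F (2 * m) * f) := by
  by_cases hN : pairing a a = 0
  swap
  · exact linForm_dvd_cartier_of_anisotropic hF hf hN
  obtain ⟨j, hj⟩ := Function.ne_iff.mp ha
  have hrev : j.rev ≠ j := fun h => by
    have h1 := congrArg Fin.val h
    have h2 := j.2
    rw [Fin.val_rev] at h1
    omega
  refine linForm_dvd_cartier_of_isotropic hF hf (c := Pi.single j.rev 1) hN ?_ ?_ ?_
  · rw [pairing_single_right]
    simp [Pi.single_apply, hrev.symm]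
  · rw [pairing_single_right]
    simpa using hj
  · rw [linForm_single, C_1, one_mul]
    exact X_dvd_cartier _ hf

end Divisibility

end Moore

/-! ### Linear forms and the factorisation of the Moore determinant -/

section LinearForms

variable {F : Type*} [Field F] [Fintype F] {n : ℕ}

theorem coeff_linForm (a : Fin n → F) (j : Fin n) :
    coeff (Finsupp.single j 1) (linForm a) = a j := by
  classical
  simp [linForm, coeff_sum, coeff_C_mul, coeff_X, Finsupp.single_left_inj]

theorem linForm_isHomogeneous (a : Fin n → F) : (linForm a).IsHomogeneous 1 :=
  linear_isHomogeneous a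

theorem linForm_ne_zero {a : Fin n → F} (ha : a ≠ 0) : linForm a ≠ 0 := by
  obtain ⟨k, hk⟩ := Function.ne_iff.mp ha
  intro h
  apply hk
  rw [← coeff_linForm a k, h]
  rfl

theorem linForm_irreducible {a : Fin n → F} (ha : a ≠ 0) : Irreducible (linForm a) := by
  obtain ⟨k, hk⟩ := Function.ne_iff.mp ha
  refine irreducible_of_totalDegree_eq_one
    ((linForm_isHomogeneous a).totalDegree (linForm_ne_zero ha)) fun x hx => ?_
  have h := hx (Finsupp.single k 1)
  rw [coeff_linForm] at h
  exact isUnit_of_dvd_unit h (IsUnit.mk0 _ hk)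

theorem eq_smul_of_linForm_dvd {a b : Fin n → F} (ha : a ≠ 0) (hb : b ≠ 0)
    (h : linForm a ∣ linForm b) : ∃ c : F, b = c • a := by
  obtain ⟨u, hu⟩ := h
  have hu0 : u ≠ 0 := by
    rintro rfl
    rw [mul_zero] at hu
    exact linForm_ne_zero hb hu
  have hd := congrArg totalDegree hu
  rw [totalDegree_mul_of_isDomain (linForm_ne_zero ha) hu0,
    (linForm_isHomogeneous a).totalDegree (linForm_ne_zero ha),
    (linForm_isHomogeneous b).totalDegree (linForm_ne_zero hb)] at hd
  rw [totalDegree_eq_zero_iff_eq_C.mp (by omega : u.totalDegree = 0), mul_comm] at hu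
  refine ⟨coeff 0 u, ?_⟩
  ext j
  rw [← coeff_linForm b, hu, coeff_C_mul, coeff_linForm]
  rfl

open Classical in
/-- The vector with entry `1` in position `k`, arbitrary entries before, and `0` after. -/
noncomputable def normVec (p : Σ k : Fin n, (Fin k → F)) : Fin n → F := fun j =>
  if h : j < p.1 then p.2 ⟨j, h⟩ else if j = p.1 then 1 else 0

theorem normVec_fst (p : Σ k : Fin n, (Fin k → F)) : normVec p p.1 = 1 := by simp [normVec]

theorem normVec_of_gt (p : Σ k : Fin n, (Fin k → F)) {j : Fin n} (hj : p.1 < j) :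
    normVec p j = 0 := by simp [normVec, hj.not_gt, hj.ne']

theorem normVec_ne_zero (p : Σ k : Fin n, (Fin k → F)) : normVec p ≠ 0 := fun h => by
  have := normVec_fst p
  rw [h] at this
  simp at this

theorem normVec_injective : Function.Injective (normVec : (Σ k : Fin n, (Fin k → F)) → Fin n → F) := by
  intro p p' h
  have h1 : p.1 = p'.1 := by
    rcases lt_trichotomy p.1 p'.1 with hlt | heq | hgt
    · have := normVec_fst p'
      rw [← h, normVec_of_gt p hlt] at this
      simp at this
    · exact heq
    · have := normVec_fst p
      rw [h, normVec_of_gt p' hgt] at this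
      simp at this
  obtain ⟨k, c⟩ := p
  obtain ⟨k', c'⟩ := p'
  obtain rfl : k = k' := h1
  congr
  ext j
  have := congrFun h ⟨j, j.2.trans k.2⟩
  simpa [normVec, Fin.lt_def] using this

theorem isRelPrime_normVec {p p' : Σ k : Fin n, (Fin k → F)} (h : p ≠ p') :
    IsRelPrime (linForm (normVec p)) (linForm (normVec p')) := by
  rw [(linForm_irreducible (normVec_ne_zero p)).isRelPrime_iff_not_dvd]
  intro hd
  obtain ⟨c, hc⟩ := eq_smul_of_linForm_dvd (normVec_ne_zero p) (normVec_ne_zero p') hd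
  apply h
  apply normVec_injective
  have h1 : p.1 = p'.1 := by
    rcases lt_trichotomy p.1 p'.1 with hlt | heq | hgt
    · have := normVec_fst p'
      rw [hc, Pi.smul_apply, normVec_of_gt p hlt] at this
      simp at this
    · exact heq
    · have h2 := congrFun hc p.1
      rw [Pi.smul_apply, normVec_fst, normVec_of_gt p' hgt, smul_eq_mul, mul_one] at h2
      rw [← h2, zero_smul] at hc
      exact absurd hc (normVec_ne_zero p')
  have h2 := congrFun hc p.1
  rw [Pi.smul_apply, normVec_fst, h1, normVec_fst, smul_eq_mul, mul_one] at h2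
  rw [hc, ← h2, one_smul]

/-- A polynomial divisible by every nonzero linear form is divisible by the Moore determinant. -/
theorem mooreDet_dvd {h : MvPolynomial (Fin n) F} (hh : ∀ a : Fin n → F, a ≠ 0 → linForm a ∣ h) :
    mooreDet F n ∣ h := by
  set Λ : MvPolynomial (Fin n) F := ∏ p : Σ k : Fin n, (Fin k → F), linForm (normVec p) with hΛ
  have hdvd : ∀ g : MvPolynomial (Fin n) F, (∀ a : Fin n → F, a ≠ 0 → linForm a ∣ g) → Λ ∣ g :=
    fun g hg => Finset.prod_dvd_of_isRelPrime
      (fun p _ p' _ hne => isRelPrime_normVec hne) fun p _ => hg _ (normVec_ne_zero p)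
  obtain ⟨u, hu⟩ := hdvd (mooreDet F n) fun a ha => linForm_dvd_mooreDet ha
  have hΛ0 : Λ ≠ 0 := Finset.prod_ne_zero_iff.mpr fun p _ => linForm_ne_zero (normVec_ne_zero p)
  have hu0 : u ≠ 0 := by
    rintro rfl
    rw [mul_zero] at hu
    exact mooreDet_ne_zero hu
  have hΛd : Λ.IsHomogeneous (∑ p : Σ k : Fin n, (Fin k → F), 1) :=
    IsHomogeneous.prod _ _ _ fun p _ => linForm_isHomogeneous _
  -- There is one normalised vector for each line of F^n, so the product of their linear forms
  -- already has the degree of the Moore determinant and the cofactor u is constant.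
  have hcard : ∑ p : Σ k : Fin n, (Fin k → F), 1 = ∑ j : Fin n, Fintype.card F ^ (j : ℕ) := by
    simp
  have hd := congrArg totalDegree hu
  rw [totalDegree_mul_of_isDomain hΛ0 hu0, mooreDet_isHomogeneous.totalDegree mooreDet_ne_zero,
    hΛd.totalDegree hΛ0, hcard] at hd
  have huC := totalDegree_eq_zero_iff_eq_C.mp (by omega : u.totalDegree = 0)
  have hc : coeff 0 u ≠ 0 := by
    intro h0
    rw [h0, C_0] at huC
    exact hu0 huC
  rw [hu, huC]
  exact (((IsUnit.mk0 _ hc).map C).mul_right_dvd).mpr (hdvd h hh)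

end LinearForms

/-! ### Spanning by monomials with exponents below q -/

section Span

variable {F A ι : Type*} [Field F] [CommRing A] [Algebra F A] [Fintype ι] [DecidableEq ι]

/-- If the `q`-th powers of the `v k` lie in a subalgebra `D`, the algebra generated by `D` and the
`v k` is spanned over `D` by the monomials in the `v k` with exponents less than `q`. -/
theorem exists_sum_of_mem_adjoin (D : Subalgebra F A) {q : ℕ} (hq : 0 < q) (v : ι → A)
    (hv : ∀ k, v k ^ q ∈ D) {f : A} (hf : f ∈ Algebra.adjoin F ((D : Set A) ∪ Set.range v)) :
    ∃ a : (ι → Fin q) → A, (∀ c, a c ∈ D) ∧ f = ∑ c, a c * ∏ k, v k ^ (c k : ℕ) := by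
  set mon : (ι → Fin q) → A := fun c => ∏ k, v k ^ (c k : ℕ) with hmon
  set W : Submodule D A := Submodule.span D (Set.range mon) with hW
  -- Dividing each exponent by q moves the quotient part into D and leaves a monomial with small
  -- exponents.
  have hall : ∀ e : ι → ℕ, ∏ k, v k ^ e k ∈ W := by
    intro e
    have h1 : ∏ k, v k ^ e k =
        (⟨∏ k, (v k ^ q) ^ (e k / q), prod_mem fun k _ => pow_mem (hv k) _⟩ : D) •
          mon (fun k => ⟨e k % q, Nat.mod_lt _ hq⟩) := by
      rw [Subalgebra.smul_def, hmon, smul_eq_mul, ← Finset.prod_mul_distrib]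
      refine Finset.prod_congr rfl fun k _ => ?_
      rw [← pow_mul, ← pow_add, Nat.div_add_mod]
    rw [h1]
    exact W.smul_mem _ (Submodule.subset_span ⟨_, rfl⟩)
  have hone : (1 : A) ∈ W := by simpa using hall 0
  have hmul : ∀ x ∈ W, ∀ y ∈ W, x * y ∈ W := by
    intro x hx y hy
    have : x * y ∈ W * W := Submodule.mul_mem_mul hx hy
    rw [hW, Submodule.span_mul_span] at this
    refine (Submodule.span_le.mpr ?_) this
    rintro _ ⟨_, ⟨c, rfl⟩, _, ⟨c', rfl⟩, rfl⟩
    have := hall fun k => (c k : ℕ) + c' k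
    simpa [hmon, pow_add, Finset.prod_mul_distrib] using this
  have hD : ∀ d ∈ D, d ∈ W := fun d hd => by
    have := W.smul_mem (⟨d, hd⟩ : D) hone
    rwa [Subalgebra.smul_def, smul_eq_mul, mul_one] at this
  have hfW : f ∈ W := by
    induction hf using Algebra.adjoin_induction with
    | mem x hx =>
      rcases hx with hx | ⟨k, rfl⟩
      · exact hD x hx
      · have := hall (Pi.single k 1)
        rwa [Finset.prod_eq_single k (fun j _ hj => by simp [Pi.single_apply, hj]) (by simp),
          Pi.single_eq_same, pow_one] at this
    | algebraMap r => exact hD _ (D.algebraMap_mem r)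
    | add x y _ _ hx hy => exact W.add_mem hx hy
    | mul x y _ _ hx hy => exact hmul x hx y hy
  obtain ⟨a, ha⟩ := (Submodule.mem_span_range_iff_exists_fun D).mp hfW
  exact ⟨fun c => a c, fun c => (a c).2, ha.symm⟩

end Span

/-! ### Duality of the ξ-monomials under κ(L · ) -/

section DualBasis

variable {F : Type*} [Field F] [Fintype F] {m : ℕ}

/-- The monomial in `ξ_0, …, ξ_{2m-1}` with exponents `e`. -/
noncomputable def xiMonomial (F : Type*) [Field F] [Fintype F] (m : ℕ) (e : Fin (2 * m) → ℕ) :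
    MvPolynomial (Fin (2 * m)) F :=
  ∏ k : Fin (2 * m), xi m F k ^ e k

theorem xi_isHomogeneous (k : ℕ) : (xi m F k).IsHomogeneous (Fintype.card F ^ k + 1) := by
  rw [xi]
  split_ifs with hk
  · subst hk
    refine IsHomogeneous.sum _ _ _ fun i _ => ?_
    exact (isHomogeneous_X F _).mul (isHomogeneous_X F _)
  · refine IsHomogeneous.sum _ _ _ fun i _ => ?_
    refine IsHomogeneous.add ?_ ?_
    · exact (isHomogeneous_X_pow _ _).mul (isHomogeneous_X F _)
    · rw [add_comm]
      exact (isHomogeneous_X F _).mul (isHomogeneous_X_pow _ _)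

theorem xiMonomial_isHomogeneous (e : Fin (2 * m) → ℕ) :
    (xiMonomial F m e).IsHomogeneous (∑ k : Fin (2 * m), (Fintype.card F ^ (k : ℕ) + 1) * e k) :=
  IsHomogeneous.prod _ _ _ fun _ _ => (xi_isHomogeneous _).pow _

theorem xiMonomial_mem (e : Fin (2 * m) → ℕ) :
    xiMonomial F m e ∈ Algebra.adjoin F (Set.range (xi m F)) :=
  prod_mem fun _ _ => pow_mem (Algebra.subset_adjoin (Set.mem_range_self _)) _

theorem mooreDet_dvd_cartier (hF : ringChar F ≠ 2) {f : MvPolynomial (Fin (2 * m)) F}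
    (hf : f ∈ Algebra.adjoin F (Set.range (xi m F))) :
    mooreDet F (2 * m) ∣ cartier (mooreDet F (2 * m) * f) :=
  mooreDet_dvd fun _ ha => linForm_dvd_cartier hF hf ha

/-- Degree count with n = 2m and D = deg L = ∑ q^k. If nonzero, the value is a multiple of L and has
degree at least D; but its degree is at most (D + ∑ (q^k + 1)e_k − n(q − 1))/q, which is less than D
as soon as some e_k < q − 1. -/
theorem cartier_mooreDet_xiMonomial_of_lt (hF : ringChar F ≠ 2) {e : Fin (2 * m) → ℕ}
    (he : ∀ k, e k ≤ Fintype.card F - 1) {i : Fin (2 * m)} (hi : e i ≠ Fintype.card F - 1) :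
    cartier (mooreDet F (2 * m) * xiMonomial F m e) = 0 := by
  have hq : 1 < Fintype.card F := Fintype.one_lt_card
  by_contra hne
  obtain ⟨u, hu⟩ := mooreDet_dvd_cartier hF (xiMonomial_mem (F := F) e)
  have h1 := totalDegree_cartier hne
  have hu0 : u ≠ 0 := by
    rintro rfl
    rw [mul_zero] at hu
    exact hne hu
  rw [hu, totalDegree_mul_of_isDomain mooreDet_ne_zero hu0,
    mooreDet_isHomogeneous.totalDegree mooreDet_ne_zero] at h1
  have h2 := (mooreDet_isHomogeneous.mul (xiMonomial_isHomogeneous (F := F) e)).totalDegree_le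
  have h3 : ∑ k : Fin (2 * m), (Fintype.card F ^ (k : ℕ) + 1) * e k <
      ∑ k : Fin (2 * m), (Fintype.card F ^ (k : ℕ) + 1) * (Fintype.card F - 1) := by
    refine Finset.sum_lt_sum (fun k _ => Nat.mul_le_mul_left _ (he k)) ⟨i, Finset.mem_univ i, ?_⟩
    exact Nat.mul_lt_mul_of_pos_left (lt_of_le_of_ne (he i) hi) (Nat.succ_pos _)
  rw [← Finset.sum_mul, Finset.sum_add_distrib] at h3
  simp only [Finset.sum_const, Finset.card_univ, Fintype.card_fin, smul_eq_mul, mul_one] at h3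
  set D := ∑ j : Fin (2 * m), Fintype.card F ^ (j : ℕ)
  obtain ⟨r, hr⟩ : ∃ r, Fintype.card F = r + 1 := ⟨_, (Nat.sub_add_cancel hq.le).symm⟩
  rw [hr] at h1 h3
  simp only [Nat.add_sub_cancel] at h1 h3
  have h4 := h1.trans h2
  set s := ∑ k : Fin (2 * m), (Fintype.card F ^ (k : ℕ) + 1) * e k with hs
  rw [hr] at hs
  simp only [← hs] at h3
  nlinarith [Nat.zero_le (u.totalDegree), Nat.zero_le (r * u.totalDegree)]

/-- The equality case of the same count, where the cofactor of L must be constant. That the constant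
is nonzero needs the field generation result, see `exists_cartier_top_eq`. -/
theorem cartier_mooreDet_xiMonomial_top (hF : ringChar F ≠ 2) :
    ∃ c : F, cartier (mooreDet F (2 * m) * xiMonomial F m fun _ => Fintype.card F - 1) =
      C c * mooreDet F (2 * m) := by
  have hq : 1 < Fintype.card F := Fintype.one_lt_card
  obtain ⟨u, hu⟩ := mooreDet_dvd_cartier hF
    (xiMonomial_mem (F := F) (m := m) fun _ => Fintype.card F - 1)
  by_cases hu0 : u = 0
  · exact ⟨0, by rw [hu, hu0]; simp⟩
  have hne : cartier (mooreDet F (2 * m) * xiMonomial F m fun _ => Fintype.card F - 1) ≠ 0 := by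
    rw [hu]
    exact mul_ne_zero mooreDet_ne_zero hu0
  have h1 := totalDegree_cartier hne
  rw [hu, totalDegree_mul_of_isDomain mooreDet_ne_zero hu0,
    mooreDet_isHomogeneous.totalDegree mooreDet_ne_zero] at h1
  have h2 := (mooreDet_isHomogeneous.mul
    (xiMonomial_isHomogeneous (F := F) (m := m) fun _ => Fintype.card F - 1)).totalDegree_le
  rw [← Finset.sum_mul, Finset.sum_add_distrib] at h2
  simp only [Finset.sum_const, Finset.card_univ, Fintype.card_fin, smul_eq_mul, mul_one] at h2
  have h4 := h1.trans h2
  set D := ∑ j : Fin (2 * m), Fintype.card F ^ (j : ℕ) with hD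
  obtain ⟨r, hr⟩ : ∃ r, Fintype.card F = r + 1 := ⟨_, (Nat.sub_add_cancel hq.le).symm⟩
  clear_value D
  rw [hr] at h4
  simp only [Nat.add_sub_cancel] at h4
  have hu1 : u.totalDegree = 0 := by
    nlinarith [Nat.zero_le (u.totalDegree), Nat.zero_le (r * u.totalDegree)]
  refine ⟨coeff 0 u, ?_⟩
  rw [hu, mul_comm (mooreDet F (2 * m)) u]
  congr 1
  exact totalDegree_eq_zero_iff_eq_C.mp hu1

theorem cartier_mooreDet_xiMonomial (hF : ringChar F ≠ 2) {e : Fin (2 * m) → ℕ} {i : Fin (2 * m)}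
    (hi : e i % Fintype.card F ≠ Fintype.card F - 1) :
    cartier (mooreDet F (2 * m) * xiMonomial F m e) = 0 := by
  have hq : 1 < Fintype.card F := Fintype.one_lt_card
  have h : xiMonomial F m e = xiMonomial F m (fun k => e k / Fintype.card F) ^ Fintype.card F *
      xiMonomial F m (fun k => e k % Fintype.card F) := by
    simp only [xiMonomial]
    rw [← Finset.prod_pow, ← Finset.prod_mul_distrib]
    refine Finset.prod_congr rfl fun k _ => ?_
    rw [← pow_mul, ← pow_add, Nat.div_add_mod']
  rw [h, mul_left_comm, cartier_pow_mul, cartier_mooreDet_xiMonomial_of_lt hF _ hi, mul_zero]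
  intro k
  have := Nat.mod_lt (e k) (by omega : Fintype.card F > 0)
  omega

/-- The coefficients of an expansion in monomials in the `ξ_k` over the ring of `q`-th powers. -/
theorem cartier_mooreDet_sum (hF : ringChar F ≠ 2)
    (a : (Fin (2 * m) → Fin (Fintype.card F)) → MvPolynomial (Fin (2 * m)) F)
    (c : Fin (2 * m) → Fin (Fintype.card F)) :
    cartier (mooreDet F (2 * m) * ((∑ d, a d ^ Fintype.card F * xiMonomial F m fun k => d k) *
      xiMonomial F m fun k => Fintype.card F - 1 - c k)) =
    a c * cartier (mooreDet F (2 * m) * xiMonomial F m fun _ => Fintype.card F - 1) := by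
  have hq : 1 < Fintype.card F := Fintype.one_lt_card
  have hmul : ∀ e e' : Fin (2 * m) → ℕ,
      xiMonomial F m e * xiMonomial F m e' = xiMonomial F m fun k => e k + e' k := by
    intro e e'
    simp only [xiMonomial, ← Finset.prod_mul_distrib, pow_add]
  have h1 : mooreDet F (2 * m) * ((∑ d, a d ^ Fintype.card F * xiMonomial F m fun k => d k) *
      xiMonomial F m fun k => Fintype.card F - 1 - c k) =
      ∑ d, a d ^ Fintype.card F * (mooreDet F (2 * m) *
        xiMonomial F m fun k => d k + (Fintype.card F - 1 - c k)) := by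
    rw [Finset.sum_mul, Finset.mul_sum]
    refine Finset.sum_congr rfl fun d _ => ?_
    rw [← hmul]
    ring
  rw [h1, map_sum]
  simp only [cartier_pow_mul]
  -- The exponents d_k + (q − 1 − c_k) are all congruent to −1 modulo q only for d = c; every other
  -- term vanishes.
  rw [Finset.sum_eq_single c]
  · congr 4
    ext k
    have := (c k).2
    omega
  · intro d _ hd
    obtain ⟨i, hi⟩ := Function.ne_iff.mp hd
    rw [cartier_mooreDet_xiMonomial hF (i := i), mul_zero]
    have h2 := (c i).2
    have h3 := (d i).2
    have h4 : (d i : ℕ) ≠ c i := fun h => hi (Fin.ext h)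
    rcases lt_or_gt_of_ne h4 with h5 | h5
    · rw [Nat.mod_eq_of_lt (by omega)]
      omega
    · have h6 : (d i : ℕ) + (Fintype.card F - 1 - c i) = (d i - c i - 1) + Fintype.card F := by omega
      rw [h6, Nat.add_mod_right, Nat.mod_eq_of_lt (by omega)]
      omega
  · simp

end DualBasis

/-! ### The ξ_k generate the function field over q-th powers -/

section FieldExtension

variable {F : Type*} [Field F] [Fintype F] {m : ℕ}

/-- The subfield of the field of rational functions generated by the `q`-th powers of the variables
and `ξ_0, …, ξ_{2m-1}`. -/
noncomputable def xiField (F : Type*) [Field F] [Fintype F] (m : ℕ) :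
    IntermediateField F (FractionRing (MvPolynomial (Fin (2 * m)) F)) :=
  IntermediateField.adjoin F
    (Set.range (fun i : Fin (2 * m) => algebraMap (MvPolynomial (Fin (2 * m)) F)
      (FractionRing (MvPolynomial (Fin (2 * m)) F)) (X i ^ Fintype.card F)) ∪
    Set.range (fun k : Fin (2 * m) => algebraMap (MvPolynomial (Fin (2 * m)) F)
      (FractionRing (MvPolynomial (Fin (2 * m)) F)) (xi m F k)))

theorem algebraMap_pow_mem_xiField (f : MvPolynomial (Fin (2 * m)) F) :
    algebraMap _ (FractionRing (MvPolynomial (Fin (2 * m)) F)) (f ^ Fintype.card F) ∈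
      xiField F m := by
  induction f using MvPolynomial.induction_on with
  | C a =>
    rw [← C_pow, ← algebraMap_eq, ← IsScalarTower.algebraMap_apply]
    exact (xiField F m).algebraMap_mem _
  | add p r hp hr =>
    rw [add_pow_card, map_add]
    exact add_mem hp hr
  | mul_X p i hp =>
    rw [mul_pow, map_mul]
    exact mul_mem hp (IntermediateField.subset_adjoin _ _ (Or.inl ⟨i, rfl⟩))

theorem pow_mem_xiField (x : FractionRing (MvPolynomial (Fin (2 * m)) F)) :
    x ^ Fintype.card F ∈ xiField F m := by
  obtain ⟨a, b, _, rfl⟩ := IsFractionRing.div_surjective (A := MvPolynomial (Fin (2 * m)) F) x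
  rw [div_pow, ← map_pow, ← map_pow]
  exact div_mem (algebraMap_pow_mem_xiField a) (algebraMap_pow_mem_xiField b)

instance isPurelyInseparable_xiField :
    IsPurelyInseparable (xiField F m) (FractionRing (MvPolynomial (Fin (2 * m)) F)) := by
  obtain ⟨p, hp⟩ := CharP.exists F
  obtain ⟨r, hpr, hr⟩ := FiniteField.card F p
  have : Fact p.Prime := ⟨hpr⟩
  have : CharP (xiField F m) p := charP_of_injective_algebraMap (algebraMap F (xiField F m)).injective p
  have : ExpChar (xiField F m) p := ExpChar.prime hpr
  rw [isPurelyInseparable_iff_pow_mem (xiField F m) p]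
  intro x
  refine ⟨r, ⟨⟨x ^ Fintype.card F, pow_mem_xiField x⟩, ?_⟩⟩
  rw [← hr]
  rfl

/-- Cramer's rule for a system with unknowns in a vector space: multiply by the adjugate of the
Moore matrix. -/
theorem eq_zero_of_moore_sum {V : Type*} [AddCommGroup V]
    [Module (FractionRing (MvPolynomial (Fin (2 * m)) F)) V] (d : Fin (2 * m) → V)
    (hd : ∀ k : Fin (2 * m), ∑ j, algebraMap (MvPolynomial (Fin (2 * m)) F)
      (FractionRing (MvPolynomial (Fin (2 * m)) F)) (X j ^ (Fintype.card F ^ (k : ℕ))) • d j = 0) :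
    d = 0 := by
  set K := FractionRing (MvPolynomial (Fin (2 * m)) F)
  set M : Matrix (Fin (2 * m)) (Fin (2 * m)) K :=
    (mooreMatrix F (2 * m)).map (algebraMap _ K) with hM
  have hdet : M.det ≠ 0 := by
    have : M.det = algebraMap _ K (mooreDet F (2 * m)) :=
      (RingHom.map_det (algebraMap (MvPolynomial (Fin (2 * m)) F) K) _).symm
    rw [this]
    exact (map_ne_zero_iff _ (IsFractionRing.injective _ K)).mpr mooreDet_ne_zero
  ext i
  have h1 : ∑ k, M.adjugate k i • ∑ j, M j k • d j = 0 :=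
    Finset.sum_eq_zero fun k _ => by
      have := hd k
      simp only [hM, Matrix.map_apply, mooreMatrix, Matrix.of_apply]
      rw [this, smul_zero]
  have h2 : ∑ k, M.adjugate k i • ∑ j, M j k • d j = M.det • d i := by
    simp only [Finset.smul_sum, smul_smul]
    rw [Finset.sum_comm]
    simp only [← Finset.sum_smul]
    have : ∀ j, ∑ k, M.adjugate k i * M j k = if j = i then M.det else 0 := by
      intro j
      have h3 := congrArg (fun N : Matrix _ _ K => N j i) (Matrix.mul_adjugate M)
      rw [Matrix.mul_apply, Matrix.smul_apply, Matrix.one_apply] at h3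
      simp only [mul_comm (M.adjugate _ _)]
      rw [h3]
      simp
    simp [this]
  rw [h2] at h1
  exact (smul_eq_zero.mp h1).resolve_left hdet

theorem two_ne_zero_fractionRing (hF : ringChar F ≠ 2) :
    (2 : FractionRing (MvPolynomial (Fin (2 * m)) F)) ≠ 0 := by
  rw [← map_ofNat (algebraMap F (FractionRing (MvPolynomial (Fin (2 * m)) F))) 2]
  exact (map_ne_zero_iff _ (algebraMap F _).injective).mpr (Ring.two_ne_zero hF)

/-- Applying D to ξ_k and dropping q-th powers leaves ∑_j X_j^{q^k} D(X_{j.rev}) = 0; for k = 0 this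
requires division by 2. For 0 ≤ k < 2m these equations have the Moore matrix as coefficients, so D
kills all variables. -/
theorem derivation_xiField_eq_zero (hF : ringChar F ≠ 2) {V : Type*} [AddCommGroup V]
    [Module (FractionRing (MvPolynomial (Fin (2 * m)) F)) V] [Module (xiField F m) V]
    (D : Derivation (xiField F m) (FractionRing (MvPolynomial (Fin (2 * m)) F)) V)
    (x : FractionRing (MvPolynomial (Fin (2 * m)) F)) : D x = 0 := by
  have hE : ∀ x ∈ xiField F m, D x = 0 := fun x hx => D.map_algebraMap ⟨x, hx⟩
  have hqpow : ∀ (k : ℕ) (j : Fin (2 * m)), k ≠ 0 →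
      D (algebraMap (MvPolynomial (Fin (2 * m)) F) _ (X j ^ (Fintype.card F ^ k))) = 0 := by
    intro k j hk
    apply hE
    obtain ⟨k, rfl⟩ := Nat.exists_eq_succ_of_ne_zero hk
    rw [Nat.succ_eq_add_one, pow_succ, pow_mul]
    exact algebraMap_pow_mem_xiField _
  have hxi : ∀ k : Fin (2 * m), D (algebraMap (MvPolynomial (Fin (2 * m)) F) _ (xi m F k)) = 0 :=
    fun k => hE _ (IntermediateField.subset_adjoin _ _ (Or.inr ⟨k, rfl⟩))
  have hX : (fun j : Fin (2 * m) =>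
      D (algebraMap (MvPolynomial (Fin (2 * m)) F) _ (X j.rev))) = 0 := by
    apply eq_zero_of_moore_sum (F := F)
    intro k
    rcases eq_or_ne (k : ℕ) 0 with hk | hk
    · have h3 := hxi k
      rw [hk] at h3
      have h4 : D (algebraMap (MvPolynomial (Fin (2 * m)) F) _ (2 * xi m F 0)) = 0 := by
        rw [two_mul (xi m F 0), map_add, map_add, h3, add_zero]
      rw [two_mul_xi_zero, pairing, map_sum, map_sum] at h4
      simp only [map_mul, Derivation.leibniz, Finset.sum_add_distrib] at h4
      rw [← Equiv.sum_comp Fin.revPerm (fun j : Fin (2 * m) =>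
        algebraMap (MvPolynomial (Fin (2 * m)) F) (FractionRing (MvPolynomial (Fin (2 * m)) F))
          (X j.rev) • D (algebraMap (MvPolynomial (Fin (2 * m)) F) _ (X j)))] at h4
      simp only [Fin.revPerm_apply, Fin.rev_rev] at h4
      rw [← two_smul (FractionRing (MvPolynomial (Fin (2 * m)) F)), smul_eq_zero] at h4
      rw [hk]
      simpa using h4.resolve_left (two_ne_zero_fractionRing hF)
    · have h3 := hxi k
      rw [xi_eq_pairing hk, pairing, map_sum, map_sum] at h3
      simp only [map_mul, Derivation.leibniz, hqpow _ _ hk, smul_zero, add_zero] at h3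
      exact h3
  have hX' : ∀ j : Fin (2 * m), D (algebraMap (MvPolynomial (Fin (2 * m)) F) _ (X j)) = 0 :=
    fun j => by
      have := congrFun hX j.rev
      simpa using this
  have hS : ∀ f, D (algebraMap (MvPolynomial (Fin (2 * m)) F) _ f) = 0 := by
    intro f
    induction f using MvPolynomial.induction_on with
    | C a =>
      apply hE
      rw [← algebraMap_eq, ← IsScalarTower.algebraMap_apply]
      exact (xiField F m).algebraMap_mem _
    | add p r hp hr => rw [map_add, map_add, hp, hr, add_zero]
    | mul_X p i hp => rw [map_mul, Derivation.leibniz, hp, hX', smul_zero, smul_zero, add_zero]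
  obtain ⟨a, b, hb, rfl⟩ := IsFractionRing.div_surjective (A := MvPolynomial (Fin (2 * m)) F) x
  have hb0 : algebraMap _ (FractionRing (MvPolynomial (Fin (2 * m)) F)) b ≠ 0 :=
    (map_ne_zero_iff _ (IsFractionRing.injective _ _)).mpr (nonZeroDivisors.ne_zero hb)
  have h5 := hS a
  rw [← div_mul_cancel₀ (algebraMap _ (FractionRing (MvPolynomial (Fin (2 * m)) F)) a) hb0,
    Derivation.leibniz, hS b, smul_zero, zero_add] at h5
  exact (smul_eq_zero.mp h5).resolve_left hb0

theorem formallyUnramified_xiField (hF : ringChar F ≠ 2) :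
    Algebra.FormallyUnramified (xiField F m) (FractionRing (MvPolynomial (Fin (2 * m)) F)) := by
  rw [Algebra.formallyUnramified_iff]
  refine ⟨fun a b => ?_⟩
  have htop : (⊤ : Submodule (FractionRing (MvPolynomial (Fin (2 * m)) F))
      (Ω[FractionRing (MvPolynomial (Fin (2 * m)) F)⁄xiField F m])) ≤ ⊥ := by
    rw [← KaehlerDifferential.span_range_derivation, Submodule.span_le]
    rintro _ ⟨x, rfl⟩
    exact derivation_xiField_eq_zero hF _ x
  exact ((Submodule.mem_bot _).mp (htop Submodule.mem_top)).trans
    ((Submodule.mem_bot _).mp (htop Submodule.mem_top)).symm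

/-- The extension is unramified, hence separable, and also purely inseparable because it contains
all q-th powers; so it is trivial. -/
theorem xiField_eq_top (hF : ringChar F ≠ 2) (x : FractionRing (MvPolynomial (Fin (2 * m)) F)) :
    x ∈ xiField F m := by
  have : Algebra.EssFiniteType F (FractionRing (MvPolynomial (Fin (2 * m)) F)) := by
    have : Algebra.EssFiniteType (MvPolynomial (Fin (2 * m)) F)
        (FractionRing (MvPolynomial (Fin (2 * m)) F)) :=
      Algebra.EssFiniteType.of_isLocalization _ (nonZeroDivisors (MvPolynomial (Fin (2 * m)) F))
    exact Algebra.EssFiniteType.comp F (MvPolynomial (Fin (2 * m)) F) _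
  have : Algebra.EssFiniteType (xiField F m) (FractionRing (MvPolynomial (Fin (2 * m)) F)) :=
    Algebra.EssFiniteType.of_comp F _ _
  have : Algebra.FormallyUnramified (xiField F m) (FractionRing (MvPolynomial (Fin (2 * m)) F)) :=
    formallyUnramified_xiField hF
  have : Algebra.IsSeparable (xiField F m) (FractionRing (MvPolynomial (Fin (2 * m)) F)) :=
    (Algebra.FormallyUnramified.iff_isSeparable _ _).mp this
  obtain ⟨y, rfl⟩ := IsPurelyInseparable.surjective_algebraMap_of_isSeparable (xiField F m)
    (FractionRing (MvPolynomial (Fin (2 * m)) F)) x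
  exact y.2

/-- The algebra generated by the `q`-th powers and `ξ_0, …, ξ_{2m-1}`. -/
noncomputable def xiRing (F : Type*) [Field F] [Fintype F] (m : ℕ) :
    Subalgebra F (MvPolynomial (Fin (2 * m)) F) :=
  Algebra.adjoin F (((FiniteField.frobeniusAlgHom F (MvPolynomial (Fin (2 * m)) F)).range :
    Set (MvPolynomial (Fin (2 * m)) F)) ∪ Set.range fun k : Fin (2 * m) => xi m F k)

theorem pow_card_mem_xiRing (f : MvPolynomial (Fin (2 * m)) F) :
    f ^ Fintype.card F ∈ xiRing F m :=
  Algebra.subset_adjoin (Or.inl ⟨f, rfl⟩)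

/-- Rational functions which become elements of `xiRing` when multiplied by a `q`-th power. -/
def IsXiFraction (x : FractionRing (MvPolynomial (Fin (2 * m)) F)) : Prop :=
  ∃ s : MvPolynomial (Fin (2 * m)) F, s ≠ 0 ∧ ∃ a ∈ xiRing F m,
    algebraMap _ (FractionRing (MvPolynomial (Fin (2 * m)) F)) (s ^ Fintype.card F) * x =
      algebraMap _ _ a

theorem isXiFraction_algebraMap {a : MvPolynomial (Fin (2 * m)) F} (ha : a ∈ xiRing F m) :
    IsXiFraction (algebraMap _ (FractionRing (MvPolynomial (Fin (2 * m)) F)) a) :=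
  ⟨1, one_ne_zero, a, ha, by rw [one_pow, map_one, one_mul]⟩

theorem IsXiFraction.mul {x y : FractionRing (MvPolynomial (Fin (2 * m)) F)}
    (hx : IsXiFraction x) (hy : IsXiFraction y) : IsXiFraction (x * y) := by
  obtain ⟨s, hs, a, ha, h⟩ := hx
  obtain ⟨t, ht, b, hb, h'⟩ := hy
  refine ⟨s * t, mul_ne_zero hs ht, a * b, mul_mem ha hb, ?_⟩
  rw [mul_pow, map_mul, map_mul _ a b, ← h, ← h']
  ring

theorem IsXiFraction.add {x y : FractionRing (MvPolynomial (Fin (2 * m)) F)}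
    (hx : IsXiFraction x) (hy : IsXiFraction y) : IsXiFraction (x + y) := by
  obtain ⟨s, hs, a, ha, h⟩ := hx
  obtain ⟨t, ht, b, hb, h'⟩ := hy
  refine ⟨s * t, mul_ne_zero hs ht, t ^ Fintype.card F * a + s ^ Fintype.card F * b,
    add_mem (mul_mem (pow_card_mem_xiRing t) ha) (mul_mem (pow_card_mem_xiRing s) hb), ?_⟩
  rw [mul_pow, map_mul, map_add, map_mul _ _ a, map_mul _ _ b, ← h, ← h']
  ring

theorem IsXiFraction.pow {x : FractionRing (MvPolynomial (Fin (2 * m)) F)}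
    (hx : IsXiFraction x) (n : ℕ) : IsXiFraction (x ^ n) := by
  induction n with
  | zero =>
    rw [pow_zero, ← map_one (algebraMap (MvPolynomial (Fin (2 * m)) F) _)]
    exact isXiFraction_algebraMap (one_mem _)
  | succ n ih =>
    rw [pow_succ]
    exact ih.mul hx

/-- Writing x⁻¹ = x^{q−1}(x⁻¹)^q, the second factor is a q-th power, whose denominator is again a
q-th power. -/
theorem IsXiFraction.inv {x : FractionRing (MvPolynomial (Fin (2 * m)) F)}
    (hx : IsXiFraction x) : IsXiFraction x⁻¹ := by
  have hq : 0 < Fintype.card F := Fintype.card_pos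
  by_cases hx0 : x = 0
  · rwa [hx0, inv_zero, ← hx0]
  have h6 : x⁻¹ = x ^ (Fintype.card F - 1) * x⁻¹ ^ Fintype.card F := by
    obtain ⟨r, hr⟩ : ∃ r, Fintype.card F = r + 1 := ⟨_, (Nat.sub_add_cancel hq).symm⟩
    rw [hr, Nat.add_sub_cancel, pow_succ, ← mul_assoc, ← mul_pow, mul_inv_cancel₀ hx0, one_pow,
      one_mul]
  rw [h6]
  refine (hx.pow _).mul ?_
  obtain ⟨a, b, hb, rfl⟩ := IsFractionRing.div_surjective (A := MvPolynomial (Fin (2 * m)) F) x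
  have ha0 : a ≠ 0 := by
    rintro rfl
    rw [map_zero, zero_div] at hx0
    exact hx0 rfl
  have ha0' : algebraMap _ (FractionRing (MvPolynomial (Fin (2 * m)) F)) a ≠ 0 :=
    (map_ne_zero_iff _ (IsFractionRing.injective _ _)).mpr ha0
  refine ⟨a, ha0, _, pow_card_mem_xiRing b, ?_⟩
  rw [inv_div, map_pow, map_pow, ← mul_pow, mul_div_cancel₀ _ ha0']

theorem isXiFraction (hF : ringChar F ≠ 2) (x : FractionRing (MvPolynomial (Fin (2 * m)) F)) :
    IsXiFraction x := by
  have hx := xiField_eq_top hF x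
  rw [xiField] at hx
  induction hx using IntermediateField.adjoin_induction with
  | mem x hx =>
    rcases hx with ⟨i, rfl⟩ | ⟨k, rfl⟩
    · exact isXiFraction_algebraMap (pow_card_mem_xiRing _)
    · exact isXiFraction_algebraMap (Algebra.subset_adjoin (Or.inr ⟨k, rfl⟩))
  | algebraMap r =>
    rw [IsScalarTower.algebraMap_apply F (MvPolynomial (Fin (2 * m)) F)]
    exact isXiFraction_algebraMap ((xiRing F m).algebraMap_mem r)
  | add x y _ _ hx hy => exact hx.add hy
  | inv x _ hx => exact hx.inv
  | mul x y _ _ hx hy => exact hx.mul hy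

theorem exists_expansion (hF : ringChar F ≠ 2) (f : MvPolynomial (Fin (2 * m)) F) :
    ∃ s : MvPolynomial (Fin (2 * m)) F, s ≠ 0 ∧
      ∃ a : (Fin (2 * m) → Fin (Fintype.card F)) → MvPolynomial (Fin (2 * m)) F,
        s ^ Fintype.card F * f = ∑ c, a c ^ Fintype.card F * xiMonomial F m fun k => c k := by
  obtain ⟨s, hs, b, hb, h⟩ := isXiFraction hF
    (algebraMap _ (FractionRing (MvPolynomial (Fin (2 * m)) F)) f)
  obtain ⟨a, ha, hb'⟩ := exists_sum_of_mem_adjoin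
    (FiniteField.frobeniusAlgHom F (MvPolynomial (Fin (2 * m)) F)).range Fintype.card_pos
    (fun k : Fin (2 * m) => xi m F k) (fun k => ⟨_, rfl⟩) hb
  choose a' ha' using ha
  refine ⟨s, hs, a', ?_⟩
  rw [← map_mul] at h
  rw [IsFractionRing.injective _ (FractionRing (MvPolynomial (Fin (2 * m)) F)) h, hb']
  exact Finset.sum_congr rfl fun c _ => by rw [← ha']; rfl

end FieldExtension

/-! ### Expansion in ξ-monomials: uniqueness and polynomial coefficients -/

section Expansion

variable {F : Type*} [Field F] [Fintype F] {m : ℕ} (hF : ringChar F ≠ 2)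

include hF

theorem exists_cartier_top_eq : ∃ c : F, c ≠ 0 ∧
    cartier (mooreDet F (2 * m) * xiMonomial F m fun _ => Fintype.card F - 1) =
      C c * mooreDet F (2 * m) := by
  have hq : 0 < Fintype.card F := Fintype.card_pos
  obtain ⟨c, hc⟩ := cartier_mooreDet_xiMonomial_top (F := F) (m := m) hF
  refine ⟨c, ?_, hc⟩
  rintro rfl
  rw [C_0, zero_mul] at hc
  -- For f = L^{q−1} ∏ X_i^{q−1}, the product L s^q f equals (sL)^q ∏ X_i^{q−1}, on which the
  -- operator takes the nonzero value sL. A vanishing scalar would make this value zero.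
  obtain ⟨s, hs, a, ha⟩ := exists_expansion hF
    (mooreDet F (2 * m) ^ (Fintype.card F - 1) * monomial (topExp F (2 * m)) 1)
  have h := cartier_mooreDet_sum hF a fun _ => ⟨Fintype.card F - 1, Nat.sub_lt hq one_pos⟩
  rw [hc, mul_zero, ← ha] at h
  have h2 : mooreDet F (2 * m) * (s ^ Fintype.card F * (mooreDet F (2 * m) ^ (Fintype.card F - 1) *
      monomial (topExp F (2 * m)) 1) * xiMonomial F m fun _ => Fintype.card F - 1 -
        (Fintype.card F - 1)) = (s * mooreDet F (2 * m)) ^ Fintype.card F *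
          monomial (topExp F (2 * m)) 1 := by
    have h3 : (xiMonomial F m fun _ => Fintype.card F - 1 - (Fintype.card F - 1)) = 1 := by
      simp [xiMonomial]
    obtain ⟨r, hr⟩ : ∃ r, Fintype.card F = r + 1 := ⟨_, (Nat.sub_add_cancel hq).symm⟩
    rw [h3, mul_one, hr, Nat.add_sub_cancel, mul_pow, pow_succ (mooreDet F (2 * m))]
    ring
  rw [h2, cartier_pow_mul, cartier_topExp, mul_one] at h
  exact mul_ne_zero hs mooreDet_ne_zero h

/-- The monomials in `ξ_0, …, ξ_{2m-1}` with exponents less than `q` are linearly independent over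
the ring of `q`-th powers. -/
theorem eq_zero_of_sum_xiMonomial_eq_zero
    {a : (Fin (2 * m) → Fin (Fintype.card F)) → MvPolynomial (Fin (2 * m)) F}
    (ha : ∑ d, a d ^ Fintype.card F * xiMonomial F m (fun k => d k) = 0) : a = 0 := by
  obtain ⟨c, hc, htop⟩ := exists_cartier_top_eq (m := m) hF
  ext1 d
  have h := cartier_mooreDet_sum hF a d
  rw [ha, zero_mul, mul_zero, map_zero, htop] at h
  exact (mul_eq_zero.mp h.symm).resolve_right
    (mul_ne_zero ((map_ne_zero_iff _ (C_injective _ _)).mpr hc) mooreDet_ne_zero)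

/-- Every polynomial in the `ξ_k` is a combination of monomials in `ξ_0, …, ξ_{2m-1}` with exponents
less than `q`, with coefficients that are `q`-th powers. -/
theorem exists_sum_xiMonomial {f : MvPolynomial (Fin (2 * m)) F}
    (hf : f ∈ Algebra.adjoin F (Set.range (xi m F))) :
    ∃ b : (Fin (2 * m) → Fin (Fintype.card F)) → MvPolynomial (Fin (2 * m)) F,
      f = ∑ d, b d ^ Fintype.card F * xiMonomial F m fun k => d k := by
  have hq : 0 < Fintype.card F := Fintype.card_pos
  obtain ⟨c, hc, htop⟩ := exists_cartier_top_eq (m := m) hF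
  obtain ⟨s, hs, a, ha⟩ := exists_expansion hF f
  -- By duality, a_d · cL = κ(L s^q f ξ^{q−1−d}) = s κ(L f ξ^{q−1−d}). The last factor is divisible
  -- by L because f ξ^{q−1−d} is a polynomial in the ξ_k; cancelling L shows that s divides a_d.
  have h1 : ∀ d : Fin (2 * m) → Fin (Fintype.card F), ∃ b, a d * C c = s * b := by
    intro d
    have h := cartier_mooreDet_sum hF a d
    obtain ⟨b, hb⟩ := mooreDet_dvd_cartier hF
      (mul_mem hf (xiMonomial_mem (F := F) fun k : Fin (2 * m) => Fintype.card F - 1 - d k))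
    refine ⟨b, mul_right_cancel₀ (mooreDet_ne_zero (F := F) (n := 2 * m)) ?_⟩
    rw [← ha, htop, mul_assoc, mul_left_comm, cartier_pow_mul, hb] at h
    rw [mul_assoc, ← h]
    ring
  choose b hb using h1
  have hcu : (C c * C c⁻¹ : MvPolynomial (Fin (2 * m)) F) = 1 := by
    rw [← C_mul, mul_inv_cancel₀ hc, C_1]
  have h2 : ∀ d, a d = s * (b d * C c⁻¹) := fun d => by
    rw [← mul_assoc, ← hb, mul_assoc, hcu, mul_one]
  refine ⟨fun d => b d * C c⁻¹, mul_left_cancel₀ (pow_ne_zero (Fintype.card F) hs) ?_⟩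
  rw [ha, Finset.mul_sum]
  refine Finset.sum_congr rfl fun d _ => ?_
  rw [h2 d, mul_pow, mul_assoc]

end Expansion

/-! ### Adding the outer pair y_1, x_1 to the variables -/

section Indices

variable {m : ℕ}

/-- The position in the list of `2(m+1)` variables of the `i`-th variable other than `y_1, x_1`. -/
def mid (i : Fin (2 * m)) : Fin (2 * (m + 1)) := Fin.succ (n := 2 * m + 1) i.castSucc

/-- The position of `y_1`. -/
def fstIdx (m : ℕ) : Fin (2 * (m + 1)) := (0 : Fin (2 * m + 1 + 1))

/-- The position of `x_1`. -/
def lstIdx (m : ℕ) : Fin (2 * (m + 1)) := Fin.last (2 * m + 1)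

/-- The vector with entries `a`, `w`, `b`. -/
def mkVec {A : Type*} (a : A) (w : Fin (2 * m) → A) (b : A) : Fin (2 * (m + 1)) → A :=
  Fin.cons (n := 2 * m + 1) (α := fun _ => A) a (Fin.snoc (α := fun _ => A) w b)

@[simp] theorem mkVec_fst {A : Type*} (a : A) (w : Fin (2 * m) → A) (b : A) :
    mkVec a w b (fstIdx m) = a := rfl

@[simp] theorem mkVec_mid {A : Type*} (a : A) (w : Fin (2 * m) → A) (b : A) (i : Fin (2 * m)) :
    mkVec a w b (mid i) = w i := by
  simp only [mkVec, mid]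
  rw [Fin.cons_succ, Fin.snoc_castSucc]

@[simp] theorem mkVec_lst {A : Type*} (a : A) (w : Fin (2 * m) → A) (b : A) :
    mkVec a w b (lstIdx m) = b := by
  have : lstIdx m = Fin.succ (n := 2 * m + 1) (Fin.last (2 * m)) := rfl
  rw [this]
  simp only [mkVec]
  rw [Fin.cons_succ, Fin.snoc_last]

theorem idx_cases {P : Fin (2 * (m + 1)) → Prop} (h0 : P (fstIdx m)) (h1 : ∀ i, P (mid i))
    (h2 : P (lstIdx m)) (j : Fin (2 * (m + 1))) : P j := by
  refine Fin.cases (n := 2 * m + 1) (motive := P) h0 (fun i => ?_) j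
  refine Fin.lastCases (motive := fun i => P (Fin.succ (n := 2 * m + 1) i)) h2 (fun i => h1 i) i

theorem sum_idx {A : Type*} [AddCommMonoid A] (f : Fin (2 * (m + 1)) → A) :
    ∑ j, f j = f (fstIdx m) + (∑ i, f (mid i) + f (lstIdx m)) := by
  have h := Fin.sum_univ_succ (n := 2 * m + 1) f
  rw [Fin.sum_univ_castSucc (fun i => f (Fin.succ (n := 2 * m + 1) i))] at h
  exact h

theorem rev_mid (i : Fin (2 * m)) : (mid i).rev = mid i.rev := by
  ext
  have := i.2
  simp only [mid, Fin.val_rev, Fin.val_succ, Fin.val_castSucc]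
  omega

theorem rev_fstIdx : (fstIdx m).rev = lstIdx m := by
  ext
  simp [fstIdx, lstIdx, Fin.val_rev]

theorem rev_lstIdx : (lstIdx m).rev = fstIdx m := by
  rw [← rev_fstIdx, Fin.rev_rev]

theorem mid_injective : Function.Injective (mid : Fin (2 * m) → Fin (2 * (m + 1))) := by
  intro i j h
  have := congrArg Fin.val h
  simp only [mid, Fin.val_succ, Fin.val_castSucc] at this
  ext
  omega

theorem fstIdx_lt_mid (i : Fin (2 * m)) : fstIdx m < mid i := by
  rw [Fin.lt_def]
  simp [fstIdx, mid]

theorem mid_lt_lstIdx (i : Fin (2 * m)) : mid i < lstIdx m := by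
  rw [Fin.lt_def]
  have := i.2
  simp only [lstIdx, mid, Fin.val_succ, Fin.val_castSucc, Fin.val_last]
  omega

theorem fstIdx_lt_lstIdx : fstIdx m < lstIdx m := by
  rw [Fin.lt_def]
  simp [fstIdx, lstIdx]

theorem mid_lt_mid {i j : Fin (2 * m)} : mid i < mid j ↔ i < j := by
  rw [Fin.lt_def, Fin.lt_def]
  simp [mid]

theorem mid_ne_fstIdx (i : Fin (2 * m)) : mid i ≠ fstIdx m := (fstIdx_lt_mid i).ne'

theorem mid_ne_lstIdx (i : Fin (2 * m)) : mid i ≠ lstIdx m := (mid_lt_lstIdx i).ne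

theorem fstIdx_ne_lstIdx : fstIdx m ≠ lstIdx m := fstIdx_lt_lstIdx.ne

theorem pairing_idx {A : Type*} [CommRing A] (u v : Fin (2 * (m + 1)) → A) :
    pairing u v = u (fstIdx m) * v (lstIdx m) + (pairing (u ∘ mid) (v ∘ mid) +
      u (lstIdx m) * v (fstIdx m)) := by
  rw [pairing, sum_idx]
  simp only [rev_mid, rev_fstIdx, rev_lstIdx]
  rfl

theorem yIdx_zero : yIdx (0 : Fin (m + 1)) = fstIdx m := rfl

theorem xIdx_zero : xIdx (0 : Fin (m + 1)) = lstIdx m := by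
  rw [xIdx, yIdx_zero, rev_fstIdx]

theorem yIdx_succ (i : Fin m) : yIdx i.succ = mid (yIdx i) := by
  ext
  simp [yIdx, mid]

theorem xIdx_succ (i : Fin m) : xIdx i.succ = mid (xIdx i) := by
  rw [xIdx, yIdx_succ, rev_mid]
  rfl

end Indices

/-! ### P_{m+1} as an extension of P_m by its unipotent radical -/

section Structure

variable {F : Type*} [Field F] [Fintype F] {m : ℕ}

/-- The inclusion of the polynomial ring in the variables other than `y_1, x_1`. -/
noncomputable def inc (F : Type*) [Field F] (m : ℕ) :
    MvPolynomial (Fin (2 * m)) F →ₐ[F] MvPolynomial (Fin (2 * (m + 1))) F :=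
  rename mid

@[simp] theorem inc_X (i : Fin (2 * m)) : inc F m (X i) = X (mid i) := by simp [inc]

theorem xi_succ_zero : xi (m + 1) F 0 = X (fstIdx m) * X (lstIdx m) + inc F m (xi m F 0) := by
  rw [xi, xi, if_pos rfl, if_pos rfl, Fin.sum_univ_succ, map_sum]
  simp only [map_mul, inc_X, yIdx_zero, xIdx_zero, yIdx_succ, xIdx_succ]

theorem xi_succ {k : ℕ} (hk : k ≠ 0) : xi (m + 1) F k =
    X (fstIdx m) ^ (Fintype.card F ^ k) * X (lstIdx m) +
      X (fstIdx m) * X (lstIdx m) ^ (Fintype.card F ^ k) + inc F m (xi m F k) := by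
  rw [xi, xi, if_neg hk, if_neg hk, Fin.sum_univ_succ, map_sum]
  simp only [map_mul, map_add, map_pow, inc_X, yIdx_zero, xIdx_zero, yIdx_succ, xIdx_succ]

/-- Upper unitriangular matrices as elements of the general linear group. -/
noncomputable def unitriangular {n : ℕ} (M : Matrix (Fin n) (Fin n) F)
    (h : ∀ i j, j < i → M i j = 0) (h' : ∀ i, M i i = 1) : GL (Fin n) F :=
  Matrix.GeneralLinearGroup.mkOfDetNeZero M (by
    rw [Matrix.det_of_isUpperTriangular fun i j hij => h i j hij]
    simp [h'])

/-- The matrix with first row `(1, a, c)`, last row `(0, 0, 1)` and middle rows `(0, h_i, l_i)`. -/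
def blockMatrix (a : Fin (2 * m) → F) (c : F) (h : Matrix (Fin (2 * m)) (Fin (2 * m)) F)
    (l : Fin (2 * m) → F) : Matrix (Fin (2 * (m + 1))) (Fin (2 * (m + 1))) F :=
  Matrix.of (mkVec (mkVec 1 a c) (fun i => mkVec 0 (h i) (l i)) (mkVec 0 0 1))

theorem blockMatrix_lower {a : Fin (2 * m) → F} {c : F} {h : Matrix (Fin (2 * m)) (Fin (2 * m)) F}
    {l : Fin (2 * m) → F} (hh : ∀ i j, j < i → h i j = 0) (i j : Fin (2 * (m + 1))) (hij : j < i) :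
    blockMatrix a c h l i j = 0 := by
  rw [blockMatrix, Matrix.of_apply]
  induction i using idx_cases with
  | h0 => exact absurd hij (Nat.not_lt_zero _)
  | h1 i =>
    revert hij
    induction j using idx_cases with
    | h0 => simp
    | h1 j =>
      intro hij
      simpa using hh i j (mid_lt_mid.mp hij)
    | h2 =>
      intro hij
      exact absurd hij (mid_lt_lstIdx i).not_gt
  | h2 =>
    revert hij
    induction j using idx_cases with
    | h0 => simp
    | h1 j => simp
    | h2 =>
      intro hij
      exact absurd hij (lt_irrefl _)

theorem blockMatrix_diag {a : Fin (2 * m) → F} {c : F} {h : Matrix (Fin (2 * m)) (Fin (2 * m)) F}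
    {l : Fin (2 * m) → F} (hh : ∀ i, h i i = 1) (i : Fin (2 * (m + 1))) :
    blockMatrix a c h l i i = 1 := by
  rw [blockMatrix, Matrix.of_apply]
  induction i using idx_cases with
  | h0 => simp
  | h1 i => simp [hh]
  | h2 => simp

section BlockElement

variable (a : Fin (2 * m) → F) (c : F) (h : Matrix (Fin (2 * m)) (Fin (2 * m)) F)
  (l : Fin (2 * m) → F) (h0 : ∀ i j, j < i → h i j = 0) (h1 : ∀ i, h i i = 1)

/-- The element of the general linear group given by a unitriangular block matrix. -/
noncomputable def blockElt : GL (Fin (2 * (m + 1))) F :=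
  unitriangular (blockMatrix a c h l) (blockMatrix_lower h0) (blockMatrix_diag h1)

theorem coe_blockElt : (blockElt a c h l h0 h1 : Matrix _ _ F) = blockMatrix a c h l := rfl

theorem blockElt_mem_upperUnipotent : blockElt a c h l h0 h1 ∈ upperUnipotent (2 * (m + 1)) F :=
  ⟨blockMatrix_lower h0, blockMatrix_diag h1⟩

theorem act_blockElt_fst : act (blockElt a c h l h0 h1) (X (fstIdx m)) =
    X (fstIdx m) + (inc F m (linForm a) + C c * X (lstIdx m)) := by
  rw [act_X, sum_idx, coe_blockElt, blockMatrix]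
  simp [linForm]

theorem act_blockElt_mid (i : Fin (2 * m)) : act (blockElt a c h l h0 h1) (X (mid i)) =
    inc F m (linForm (h i)) + C (l i) * X (lstIdx m) := by
  rw [act_X, sum_idx, coe_blockElt, blockMatrix]
  simp [linForm]

theorem act_blockElt_lst : act (blockElt a c h l h0 h1) (X (lstIdx m)) = X (lstIdx m) := by
  rw [act_X, sum_idx, coe_blockElt, blockMatrix]
  simp

end BlockElement

theorem zero_lt_diag : (∀ i j : Fin (2 * m), j < i → (1 : Matrix (Fin (2 * m)) (Fin (2 * m)) F) i j = 0) ∧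
    ∀ i : Fin (2 * m), (1 : Matrix (Fin (2 * m)) (Fin (2 * m)) F) i i = 1 :=
  ⟨fun _ _ h => Matrix.one_apply_ne h.ne', fun _ => Matrix.one_apply_eq _⟩

/-- The elements of the unipotent radical of the stabiliser of the line spanned by `x_1`. -/
noncomputable def radElt (l : Fin (2 * m) → F) : GL (Fin (2 * (m + 1))) F :=
  blockElt (fun j => -l j.rev) (-aeval l (xi m F 0)) 1 l zero_lt_diag.1 zero_lt_diag.2

theorem linForm_one (i : Fin (2 * m)) :
    linForm ((1 : Matrix (Fin (2 * m)) (Fin (2 * m)) F) i) = X i := by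
  rw [linForm, Finset.sum_eq_single i]
  · simp
  · intro j _ hj
    simp [Matrix.one_apply_ne hj.symm]
  · simp

theorem act_radElt_mid (l : Fin (2 * m) → F) (i : Fin (2 * m)) :
    act (radElt l) (X (mid i)) = X (mid i) + C (l i) * X (lstIdx m) := by
  rw [radElt, act_blockElt_mid, linForm_one, inc_X]

theorem act_radElt_lst (l : Fin (2 * m) → F) :
    act (radElt l) (X (lstIdx m)) = X (lstIdx m) := act_blockElt_lst _ _ _ _ _ _

theorem act_radElt_fst (l : Fin (2 * m) → F) :
    act (radElt l) (X (fstIdx m)) = X (fstIdx m) +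
      (inc F m (linForm fun j => -l j.rev) + C (-aeval l (xi m F 0)) * X (lstIdx m)) :=
  act_blockElt_fst _ _ _ _ _ _

theorem act_inc_xi_zero (g : GL (Fin (2 * (m + 1))) F) (u v : Fin (2 * m) → MvPolynomial (Fin (2 * (m + 1))) F)
    (h : ∀ i, act g (X (mid i)) = u i + v i) : act g (inc F m (xi m F 0)) =
      aeval u (xi m F 0) + aeval v (xi m F 0) + pairing u v := by
  rw [← aeval_xi_zero_add, ← AlgHom.comp_apply]
  congr 1
  ext1 i
  simp [h]

/-- In ξ_0, the cross term created by w ↦ w + lx is cancelled by the linear part added to y_1, and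
the x²-term by the scalar ξ_0(l) subtracted in the corner. -/
theorem radElt_mem (l : Fin (2 * m) → F) : radElt l ∈ sylow (m + 1) F := by
  refine ⟨?_, blockElt_mem_upperUnipotent _ _ _ _ _ _⟩
  change act (radElt l) (xi (m + 1) F 0) = xi (m + 1) F 0
  rw [xi_succ_zero, map_add, map_mul, act_radElt_fst, act_radElt_lst,
    act_inc_xi_zero _ _ _ (act_radElt_mid l)]
  have h1 : aeval (fun i => (X (mid i) : MvPolynomial (Fin (2 * (m + 1))) F)) (xi m F 0) =
      inc F m (xi m F 0) := by
    congr 1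
    ext1 i
    simp
  have h2 : aeval (fun i => (C (l i) * X (lstIdx m) : MvPolynomial (Fin (2 * (m + 1))) F))
      (xi m F 0) = C (aeval l (xi m F 0)) * X (lstIdx m) ^ 2 := by
    rw [aeval_xi_zero, aeval_xi_zero, map_sum, Finset.sum_mul]
    refine Finset.sum_congr rfl fun i _ => ?_
    rw [C_mul]
    ring
  have h3 : pairing (fun i => (X (mid i) : MvPolynomial (Fin (2 * (m + 1))) F))
      (fun i => C (l i) * X (lstIdx m)) = -inc F m (linForm fun j => -l j.rev) * X (lstIdx m) := by
    rw [pairing, linForm, map_sum, ← Finset.sum_neg_distrib, Finset.sum_mul]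
    refine Finset.sum_congr rfl fun i _ => ?_
    simp only [map_mul, inc_X, C_neg, map_neg]
    rw [show inc F m (C (l i.rev)) = C (l i.rev) from algHom_C _ _]
    ring
  rw [h1, h2, h3, C_neg]
  ring

/-- The embedding of the Sylow subgroup of the smaller orthogonal group. -/
noncomputable def embElt {h : GL (Fin (2 * m)) F} (hh : h ∈ sylow m F) : GL (Fin (2 * (m + 1))) F :=
  blockElt 0 0 (h : Matrix (Fin (2 * m)) (Fin (2 * m)) F) 0 hh.2.1 hh.2.2

theorem linForm_zero {n : ℕ} : linForm (0 : Fin n → F) = 0 := by simp [linForm]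

theorem act_embElt_fst {h : GL (Fin (2 * m)) F} (hh : h ∈ sylow m F) :
    act (embElt hh) (X (fstIdx m)) = X (fstIdx m) := by
  rw [embElt, act_blockElt_fst, linForm_zero]
  simp

theorem act_embElt_lst {h : GL (Fin (2 * m)) F} (hh : h ∈ sylow m F) :
    act (embElt hh) (X (lstIdx m)) = X (lstIdx m) := act_blockElt_lst _ _ _ _ _ _

theorem act_embElt_inc {h : GL (Fin (2 * m)) F} (hh : h ∈ sylow m F)
    (f : MvPolynomial (Fin (2 * m)) F) : act (embElt hh) (inc F m f) = inc F m (act h f) := by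
  rw [← AlgHom.comp_apply, ← AlgHom.comp_apply]
  congr 1
  ext1 i
  rw [AlgHom.comp_apply, AlgHom.comp_apply, inc_X, embElt, act_blockElt_mid, act_X]
  simp [linForm]

theorem embElt_mem {h : GL (Fin (2 * m)) F} (hh : h ∈ sylow m F) : embElt hh ∈ sylow (m + 1) F := by
  refine ⟨?_, blockElt_mem_upperUnipotent _ _ _ _ _ _⟩
  change act (embElt hh) (xi (m + 1) F 0) = xi (m + 1) F 0
  rw [xi_succ_zero, map_add, map_mul, act_embElt_fst, act_embElt_lst, act_embElt_inc,
    act_xi hh.1]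

theorem act_lst {g : GL (Fin (2 * (m + 1))) F} (hg : g ∈ sylow (m + 1) F) :
    act g (X (lstIdx m)) = X (lstIdx m) := by
  rw [act_X, sum_idx, hg.2.1 _ _ fstIdx_lt_lstIdx, hg.2.2]
  simp [hg.2.1 _ _ (mid_lt_lstIdx _)]

theorem act_fst {g : GL (Fin (2 * (m + 1))) F} (hg : g ∈ sylow (m + 1) F) :
    act g (X (fstIdx m)) = X (fstIdx m) +
      (inc F m (linForm fun j => (g : Matrix (Fin (2 * (m + 1))) (Fin (2 * (m + 1))) F) (fstIdx m) (mid j)) +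
        C ((g : Matrix (Fin (2 * (m + 1))) (Fin (2 * (m + 1))) F) (fstIdx m) (lstIdx m)) * X (lstIdx m)) := by
  rw [act_X, sum_idx, hg.2.2]
  simp [linForm]

/-- Every element of the Sylow subgroup acts on the variables other than `y_1, x_1` through an
element of the smaller Sylow subgroup, modulo `x_1`. -/
theorem exists_act_mid {g : GL (Fin (2 * (m + 1))) F} (hg : g ∈ sylow (m + 1) F) :
    ∃ h ∈ sylow m F, ∀ i, act g (X (mid i)) =
      inc F m (act h (X i)) + C ((g : Matrix (Fin (2 * (m + 1))) (Fin (2 * (m + 1))) F) (mid i) (lstIdx m)) * X (lstIdx m) := by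
  set h : GL (Fin (2 * m)) F := unitriangular
    (Matrix.of fun i j => (g : Matrix (Fin (2 * (m + 1))) (Fin (2 * (m + 1))) F) (mid i) (mid j))
    (fun i j hij => hg.2.1 _ _ (mid_lt_mid.mpr hij)) (fun i => hg.2.2 _) with hh
  have hcoe : (h : Matrix (Fin (2 * m)) (Fin (2 * m)) F) = Matrix.of fun i j => (g : Matrix (Fin (2 * (m + 1))) (Fin (2 * (m + 1))) F) (mid i) (mid j) := rfl
  have hact : ∀ i, act g (X (mid i)) =
      inc F m (act h (X i)) + C ((g : Matrix (Fin (2 * (m + 1))) (Fin (2 * (m + 1))) F) (mid i) (lstIdx m)) * X (lstIdx m) := by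
    intro i
    rw [act_X, sum_idx, hg.2.1 _ _ (fstIdx_lt_mid i), act_X, hcoe]
    simp
  refine ⟨h, ⟨?_, fun i j hij => hg.2.1 _ _ (mid_lt_mid.mpr hij), fun i => hg.2.2 _⟩, hact⟩
  change act h (xi m F 0) = xi m F 0
  have hg0 : act g (xi (m + 1) F 0) = xi (m + 1) F 0 := hg.1
  rw [xi_succ_zero, map_add, map_mul, act_lst hg] at hg0
  -- Setting y_1 = x_1 = 0 in the invariance of ξ_0 under g leaves the invariance of the smaller ξ_0
  -- under h.
  set π : MvPolynomial (Fin (2 * (m + 1))) F →ₐ[F] MvPolynomial (Fin (2 * m)) F :=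
    aeval (mkVec 0 X 0) with hπ
  have h1 := congrArg π hg0
  have hl : π (X (lstIdx m)) = 0 := by simp [hπ]
  have hinc : ∀ f, π (inc F m f) = f := by
    intro f
    rw [← AlgHom.comp_apply]
    have : π.comp (inc F m) = AlgHom.id F _ := by
      ext1 i
      simp [hπ]
    rw [this, AlgHom.id_apply]
  have h2 : ∀ f, π (act g (inc F m f)) = act h f := by
    intro f
    rw [← AlgHom.comp_apply, ← AlgHom.comp_apply]
    congr 1
    ext1 i
    rw [AlgHom.comp_apply, AlgHom.comp_apply, inc_X, hact, map_add, map_mul, hl, mul_zero,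
      add_zero, hinc]
  simp only [map_add, map_mul, hl, mul_zero, zero_add, hinc, h2] at h1
  exact h1

end Structure

/-! ### The additive polynomial v^q − x^{q−1}v -/

section Twist

variable {F : Type*} [Field F] [Fintype F] {A : Type*} [CommRing A] [Algebra F A]

/-- The additive polynomial `v ↦ v ^ q - x ^ (q - 1) v`. -/
noncomputable def twist (F : Type*) [Field F] [Fintype F] {A : Type*} [CommRing A] [Algebra F A]
    (x : A) : A →ₗ[F] A :=
  (FiniteField.frobeniusAlgHom F A).toLinearMap -
    LinearMap.mulLeft F (x ^ (Fintype.card F - 1))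

theorem twist_apply (x v : A) :
    twist F x v = v ^ Fintype.card F - x ^ (Fintype.card F - 1) * v := by
  simp [twist, FiniteField.frobeniusAlgHom_apply]

theorem twist_self (x : A) : twist F x x = 0 := by
  rw [twist_apply, pow_sub_one_mul Fintype.card_ne_zero, sub_self]

theorem twist_add_smul (x v : A) (c : F) : twist F x (v + c • x) = twist F x v := by
  rw [map_add, map_smul, twist_self, smul_zero, add_zero]

theorem map_twist {B : Type*} [CommRing B] [Algebra F B] (φ : A →ₐ[F] B) (x v : A) :
    φ (twist F x v) = twist F (φ x) (φ v) := by
  simp [twist_apply]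

theorem prod_X_sub_C_eq : ∏ c : F, (Polynomial.X - Polynomial.C c) =
    (Polynomial.X ^ Fintype.card F - Polynomial.X : Polynomial F) := by
  have h1 : (Polynomial.X ^ Fintype.card F - Polynomial.X : Polynomial F).Monic :=
    Polynomial.monic_X_pow_sub (by
      rw [Polynomial.degree_X]
      exact_mod_cast Fintype.one_lt_card)
  have h2 := Polynomial.prod_multiset_X_sub_C_of_monic_of_roots_card_eq h1 (by
    rw [FiniteField.roots_X_pow_card_sub_X,
      FiniteField.X_pow_card_sub_X_natDegree_eq _ Fintype.one_lt_card]
    rfl)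
  rw [FiniteField.roots_X_pow_card_sub_X] at h2
  exact h2

/-- This is T^q − T = ∏ (T − c) evaluated at v/x and multiplied by x^q. -/
theorem prod_add_smul_of_field {K : Type*} [Field K] [Algebra F K] (x v : K) :
    ∏ c : F, (v + c • x) = twist F x v := by
  rw [twist_apply]
  rcases eq_or_ne x 0 with rfl | hx
  · have : Fintype.card F - 1 ≠ 0 := Nat.sub_ne_zero_of_lt Fintype.one_lt_card
    simp [this, Finset.card_univ]
  have h := congrArg (Polynomial.aeval (v / x)) (prod_X_sub_C_eq (F := F))
  rw [map_prod] at h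
  simp only [map_sub, map_pow, Polynomial.aeval_X, Polynomial.aeval_C] at h
  have h1 : ∏ c : F, (v + c • x) = ∏ c : F, (v / x - algebraMap F K c) * x := by
    rw [← Equiv.prod_comp (Equiv.neg F)]
    refine Finset.prod_congr rfl fun c _ => ?_
    rw [Equiv.neg_apply, neg_smul, Algebra.smul_def, sub_mul, div_mul_cancel₀ _ hx, sub_eq_add_neg]
  rw [h1, Finset.prod_mul_distrib, h, Finset.prod_const, Finset.card_univ]
  obtain ⟨k, hk⟩ := Nat.exists_eq_succ_of_ne_zero (Fintype.card_ne_zero (α := F))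
  rw [hk]
  simp only [Nat.succ_eq_add_one, Nat.add_sub_cancel]
  rw [sub_mul, ← mul_pow, div_mul_cancel₀ _ hx, pow_succ x k]
  field_simp

theorem prod_add_smul [IsDomain A] (x v : A) : ∏ c : F, (v + c • x) = twist F x v := by
  apply FaithfulSMul.algebraMap_injective A (FractionRing A)
  have h := prod_add_smul_of_field (F := F) (algebraMap A (FractionRing A) x)
    (algebraMap A (FractionRing A) v)
  rw [map_prod]
  simp only [map_add, twist_apply, map_sub, map_pow, map_mul] at h ⊢
  rw [← h]
  refine Finset.prod_congr rfl fun c _ => ?_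
  rw [Algebra.smul_def, Algebra.smul_def, map_mul, ← IsScalarTower.algebraMap_apply]

end Twist

/-! ### The maps φ and ρ between levels m and m + 1 -/

section Phi

variable {F : Type*} [Field F] [Fintype F] {m : ℕ}

/-- The algebra homomorphism sending each variable `w` to `w ^ q - x_1 ^ (q - 1) w`. -/
noncomputable def phi (F : Type*) [Field F] [Fintype F] (m : ℕ) :
    MvPolynomial (Fin (2 * m)) F →ₐ[F] MvPolynomial (Fin (2 * (m + 1))) F :=
  aeval fun i => twist F (X (lstIdx m)) (X (mid i))

@[simp] theorem phi_X (i : Fin (2 * m)) :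
    phi F m (X i) = twist F (X (lstIdx m)) (X (mid i)) := by simp [phi]

theorem phi_linForm (a : Fin (2 * m) → F) :
    phi F m (linForm a) = twist F (X (lstIdx m)) (inc F m (linForm a)) := by
  simp only [linForm, map_sum, ← smul_eq_C_mul, map_smul, phi_X, inc_X]

theorem act_X_eq_linForm {n : ℕ} (g : GL (Fin n) F) (i : Fin n) :
    act g (X i) = linForm ((g : Matrix (Fin n) (Fin n) F) i) := act_X g i

/-- The twist is F-linear and kills x, so the translation part of g becomes invisible. -/
theorem act_phi {g : GL (Fin (2 * (m + 1))) F} (hg : g ∈ sylow (m + 1) F)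
    {h : GL (Fin (2 * m)) F} {l : Fin (2 * m) → F}
    (hact : ∀ i, act g (X (mid i)) = inc F m (act h (X i)) + C (l i) * X (lstIdx m))
    (f : MvPolynomial (Fin (2 * m)) F) : act g (phi F m f) = phi F m (act h f) := by
  rw [← AlgHom.comp_apply, ← AlgHom.comp_apply]
  congr 1
  ext1 i
  rw [AlgHom.comp_apply, AlgHom.comp_apply, phi_X, map_twist, act_lst hg, hact, ← smul_eq_C_mul,
    twist_add_smul, act_X_eq_linForm, phi_linForm]

theorem phi_mem {f : MvPolynomial (Fin (2 * m)) F} (hf : f ∈ invariants (sylow m F)) :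
    phi F m f ∈ invariants (sylow (m + 1) F) := by
  intro g hg
  obtain ⟨h, hh, hact⟩ := exists_act_mid hg
  rw [act_phi hg hact, hf h hh]

theorem act_embElt_phi {h : GL (Fin (2 * m)) F} (hh : h ∈ sylow m F)
    (f : MvPolynomial (Fin (2 * m)) F) :
    act (embElt hh) (phi F m f) = phi F m (act h f) := by
  refine act_phi (embElt_mem hh) (l := 0) (fun i => ?_) f
  rw [← act_embElt_inc hh, inc_X]
  simp

theorem xi_mem (k : ℕ) : xi m F k ∈ invariants (sylow m F) := fun _ hg => act_xi hg.1 k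

/-- Reduction modulo `x_1`, with `y_1` as polynomial variable. -/
noncomputable def rho (F : Type*) [Field F] (m : ℕ) : MvPolynomial (Fin (2 * (m + 1))) F →ₐ[F]
    Polynomial (MvPolynomial (Fin (2 * m)) F) :=
  aeval (mkVec Polynomial.X (fun i => Polynomial.C (X i)) 0)

@[simp] theorem rho_fst : rho F m (X (fstIdx m)) = Polynomial.X := by simp [rho]

@[simp] theorem rho_lst : rho F m (X (lstIdx m)) = 0 := by simp [rho]

@[simp] theorem rho_mid (i : Fin (2 * m)) : rho F m (X (mid i)) = Polynomial.C (X i) := by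
  simp [rho]

@[simp] theorem rho_inc (f : MvPolynomial (Fin (2 * m)) F) : rho F m (inc F m f) = Polynomial.C f := by
  have : (rho F m).comp (inc F m) =
      IsScalarTower.toAlgHom F (MvPolynomial (Fin (2 * m)) F) _ := by
    ext1 i
    simp [Polynomial.algebraMap_apply]
  exact DFunLike.congr_fun this f

@[simp] theorem rho_phi (f : MvPolynomial (Fin (2 * m)) F) :
    rho F m (phi F m f) = Polynomial.C (f ^ Fintype.card F) := by
  have : (rho F m).comp (phi F m) =
      (IsScalarTower.toAlgHom F (MvPolynomial (Fin (2 * m)) F) _).comp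
        (FiniteField.frobeniusAlgHom F (MvPolynomial (Fin (2 * m)) F)) := by
    ext1 i
    have hq : Fintype.card F - 1 ≠ 0 := Nat.sub_ne_zero_of_lt Fintype.one_lt_card
    simp only [AlgHom.comp_apply, phi_X, map_twist, rho_lst, rho_mid, twist_apply,
      FiniteField.frobeniusAlgHom_apply, zero_pow hq, zero_mul, sub_zero]
    simp [Polynomial.algebraMap_apply, zero_pow hq]
  exact DFunLike.congr_fun this f

@[simp] theorem rho_xi (k : ℕ) : rho F m (xi (m + 1) F k) = Polynomial.C (xi m F k) := by
  rcases eq_or_ne k 0 with rfl | hk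
  · rw [xi_succ_zero]
    simp
  · rw [xi_succ hk]
    simp

/-- A section of `rho`. -/
noncomputable def rhoSection (F : Type*) [Field F] (m : ℕ) :
    Polynomial (MvPolynomial (Fin (2 * m)) F) →+* MvPolynomial (Fin (2 * (m + 1))) F :=
  Polynomial.eval₂RingHom (inc F m : MvPolynomial (Fin (2 * m)) F →+* _) (X (fstIdx m))

/-- Modulo x, a polynomial agrees with the lift of its reduction, since this holds for the
variables. -/
theorem X_lst_dvd_iff (f : MvPolynomial (Fin (2 * (m + 1))) F) :
    X (lstIdx m) ∣ f ↔ rho F m f = 0 := by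
  constructor
  · rintro ⟨g, rfl⟩
    simp
  · intro h
    have key := dvd_algHom_sub (AlgHom.id F _) (aeval (mkVec (X (fstIdx m))
      (fun i => X (mid i)) 0) : _ →ₐ[F] MvPolynomial (Fin (2 * (m + 1))) F) (X (lstIdx m))
      (fun j => by
        induction j using idx_cases with
        | h0 => simp
        | h1 i => simp
        | h2 => simp) f
    have h2 : aeval (mkVec (X (fstIdx m)) (fun i => X (mid i)) 0) f = rhoSection F m (rho F m f) := by
      clear key h
      induction f using MvPolynomial.induction_on with
      | C a =>
        rw [algHom_C, show rho F m (C a) = Polynomial.C (C a) from algHom_C _ _]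
        simp [rhoSection]
      | add p q hp hq => simp only [map_add, hp, hq]
      | mul_X p j hp =>
        rw [map_mul, map_mul, map_mul, hp, aeval_X]
        congr 1
        induction j using idx_cases with
        | h0 => simp [rhoSection]
        | h1 i => simp [rhoSection]
        | h2 => simp [rhoSection]
    rw [AlgHom.id_apply, h2, h, map_zero, sub_zero] at key
    exact key

end Phi

/-! ### Orbit products of the variables -/

section Norms

variable {F : Type*} [Field F] [Fintype F] {m : ℕ}

theorem orbitProduct_X_isHomogeneous {n : ℕ} (G : Subgroup (GL (Fin n) F)) (i : Fin n) :
    ∃ d, 0 < d ∧ (orbitProduct G (X i)).IsHomogeneous d := by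
  refine ⟨∑ _h ∈ (orbit_finite G (X i)).toFinset, 1, ?_, ?_⟩
  · rw [Finset.sum_const, smul_eq_mul, mul_one, Finset.card_pos]
    exact ⟨X i, (orbit_finite G (X i)).mem_toFinset.mpr ⟨1, G.one_mem, act_one _⟩⟩
  · rw [orbitProduct, finprod_mem_eq_finite_toFinset_prod _ (orbit_finite G (X i))]
    refine IsHomogeneous.prod _ _ _ fun h hh => ?_
    obtain ⟨g, -, rfl⟩ := (orbit_finite G (X i)).mem_toFinset.mp hh
    rw [act_X]
    exact linear_isHomogeneous _

theorem orbitProduct_lst :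
    orbitProduct (sylow (m + 1) F) (X (lstIdx m)) = X (lstIdx m) := by
  have : orbit (sylow (m + 1) F) (X (lstIdx m)) = {X (lstIdx m)} := by
    ext f
    constructor
    · rintro ⟨g, hg, rfl⟩
      exact act_lst hg
    · rintro rfl
      exact ⟨1, one_mem _, act_one _⟩
  rw [orbitProduct, this, finprod_mem_singleton]

/-- Elements of the unipotent radical shift a middle variable by arbitrary multiples of x,
independently of the action of the smaller group. -/
theorem orbit_mid (i : Fin (2 * m)) : orbit (sylow (m + 1) F) (X (mid i)) =
    (fun p : MvPolynomial (Fin (2 * m)) F × F => inc F m p.1 + p.2 • X (lstIdx m)) ''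
      (orbit (sylow m F) (X i) ×ˢ Set.univ) := by
  ext f
  constructor
  · rintro ⟨g, hg, rfl⟩
    obtain ⟨h, hh, hact⟩ := exists_act_mid hg
    refine ⟨(act h (X i), (g : Matrix (Fin (2 * (m + 1))) (Fin (2 * (m + 1))) F) (mid i) (lstIdx m)),
      ⟨⟨h, hh, rfl⟩, Set.mem_univ _⟩, ?_⟩
    rw [hact]
    simp only [smul_eq_C_mul]
  · rintro ⟨⟨_, c⟩, ⟨⟨h, hh, rfl⟩, -⟩, rfl⟩
    refine ⟨radElt (Pi.single i c) * embElt hh, mul_mem (radElt_mem _) (embElt_mem hh), ?_⟩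
    rw [act_mul, act_radElt_mid, map_add, map_mul, algHom_C, act_embElt_lst, ← inc_X,
      act_embElt_inc, Pi.single_eq_same]
    simp only [smul_eq_C_mul]
    rfl

theorem inc_add_smul_injective : Function.Injective
    (fun p : MvPolynomial (Fin (2 * m)) F × F => inc F m p.1 + p.2 • X (lstIdx m)) := by
  rintro ⟨u, c⟩ ⟨v, d⟩ h
  simp only at h
  have h1 := congrArg (rho F m) h
  simp only [map_add, rho_inc, map_smul, rho_lst, smul_zero, add_zero] at h1
  have huv : u = v := Polynomial.C_injective h1
  subst huv
  have h2 := smul_left_injective F (X_ne_zero (lstIdx m)) (add_left_cancel h)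
  rw [h2]

theorem orbitProduct_mid (i : Fin (2 * m)) : orbitProduct (sylow (m + 1) F) (X (mid i)) =
    phi F m (orbitProduct (sylow m F) (X i)) := by
  have hfin := orbit_finite (sylow m F) (X i)
  rw [orbitProduct, orbit_mid, finprod_mem_image inc_add_smul_injective.injOn, orbitProduct,
    finprod_mem_eq_finite_toFinset_prod _ (hfin.prod Set.finite_univ),
    finprod_mem_eq_finite_toFinset_prod _ hfin, map_prod]
  have : (hfin.prod (Set.finite_univ (α := F))).toFinset = hfin.toFinset ×ˢ Finset.univ := by
    ext p
    simp
  rw [this, Finset.prod_product]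
  refine Finset.prod_congr rfl fun f hf => ?_
  obtain ⟨g, -, rfl⟩ := hfin.mem_toFinset.mp hf
  simp only
  rw [prod_add_smul, act_X_eq_linForm, phi_linForm]

/-- The first row of g is isotropic. In odd characteristic its corner entry is therefore determined
by the middle entries. -/
theorem two_mul_row_fst_lst {g : GL (Fin (2 * (m + 1))) F} (hg : g ∈ sylow (m + 1) F) :
    2 * (g : Matrix (Fin (2 * (m + 1))) (Fin (2 * (m + 1))) F) (fstIdx m) (lstIdx m) +
      pairing (fun j => (g : Matrix (Fin (2 * (m + 1))) (Fin (2 * (m + 1))) F) (fstIdx m) (mid j))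
        (fun j => (g : Matrix (Fin (2 * (m + 1))) (Fin (2 * (m + 1))) F) (fstIdx m) (mid j)) = 0 := by
  have h := orthogonal_row hg.1 (fstIdx m) (fstIdx m)
  rw [pairing_idx, rev_fstIdx, if_neg fstIdx_ne_lstIdx, hg.2.2] at h
  rw [← h]
  simp only [Function.comp_def]
  ring

theorem linForm_injective {n : ℕ} : Function.Injective (linForm : (Fin n → F) → _) := by
  intro a b h
  funext j
  rw [← coeff_linForm a j, h, coeff_linForm]

theorem rho_act_radElt_fst (l : Fin (2 * m) → F) : rho F m (act (radElt l) (X (fstIdx m))) =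
    Polynomial.X + Polynomial.C (linForm fun j => -l j.rev) := by
  rw [act_radElt_fst]
  simp

theorem act_radElt_fst_injective :
    Function.Injective fun l : Fin (2 * m) → F => act (radElt l) (X (fstIdx m)) := by
  intro l l' h
  have h1 := congrArg (rho F m) h
  simp only [rho_act_radElt_fst] at h1
  have h2 := linForm_injective (Polynomial.C_injective (add_left_cancel h1))
  funext j
  have := congrFun h2 j.rev
  simpa using this

/-- An image of y_1 is determined by the middle entries of the first row of g, and the unipotent
radical already realises every choice of them. -/
theorem orbit_fst (hF : ringChar F ≠ 2) : orbit (sylow (m + 1) F) (X (fstIdx m)) =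
    Set.range fun l : Fin (2 * m) → F => act (radElt l) (X (fstIdx m)) := by
  ext f
  constructor
  · rintro ⟨g, hg, rfl⟩
    set a : Fin (2 * m) → F := fun j =>
      (g : Matrix (Fin (2 * (m + 1))) (Fin (2 * (m + 1))) F) (fstIdx m) (mid j) with ha
    refine ⟨fun j => -a j.rev, ?_⟩
    have h1 := two_mul_row_fst_lst hg
    have h2 := two_mul_row_fst_lst (radElt_mem fun j => -a j.rev)
    have hrow : ∀ j, (radElt (fun j => -a j.rev) :
        Matrix (Fin (2 * (m + 1))) (Fin (2 * (m + 1))) F) (fstIdx m) (mid j) = a j := by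
      intro j
      rw [radElt, coe_blockElt, blockMatrix, Matrix.of_apply, mkVec_fst, mkVec_mid, Fin.rev_rev,
        neg_neg]
    simp only [hrow] at h2
    have h3 : (2 : F) * _ = 2 * _ := add_right_cancel (h2.trans h1.symm)
    have h4 := mul_left_cancel₀ (two_ne_zero_of_ringChar hF) h3
    simp only
    rw [act_fst hg, act_fst (radElt_mem _), h4]
    simp only [hrow]
    rfl
  · rintro ⟨l, rfl⟩
    exact ⟨radElt l, radElt_mem l, rfl⟩

theorem rho_orbitProduct_fst (hF : ringChar F ≠ 2) :
    rho F m (orbitProduct (sylow (m + 1) F) (X (fstIdx m))) =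
      ∏ l : Fin (2 * m) → F, (Polynomial.X + Polynomial.C (linForm fun j => -l j.rev)) := by
  rw [orbitProduct, orbit_fst hF, finprod_mem_range act_radElt_fst_injective,
    finprod_eq_prod_of_fintype, map_prod]
  simp only [rho_act_radElt_fst]

theorem rho_orbitProduct_fst_monic (hF : ringChar F ≠ 2) :
    (rho F m (orbitProduct (sylow (m + 1) F) (X (fstIdx m)))).Monic := by
  rw [rho_orbitProduct_fst hF]
  exact Polynomial.monic_prod_of_monic _ _ fun l _ => Polynomial.monic_X_add_C _

theorem rho_orbitProduct_fst_natDegree (hF : ringChar F ≠ 2) :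
    (rho F m (orbitProduct (sylow (m + 1) F) (X (fstIdx m)))).natDegree =
      Fintype.card F ^ (2 * m) := by
  rw [rho_orbitProduct_fst hF, Polynomial.natDegree_prod_of_monic _ _
    fun l _ => Polynomial.monic_X_add_C _]
  simp

end Norms

/-! ### Translation invariant polynomials in one variable -/

section OneVariable

variable {F : Type*} [Field F] [Fintype F] {B : Type*} [CommRing B] [IsDomain B] [Algebra F B]

/-- The polynomial `T ^ q - x ^ (q - 1) T`. -/
noncomputable def twistPoly (F : Type*) [Field F] [Fintype F] {B : Type*} [CommRing B]
    [Algebra F B] (x : B) : Polynomial B := twist F (Polynomial.C x) Polynomial.X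

theorem twistPoly_eq (x : B) : twistPoly F x = Polynomial.X ^ Fintype.card F -
    Polynomial.C (x ^ (Fintype.card F - 1)) * Polynomial.X := by
  rw [twistPoly, twist_apply, map_pow]

theorem twistPoly_degree_lt (x : B) :
    (Polynomial.C (x ^ (Fintype.card F - 1)) * Polynomial.X).degree <
      (Polynomial.X ^ Fintype.card F : Polynomial B).degree := by
  rw [Polynomial.degree_X_pow]
  refine (Polynomial.degree_C_mul_X_le _).trans_lt ?_
  exact_mod_cast Fintype.one_lt_card

theorem twistPoly_monic (x : B) : (twistPoly F x).Monic := by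
  rw [twistPoly_eq]
  exact (Polynomial.monic_X_pow _).sub_of_left (twistPoly_degree_lt x)

theorem twistPoly_natDegree (x : B) : (twistPoly F x).natDegree = Fintype.card F := by
  rw [twistPoly_eq]
  apply Polynomial.natDegree_eq_of_degree_eq_some
  rw [Polynomial.degree_sub_eq_left_of_degree_lt (twistPoly_degree_lt x), Polynomial.degree_X_pow]

theorem twistPoly_comp (x : B) (c : F) :
    (twistPoly F x).comp (Polynomial.X + Polynomial.C (c • x)) = twistPoly F x := by
  have h := map_twist (F := F) ((Polynomial.aeval (R := B)
    (Polynomial.X + Polynomial.C (c • x))).restrictScalars F) (Polynomial.C x) Polynomial.X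
  rw [AlgHom.restrictScalars_apply, AlgHom.restrictScalars_apply, AlgHom.restrictScalars_apply,
    Polynomial.aeval_X, Polynomial.aeval_C, Polynomial.algebraMap_eq] at h
  rw [← Polynomial.smul_C, twist_add_smul, Polynomial.aeval_def, Polynomial.algebraMap_eq] at h
  rwa [← Polynomial.smul_C]

theorem twistPoly_dvd {x : B} (hx : x ≠ 0) {f : Polynomial B}
    (hf : ∀ c : F, f.eval (c • x) = 0) : twistPoly F x ∣ f := by
  classical
  rcases eq_or_ne f 0 with rfl | h0
  · exact dvd_zero _
  have h1 : twistPoly F x = (((Finset.univ : Finset F).val.map fun c : F => c • x).map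
      (fun a => Polynomial.X - Polynomial.C a)).prod := by
    rw [Multiset.map_map, twistPoly, ← prod_add_smul, ← Equiv.prod_comp (Equiv.neg F)]
    refine Finset.prod_congr rfl fun c _ => ?_
    simp [Polynomial.smul_C, sub_eq_add_neg]
  rw [h1, Multiset.prod_X_sub_C_dvd_iff_le_roots h0, Multiset.le_iff_subset]
  · intro a ha
    obtain ⟨c, -, rfl⟩ := Multiset.mem_map.mp ha
    exact (Polynomial.mem_roots h0).mpr (hf c)
  · exact Multiset.Nodup.map (smul_left_injective F hx) Finset.univ.nodup

/-- Induction on the degree: f − f(0) vanishes at every cx, so it is divisible by T^q − x^{q−1}T,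
and the quotient is again translation invariant. -/
theorem exists_comp_twistPoly {x : B} (hx : x ≠ 0) (f : Polynomial B)
    (hf : ∀ c : F, f.comp (Polynomial.X + Polynomial.C (c • x)) = f) :
    ∃ g : Polynomial B, f = g.comp (twistPoly F x) := by
  induction hd : f.natDegree using Nat.strong_induction_on generalizing f with
  | _ d ih =>
  subst hd
  obtain ⟨u, hu⟩ : twistPoly F x ∣ f - Polynomial.C (f.eval 0) := by
    refine twistPoly_dvd hx fun c => ?_
    have := congrArg (Polynomial.eval 0) (hf c)
    rw [Polynomial.eval_comp] at this
    simp only [Polynomial.eval_add, Polynomial.eval_X, Polynomial.eval_C, zero_add] at this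
    simp [this]
  have hm := twistPoly_monic (F := F) x
  rcases eq_or_ne u 0 with rfl | hu0
  · rw [mul_zero, sub_eq_zero] at hu
    exact ⟨Polynomial.C (f.eval 0), by rw [Polynomial.C_comp]; exact hu⟩
  have hdeg : u.natDegree < f.natDegree := by
    have h1 := congrArg Polynomial.natDegree hu
    rw [Polynomial.natDegree_sub_C, hm.natDegree_mul' hu0, twistPoly_natDegree] at h1
    have := Fintype.card_pos (α := F)
    omega
  obtain ⟨v, hv⟩ := ih u.natDegree hdeg u (fun c => by
    have h1 := congrArg (fun p => p.comp (Polynomial.X + Polynomial.C (c • x))) hu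
    simp only [Polynomial.sub_comp, Polynomial.mul_comp, hf, Polynomial.C_comp, twistPoly_comp] at h1
    rw [hu] at h1
    exact (mul_left_cancel₀ hm.ne_zero h1).symm) rfl
  refine ⟨Polynomial.X * v + Polynomial.C (f.eval 0), ?_⟩
  rw [Polynomial.add_comp, Polynomial.mul_comp, Polynomial.X_comp, ← hv, Polynomial.C_comp, ← hu,
    sub_add_cancel]

theorem eq_zero_of_comp_twistPoly {x : B} {g : Polynomial B} (h : g.comp (twistPoly F x) = 0) :
    g = 0 := by
  rcases Polynomial.comp_eq_zero_iff.mp h with h | ⟨-, h⟩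
  · exact h
  · have := congrArg Polynomial.natDegree h
    rw [twistPoly_natDegree, Polynomial.natDegree_C] at this
    exact absurd this Fintype.card_ne_zero

end OneVariable

/-! ### Expansion of a polynomial in powers of one variable -/

section Expansion

variable {F : Type*} [Field F] {σ : Type*} [DecidableEq σ]

/-- The expansion of a polynomial in powers of `X_i`. -/
noncomputable def expandAt (F : Type*) [Field F] (i : σ) :
    MvPolynomial σ F →ₐ[F] Polynomial (MvPolynomial σ F) :=
  aeval (Function.update (fun k => Polynomial.C (X k)) i Polynomial.X)

theorem expandAt_X_self (i : σ) : expandAt F i (X i) = Polynomial.X := by simp [expandAt]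

theorem expandAt_X_of_ne {i k : σ} (h : k ≠ i) :
    expandAt F i (X k) = Polynomial.C (X k) := by simp [expandAt, h]

theorem eval_expandAt (i : σ) (f : MvPolynomial σ F) : (expandAt F i f).eval (X i) = f := by
  have : ((Polynomial.aeval (R := MvPolynomial σ F) (X i)).restrictScalars F).comp (expandAt F i) =
      AlgHom.id F (MvPolynomial σ F) := by
    ext1 k
    rw [AlgHom.comp_apply, AlgHom.restrictScalars_apply]
    rcases eq_or_ne k i with rfl | h
    · simp [expandAt_X_self]
    · simp [expandAt_X_of_ne h]
  have h2 := DFunLike.congr_fun this f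
  rwa [AlgHom.comp_apply, AlgHom.restrictScalars_apply, Polynomial.coe_aeval_eq_eval] at h2

theorem expandAt_injective (i : σ) : Function.Injective (expandAt F i) := fun f g h => by
  rw [← eval_expandAt i f, h, eval_expandAt]

theorem expandAt_comp {i : σ} (φ : MvPolynomial σ F →ₐ[F] MvPolynomial σ F)
    (p : Polynomial (MvPolynomial σ F)) (hi : expandAt F i (φ (X i)) = p)
    (hk : ∀ k, k ≠ i → φ (X k) = X k) (f : MvPolynomial σ F) :
    expandAt F i (φ f) = (expandAt F i f).comp p := by
  have : (expandAt F i).comp φ =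
      ((Polynomial.aeval (R := MvPolynomial σ F) p).restrictScalars F).comp (expandAt F i) := by
    ext1 k
    rw [AlgHom.comp_apply, AlgHom.comp_apply, AlgHom.restrictScalars_apply]
    rcases eq_or_ne k i with rfl | h
    · rw [hi, expandAt_X_self, Polynomial.aeval_X]
    · rw [hk k h, expandAt_X_of_ne h, Polynomial.aeval_C, Polynomial.algebraMap_eq]
  have h2 := DFunLike.congr_fun this f
  rwa [AlgHom.comp_apply, AlgHom.comp_apply, AlgHom.restrictScalars_apply,
    Polynomial.aeval_def, Polynomial.algebraMap_eq] at h2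

end Expansion

/-! ### Invariants of groups of translations -/

section Translations

variable {F : Type*} [Field F] [Fintype F] {σ : Type*} [DecidableEq σ]

/-- The substitution `X_i ↦ X_i + c X_j`. -/
noncomputable def translation (j i : σ) (c : F) : MvPolynomial σ F →ₐ[F] MvPolynomial σ F :=
  aeval (Function.update X i (X i + c • X j))

/-- The substitution `X_k ↦ X_k ^ q - X_j ^ (q - 1) X_k` for `k ∈ s`. -/
noncomputable def twistVars (F : Type*) [Field F] [Fintype F] (j : σ) (s : Finset σ) :
    MvPolynomial σ F →ₐ[F] MvPolynomial σ F :=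
  aeval fun k => if k ∈ s then twist F (X j) (X k) else X k

theorem twistVars_X_of_mem {j k : σ} {s : Finset σ} (h : k ∈ s) :
    twistVars F j s (X k) = twist F (X j) (X k) := by simp [twistVars, h]

theorem twistVars_X_of_notMem {j k : σ} {s : Finset σ} (h : k ∉ s) :
    twistVars F j s (X k) = X k := by simp [twistVars, h]

theorem translation_X_self (j i : σ) (c : F) : translation j i c (X i) = X i + c • X j := by
  simp [translation]

theorem translation_X_of_ne {j i k : σ} (c : F) (h : k ≠ i) : translation j i c (X k) = X k := by
  simp [translation, h]

theorem expandAt_twistVars {i j : σ} (hij : j ≠ i) (f : MvPolynomial σ F) :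
    expandAt F i (twistVars F j {i} f) = (expandAt F i f).comp (twistPoly F (X j)) := by
  refine expandAt_comp _ _ ?_ (fun k hk => twistVars_X_of_notMem (by simpa using hk)) f
  rw [twistVars_X_of_mem (Finset.mem_singleton_self i), map_twist, expandAt_X_self,
    expandAt_X_of_ne hij, twistPoly]

theorem expandAt_translation {i j : σ} (hij : j ≠ i) (c : F) (f : MvPolynomial σ F) :
    expandAt F i (translation j i c f) =
      (expandAt F i f).comp (Polynomial.X + Polynomial.C (c • X j)) := by
  refine expandAt_comp _ _ ?_ (fun k hk => translation_X_of_ne c hk) f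
  rw [translation_X_self, map_add, map_smul, expandAt_X_self, expandAt_X_of_ne hij,
    Polynomial.smul_C]

theorem twistVars_singleton_injective {i j : σ} (hij : j ≠ i) :
    Function.Injective (twistVars F j {i}) := by
  rw [injective_iff_map_eq_zero]
  intro f hf
  have h := expandAt_twistVars hij f
  rw [hf, map_zero] at h
  apply expandAt_injective i
  rw [map_zero]
  exact eq_zero_of_comp_twistPoly h.symm

theorem exists_twistVars_singleton {i j : σ} (hij : j ≠ i) (f : MvPolynomial σ F)
    (hf : ∀ c : F, translation j i c f = f) : ∃ g, twistVars F j {i} g = f := by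
  obtain ⟨H, hH⟩ := exists_comp_twistPoly (F := F) (X_ne_zero j) (expandAt F i f)
    (fun c => by rw [← expandAt_translation hij, hf])
  -- The coefficients of H might involve X_i. Setting X_i = 0 in them removes it, and does not
  -- affect the expansion of f, whose coefficients are already free of X_i.
  set ε : MvPolynomial σ F →ₐ[F] MvPolynomial σ F := aeval (Function.update X i 0) with hε
  have hεk : ∀ k, k ≠ i → ε (X k) = X k := fun k hk => by simp [hε, hk]
  have hmap : (expandAt F i f).map (ε : MvPolynomial σ F →+* MvPolynomial σ F) =
      expandAt F i f := by
    have : (Polynomial.mapAlgHom ε).comp (expandAt F i) = expandAt F i := by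
      ext1 k
      rw [AlgHom.comp_apply]
      rcases eq_or_ne k i with rfl | h
      · simp [expandAt_X_self]
      · simp [expandAt_X_of_ne h, hεk k h]
    exact DFunLike.congr_fun this f
  have htw : (twistPoly F (X j : MvPolynomial σ F)).map
      (ε : MvPolynomial σ F →+* MvPolynomial σ F) = twistPoly F (X j) := by
    rw [twistPoly_eq]
    simp [hεk j hij]
  have hcomp : (twistVars F j {i}).comp ε = ε := by
    ext1 k
    rw [AlgHom.comp_apply]
    rcases eq_or_ne k i with rfl | h
    · simp [hε]
    · rw [hεk k h, twistVars_X_of_notMem (by simpa using h)]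
  refine ⟨(H.map (ε : MvPolynomial σ F →+* MvPolynomial σ F)).eval (X i), ?_⟩
  have h1 : twistVars F j {i} ((H.map (ε : MvPolynomial σ F →+* MvPolynomial σ F)).eval (X i)) =
      ((H.map (ε : MvPolynomial σ F →+* MvPolynomial σ F)).map
        (twistVars F j {i} : MvPolynomial σ F →+* MvPolynomial σ F)).eval
          (twistVars F j {i} (X i)) := by
    exact (Polynomial.eval_map_apply (twistVars F j {i} : MvPolynomial σ F →+* MvPolynomial σ F)
      (X i)).symm
  have h2 : (H.map (ε : MvPolynomial σ F →+* MvPolynomial σ F)).map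
        (twistVars F j {i} : MvPolynomial σ F →+* MvPolynomial σ F) =
      H.map (ε : MvPolynomial σ F →+* MvPolynomial σ F) := by
    rw [Polynomial.map_map]
    congr 1
    exact congrArg (fun φ : MvPolynomial σ F →ₐ[F] MvPolynomial σ F =>
      (φ : MvPolynomial σ F →+* MvPolynomial σ F)) hcomp
  have h3 : twistVars F j {i} (X i) = (twistPoly F (X j)).eval (X i) := by
    rw [twistVars_X_of_mem (Finset.mem_singleton_self i), twistPoly_eq, twist_apply]
    simp
  rw [h1, h2, h3, ← Polynomial.eval_comp]
  conv_lhs => rw [← htw, ← Polynomial.map_comp, ← hH, hmap, eval_expandAt]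

theorem twistVars_insert {i j : σ} {s : Finset σ} (hi : i ∉ s) (hj : j ∉ insert i s)
    (f : MvPolynomial σ F) :
    twistVars F j s (twistVars F j {i} f) = twistVars F j (insert i s) f := by
  rw [Finset.mem_insert, not_or] at hj
  rw [← AlgHom.comp_apply]
  congr 1
  ext1 k
  rw [AlgHom.comp_apply]
  rcases eq_or_ne k i with rfl | h
  · rw [twistVars_X_of_mem (Finset.mem_singleton_self k), map_twist, twistVars_X_of_notMem hi,
      twistVars_X_of_notMem hj.2, twistVars_X_of_mem (Finset.mem_insert_self k s)]
  · rw [twistVars_X_of_notMem (show k ∉ ({i} : Finset σ) by simpa using h)]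
    by_cases hks : k ∈ s
    · rw [twistVars_X_of_mem hks, twistVars_X_of_mem (Finset.mem_insert_of_mem hks)]
    · rw [twistVars_X_of_notMem hks, twistVars_X_of_notMem (by simp [h, hks])]

theorem twistVars_injective {j : σ} {s : Finset σ} (hj : j ∉ s) :
    Function.Injective (twistVars F j s) := by
  induction s using Finset.induction_on with
  | empty =>
    have : twistVars F j ∅ = AlgHom.id F (MvPolynomial σ F) := by
      ext1 k
      rw [twistVars_X_of_notMem (Finset.notMem_empty k), AlgHom.id_apply]
    rw [this]
    exact Function.injective_id
  | insert i s hi ih =>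
    have hj' := hj
    rw [Finset.mem_insert, not_or] at hj'
    intro f g h
    rw [← twistVars_insert hi hj, ← twistVars_insert hi hj] at h
    exact twistVars_singleton_injective hj'.1 (ih hj'.2 h)

theorem translation_twistVars {i j : σ} {s : Finset σ} (hi : i ∉ s) (hij : j ≠ i) (hj : j ∉ s)
    (c : F) (f : MvPolynomial σ F) :
    translation j i c (twistVars F j s f) = twistVars F j s (translation j i c f) := by
  have : (translation j i c).comp (twistVars F j s) =
      (twistVars F j s).comp (translation j i c) := by
    ext1 k
    rw [AlgHom.comp_apply, AlgHom.comp_apply]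
    rcases eq_or_ne k i with rfl | h
    · rw [twistVars_X_of_notMem hi, translation_X_self, map_add, map_smul,
        twistVars_X_of_notMem hi, twistVars_X_of_notMem hj]
    · rw [translation_X_of_ne c h]
      by_cases hks : k ∈ s
      · rw [twistVars_X_of_mem hks, map_twist, translation_X_of_ne c h,
          translation_X_of_ne c hij]
      · rw [twistVars_X_of_notMem hks, translation_X_of_ne c h]
  exact DFunLike.congr_fun this f

/-- Polynomials invariant under all translations `X_i ↦ X_i + c X_j`, `i ∈ s`, are polynomials in
the `X_i ^ q - X_j ^ (q - 1) X_i` and the other variables. -/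
theorem exists_twistVars {j : σ} {s : Finset σ} (hj : j ∉ s) (f : MvPolynomial σ F)
    (hf : ∀ i ∈ s, ∀ c : F, translation j i c f = f) : ∃ g, twistVars F j s g = f := by
  induction s using Finset.induction_on with
  | empty =>
    refine ⟨f, ?_⟩
    have : twistVars F j ∅ = AlgHom.id F (MvPolynomial σ F) := by
      ext1 k
      rw [twistVars_X_of_notMem (Finset.notMem_empty k), AlgHom.id_apply]
    rw [this, AlgHom.id_apply]
  | insert i s hi ih =>
    have hj' := hj
    rw [Finset.mem_insert, not_or] at hj'
    obtain ⟨g, rfl⟩ := ih hj'.2 fun k hk => hf k (Finset.mem_insert_of_mem hk)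
    obtain ⟨u, rfl⟩ := exists_twistVars_singleton hj'.1 g fun c => by
      apply twistVars_injective (F := F) hj'.2
      rw [← translation_twistVars hi hj'.1 hj'.2]
      exact hf i (Finset.mem_insert_self i s) c
    exact ⟨u, (twistVars_insert hi hj u).symm⟩

end Translations

/-! ### Invariants after inverting x_1 -/

section LocalInvariants

variable {F : Type*} [Field F] [Fintype F] {m : ℕ}

/-- The substitution of `ξ_0` for `y_1`. -/
noncomputable def xiSubst (F : Type*) [Field F] [Fintype F] (m : ℕ) :
    MvPolynomial (Fin (2 * (m + 1))) F →ₐ[F] MvPolynomial (Fin (2 * (m + 1))) F :=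
  aeval (mkVec (xi (m + 1) F 0) (fun i => X (mid i)) (X (lstIdx m)))

@[simp] theorem xiSubst_fst : xiSubst F m (X (fstIdx m)) = xi (m + 1) F 0 := by simp [xiSubst]

@[simp] theorem xiSubst_lst : xiSubst F m (X (lstIdx m)) = X (lstIdx m) := by simp [xiSubst]

@[simp] theorem xiSubst_mid (i : Fin (2 * m)) : xiSubst F m (X (mid i)) = X (mid i) := by
  simp [xiSubst]

theorem xiSubst_inc (f : MvPolynomial (Fin (2 * m)) F) :
    xiSubst F m (inc F m f) = inc F m f := by
  rw [← AlgHom.comp_apply]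
  congr 1
  ext1 i
  simp

theorem xiSubst_phi (f : MvPolynomial (Fin (2 * m)) F) :
    xiSubst F m (phi F m f) = phi F m f := by
  rw [← AlgHom.comp_apply]
  congr 1
  ext1 i
  simp [map_twist]

/-- In the fraction field, y_1 ↦ (y_1 − ξ_0')/x undoes the substitution, where ξ_0' is the form in
the middle variables. -/
theorem xiSubst_injective : Function.Injective (xiSubst F m) := by
  set K := FractionRing (MvPolynomial (Fin (2 * (m + 1))) F)
  set ι : MvPolynomial (Fin (2 * (m + 1))) F →ₐ[F] K :=
    IsScalarTower.toAlgHom F (MvPolynomial (Fin (2 * (m + 1))) F) K with hι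
  have hinj : Function.Injective ι :=
    FaithfulSMul.algebraMap_injective (MvPolynomial (Fin (2 * (m + 1))) F) K
  have hx : ι (X (lstIdx m)) ≠ 0 := fun h => X_ne_zero (lstIdx m) (hinj (by rw [h, map_zero]))
  set α : MvPolynomial (Fin (2 * (m + 1))) F →ₐ[F] K :=
    aeval (mkVec ((ι (X (fstIdx m)) - ι (inc F m (xi m F 0))) / ι (X (lstIdx m)))
      (fun i => ι (X (mid i))) (ι (X (lstIdx m)))) with hα
  have hα1 : ∀ f, α (inc F m f) = ι (inc F m f) := by
    intro f
    rw [← AlgHom.comp_apply, ← AlgHom.comp_apply]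
    congr 1
    ext1 i
    simp [hα]
  have hcomp : α.comp (xiSubst F m) = ι := by
    ext1 j
    rw [AlgHom.comp_apply]
    induction j using idx_cases with
    | h0 =>
      rw [xiSubst_fst, xi_succ_zero, map_add, map_mul, hα1]
      simp only [hα, aeval_X, mkVec_fst, mkVec_lst]
      rw [div_mul_cancel₀ _ hx, sub_add_cancel]
    | h1 i => simp [hα]
    | h2 => simp [hα]
  intro f g h
  apply hinj
  rw [← hcomp, AlgHom.comp_apply, AlgHom.comp_apply, h]

theorem exists_pow_mul_eq_xiSubst (f : MvPolynomial (Fin (2 * (m + 1))) F) :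
    ∃ k g, X (lstIdx m) ^ k * f = xiSubst F m g := by
  induction f using MvPolynomial.induction_on with
  | C a => exact ⟨0, C a, by rw [algHom_C]; simp [algebraMap_eq]⟩
  | add p q hp hq =>
    obtain ⟨k, g, hg⟩ := hp
    obtain ⟨l, h, hh⟩ := hq
    refine ⟨k + l, X (lstIdx m) ^ l * g + X (lstIdx m) ^ k * h, ?_⟩
    rw [map_add, map_mul, map_mul, map_pow, map_pow, xiSubst_lst, ← hg, ← hh]
    ring
  | mul_X p j hp =>
    obtain ⟨k, g, hg⟩ := hp
    induction j using idx_cases with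
    | h0 =>
      refine ⟨k + 1, g * (X (fstIdx m) - inc F m (xi m F 0)), ?_⟩
      rw [map_mul, map_sub, xiSubst_fst, xiSubst_inc, xi_succ_zero, ← hg]
      ring
    | h1 i => exact ⟨k, g * X (mid i), by rw [map_mul, xiSubst_mid, ← hg, mul_assoc]⟩
    | h2 => exact ⟨k, g * X (lstIdx m), by rw [map_mul, xiSubst_lst, ← hg, mul_assoc]⟩

/-- With ξ_0 as coordinate instead of y_1, the unipotent radical acts by pure translations of the
middle variables. -/
theorem act_radElt_single_xiSubst (i : Fin (2 * m)) (c : F)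
    (f : MvPolynomial (Fin (2 * (m + 1))) F) :
    act (radElt (Pi.single i c)) (xiSubst F m f) =
      xiSubst F m (translation (lstIdx m) (mid i) c f) := by
  rw [← AlgHom.comp_apply, ← AlgHom.comp_apply]
  congr 1
  ext1 j
  rw [AlgHom.comp_apply, AlgHom.comp_apply]
  induction j using idx_cases with
  | h0 =>
    rw [translation_X_of_ne c (mid_ne_fstIdx i).symm, xiSubst_fst, xi_mem _ _ (radElt_mem _)]
  | h1 j =>
    rw [xiSubst_mid, act_radElt_mid]
    rcases eq_or_ne j i with rfl | h
    · rw [translation_X_self, Pi.single_eq_same, map_add, map_smul, xiSubst_mid, xiSubst_lst,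
        smul_eq_C_mul]
    · rw [translation_X_of_ne c (mid_injective.ne h), Pi.single_eq_of_ne h, xiSubst_mid]
      simp
  | h2 =>
    rw [translation_X_of_ne c (mid_ne_lstIdx i).symm, xiSubst_lst, act_radElt_lst]

/-- The positions of the variables other than `y_1, x_1`. -/
def midSet (m : ℕ) : Finset (Fin (2 * (m + 1))) := Finset.univ.image mid

theorem mid_mem_midSet (i : Fin (2 * m)) : mid i ∈ midSet m :=
  Finset.mem_image_of_mem _ (Finset.mem_univ i)

theorem lstIdx_notMem_midSet : lstIdx m ∉ midSet m := by
  simp [midSet, mid_ne_lstIdx]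

theorem fstIdx_notMem_midSet : fstIdx m ∉ midSet m := by
  simp [midSet, mid_ne_fstIdx]

theorem twistVars_inc (f : MvPolynomial (Fin (2 * m)) F) :
    twistVars F (lstIdx m) (midSet m) (inc F m f) = phi F m f := by
  rw [← AlgHom.comp_apply]
  congr 1
  ext1 i
  rw [AlgHom.comp_apply, inc_X, twistVars_X_of_mem (mid_mem_midSet i), phi_X]

theorem act_embElt_xiSubst {h : GL (Fin (2 * m)) F} (hh : h ∈ sylow m F)
    (f : MvPolynomial (Fin (2 * (m + 1))) F) :
    act (embElt hh) (xiSubst F m f) = xiSubst F m (act (embElt hh) f) := by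
  rw [← AlgHom.comp_apply, ← AlgHom.comp_apply]
  congr 1
  ext1 j
  rw [AlgHom.comp_apply, AlgHom.comp_apply]
  induction j using idx_cases with
  | h0 => rw [xiSubst_fst, act_embElt_fst, xiSubst_fst, xi_mem _ _ (embElt_mem hh)]
  | h1 i => rw [xiSubst_mid, ← inc_X, act_embElt_inc, xiSubst_inc]
  | h2 => rw [xiSubst_lst, act_embElt_lst, xiSubst_lst]

theorem act_embElt_twistVars {h : GL (Fin (2 * m)) F} (hh : h ∈ sylow m F)
    (f : MvPolynomial (Fin (2 * (m + 1))) F) :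
    act (embElt hh) (twistVars F (lstIdx m) (midSet m) f) =
      twistVars F (lstIdx m) (midSet m) (act (embElt hh) f) := by
  rw [← AlgHom.comp_apply, ← AlgHom.comp_apply]
  refine DFunLike.congr_fun (?_ : AlgHom.comp _ _ = AlgHom.comp _ _) f
  ext1 j
  rw [AlgHom.comp_apply, AlgHom.comp_apply]
  induction j using idx_cases with
  | h0 => rw [act_embElt_fst, twistVars_X_of_notMem fstIdx_notMem_midSet, act_embElt_fst]
  | h1 i =>
    rw [twistVars_X_of_mem (mid_mem_midSet i), ← phi_X, act_embElt_phi, ← inc_X, act_embElt_inc,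
      twistVars_inc]
  | h2 => rw [act_embElt_lst, twistVars_X_of_notMem lstIdx_notMem_midSet, act_embElt_lst]

/-- Expansion in powers of `y_1` and `x_1`. -/
noncomputable def expandOuter (F : Type*) [Field F] (m : ℕ) :
    MvPolynomial (Fin (2 * (m + 1))) F →ₐ[F]
      Polynomial (Polynomial (MvPolynomial (Fin (2 * m)) F)) :=
  aeval (mkVec Polynomial.X (fun i => Polynomial.C (Polynomial.C (X i)))
    (Polynomial.C Polynomial.X))

theorem expandOuter_inc (f : MvPolynomial (Fin (2 * m)) F) :
    expandOuter F m (inc F m f) = Polynomial.C (Polynomial.C f) := by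
  have : (expandOuter F m).comp (inc F m) =
      IsScalarTower.toAlgHom F (MvPolynomial (Fin (2 * m)) F) _ := by
    ext1 i
    simp [expandOuter, Polynomial.algebraMap_apply]
  exact DFunLike.congr_fun this f

theorem expandOuter_act {h : GL (Fin (2 * m)) F} (hh : h ∈ sylow m F)
    (f : MvPolynomial (Fin (2 * (m + 1))) F) :
    expandOuter F m (act (embElt hh) f) =
      Polynomial.mapAlgHom (Polynomial.mapAlgHom (act h)) (expandOuter F m f) := by
  rw [← AlgHom.comp_apply, ← AlgHom.comp_apply]
  congr 1
  ext1 j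
  rw [AlgHom.comp_apply, AlgHom.comp_apply]
  induction j using idx_cases with
  | h0 =>
    rw [act_embElt_fst]
    simp [expandOuter]
  | h1 i =>
    rw [← inc_X, act_embElt_inc, expandOuter_inc, expandOuter_inc]
    simp
  | h2 =>
    rw [act_embElt_lst]
    simp [expandOuter]

/-- Evaluation of a polynomial in two variables at `y_1`, `x_1`. -/
noncomputable def evalOuter (F : Type*) [Field F] (m : ℕ) :
    Polynomial (Polynomial (MvPolynomial (Fin (2 * m)) F)) →+*
      MvPolynomial (Fin (2 * (m + 1))) F :=
  Polynomial.eval₂RingHom (Polynomial.eval₂RingHom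
    (inc F m : MvPolynomial (Fin (2 * m)) F →+* _) (X (lstIdx m))) (X (fstIdx m))

theorem evalOuter_expandOuter (f : MvPolynomial (Fin (2 * (m + 1))) F) :
    evalOuter F m (expandOuter F m f) = f := by
  induction f using MvPolynomial.induction_on with
  | C a =>
    rw [show expandOuter F m (C a) = Polynomial.C (Polynomial.C (C a)) from algHom_C _ _]
    simp [evalOuter]
  | add p q hp hq => rw [map_add, map_add, hp, hq]
  | mul_X p j hp =>
    rw [map_mul, map_mul, hp]
    refine congrArg₂ (· * ·) rfl ?_
    induction j using idx_cases with
    | h0 => simp [evalOuter, expandOuter]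
    | h1 i => simp [evalOuter, expandOuter]
    | h2 => simp [evalOuter, expandOuter]

/-- The embedded group fixes y_1 and x_1, so it acts coefficientwise on the expansion in these two
variables. -/
theorem mem_adjoin_of_act_embElt {f : MvPolynomial (Fin (2 * (m + 1))) F}
    (hf : ∀ h, ∀ hh : h ∈ sylow m F, act (embElt hh) f = f) :
    f ∈ Algebra.adjoin F ({X (fstIdx m), X (lstIdx m)} ∪
      inc F m '' (invariants (sylow m F) : Set (MvPolynomial (Fin (2 * m)) F))) := by
  have hc : ∀ a b, ((expandOuter F m f).coeff a).coeff b ∈ invariants (sylow m F) := by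
    intro a b h hh
    have h1 := expandOuter_act hh f
    rw [hf] at h1
    conv_rhs => rw [h1]
    simp [Polynomial.coeff_map]
  rw [← evalOuter_expandOuter f, evalOuter, Polynomial.coe_eval₂RingHom,
    Polynomial.eval₂_eq_sum_range]
  refine Subalgebra.sum_mem _ fun a _ => Subalgebra.mul_mem _ ?_ (Subalgebra.pow_mem _
    (Algebra.subset_adjoin (by simp)) _)
  rw [Polynomial.coe_eval₂RingHom, Polynomial.eval₂_eq_sum_range]
  refine Subalgebra.sum_mem _ fun b _ => Subalgebra.mul_mem _ ?_ (Subalgebra.pow_mem _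
    (Algebra.subset_adjoin (by simp)) _)
  exact Algebra.subset_adjoin (Or.inr ⟨_, hc a b, rfl⟩)

/-- After multiplication with a power of `x_1`, every invariant becomes a polynomial in `x_1`,
`ξ_0` and the images of the invariants of the smaller group. -/
theorem exists_pow_mul_mem_adjoin {f : MvPolynomial (Fin (2 * (m + 1))) F}
    (hf : f ∈ invariants (sylow (m + 1) F)) :
    ∃ k, X (lstIdx m) ^ k * f ∈ Algebra.adjoin F ({xi (m + 1) F 0, X (lstIdx m)} ∪
      phi F m '' (invariants (sylow m F) : Set (MvPolynomial (Fin (2 * m)) F))) := by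
  obtain ⟨k, g, hg⟩ := exists_pow_mul_eq_xiSubst f
  refine ⟨k, ?_⟩
  have hinv : ∀ u ∈ sylow (m + 1) F, act u (xiSubst F m g) = xiSubst F m g := by
    intro u hu
    rw [← hg, map_mul, map_pow, act_lst hu, hf u hu]
  -- Invariance under the radical puts g in the image of the twist. Invariance under the embedded
  -- smaller group then descends to G, because both substitutions are injective and equivariant.
  obtain ⟨G, rfl⟩ := exists_twistVars lstIdx_notMem_midSet g fun j hj c => by
    obtain ⟨i, -, rfl⟩ := Finset.mem_image.mp hj
    apply xiSubst_injective
    rw [← act_radElt_single_xiSubst, hinv _ (radElt_mem _)]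
  have hG : ∀ h, ∀ hh : h ∈ sylow m F, act (embElt hh) G = G := by
    intro h hh
    apply twistVars_injective (F := F) lstIdx_notMem_midSet
    apply xiSubst_injective
    rw [← act_embElt_twistVars, ← act_embElt_xiSubst, hinv _ (embElt_mem hh)]
  have h1 := mem_adjoin_of_act_embElt hG
  rw [hg]
  have h2 := Subalgebra.mem_map.mpr
    ⟨G, h1, (rfl : ((xiSubst F m).comp (twistVars F (lstIdx m) (midSet m))) G = _)⟩
  rw [AlgHom.map_adjoin, AlgHom.comp_apply] at h2
  refine Algebra.adjoin_mono ?_ h2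
  rintro _ ⟨u, (rfl | rfl) | ⟨v, hv, rfl⟩, rfl⟩
  · left; left
    rw [AlgHom.comp_apply, twistVars_X_of_notMem fstIdx_notMem_midSet, xiSubst_fst]
  · left; right
    rw [AlgHom.comp_apply, twistVars_X_of_notMem lstIdx_notMem_midSet, xiSubst_lst]
    rfl
  · right
    exact ⟨v, hv, by rw [AlgHom.comp_apply, twistVars_inc, xiSubst_phi]⟩

end LocalInvariants

/-! ### The images φ(ξ_k) in terms of the larger ξ_k -/

section PhiXi

variable {F : Type*} [Field F] [Fintype F] {m : ℕ}

theorem pow_card_pow_sub (A : Type*) [CommRing A] [Algebra F A] (a b : A) (k : ℕ) :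
    (a - b) ^ Fintype.card F ^ k = a ^ Fintype.card F ^ k - b ^ Fintype.card F ^ k := by
  induction k with
  | zero => simp
  | succ k ih => rw [pow_succ, pow_mul, ih, sub_pow_card, ← pow_mul, ← pow_mul]

theorem pairing_pow_card {A : Type*} [CommRing A] [Algebra F A] (u v : Fin (2 * m) → A) :
    pairing u v ^ Fintype.card F =
      pairing (fun j => u j ^ Fintype.card F) (fun j => v j ^ Fintype.card F) := by
  rw [pairing, sum_pow_card]
  simp only [mul_pow]
  rfl

theorem pairing_sub_mul_sub_mul {A : Type*} [CommRing A] (c d : A) (a b a' b' : Fin (2 * m) → A) :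
    pairing (fun j => a j - c * b j) (fun j => a' j - d * b' j) =
      pairing a a' - d * pairing a b' - c * (pairing b a' - d * pairing b b') := by
  simp only [pairing, Finset.mul_sum, ← Finset.sum_sub_distrib]
  exact Finset.sum_congr rfl fun j _ => by ring

/-- The vector of all twisted variables. -/
noncomputable def twistVec (F : Type*) [Field F] [Fintype F] (m : ℕ) :
    Fin (2 * (m + 1)) → MvPolynomial (Fin (2 * (m + 1))) F :=
  fun j => X j ^ Fintype.card F - X (lstIdx m) ^ (Fintype.card F - 1) * X j

theorem twistVec_eq (j : Fin (2 * (m + 1))) : twistVec F m j = twist F (X (lstIdx m)) (X j) :=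
  (twist_apply _ _).symm

/-- The twist of x_1 is zero, so both outer terms of the pairing drop out. -/
theorem pairing_twistVec_pow (k : ℕ) :
    pairing (fun j => twistVec F m j ^ Fintype.card F ^ k) (twistVec F m) =
      pairing (fun j => phi F m (X j) ^ Fintype.card F ^ k) (fun j => phi F m (X j)) := by
  have h0 : twistVec F m (lstIdx m) = 0 := by rw [twistVec_eq, twist_self]
  have hq : Fintype.card F ^ k ≠ 0 := pow_ne_zero _ Fintype.card_ne_zero
  rw [pairing_idx, h0, zero_pow hq]
  simp only [Function.comp_def, twistVec_eq, phi_X]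
  ring

theorem map_pairing {A B : Type*} [CommRing A] [CommRing B] (f : A →+* B)
    (u v : Fin (2 * m) → A) :
    f (pairing u v) = pairing (fun j => f (u j)) (fun j => f (v j)) := by
  simp [pairing]

/-- Bilinear expansion. Together with `pairing_twistVec_pow` it expresses φ(ξ_k) through ξ_k,
ξ_{k+1} and ⟨X^{q^k}, X^q⟩ of the larger space. -/
theorem pairing_twistVec_expand (k : ℕ) :
    pairing (fun j => twistVec F m j ^ Fintype.card F ^ k) (twistVec F m) =
      pairing (fun j => X j ^ Fintype.card F ^ k) X ^ Fintype.card F -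
      X (lstIdx m) ^ (Fintype.card F - 1) * pairing (fun j => X j ^ Fintype.card F ^ (k + 1)) X -
      (X (lstIdx m) ^ (Fintype.card F - 1)) ^ Fintype.card F ^ k *
        (pairing (fun j => X j ^ Fintype.card F ^ k) (fun j => X j ^ Fintype.card F) -
        X (lstIdx m) ^ (Fintype.card F - 1) * pairing (fun j => X j ^ Fintype.card F ^ k) X) := by
  have h1 : (fun j => twistVec F m j ^ Fintype.card F ^ k) = fun j =>
      X j ^ Fintype.card F ^ (k + 1) -
        (X (lstIdx m) ^ (Fintype.card F - 1)) ^ Fintype.card F ^ k *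
          X j ^ Fintype.card F ^ k := by
    funext j
    rw [twistVec, pow_card_pow_sub, ← pow_mul, mul_pow, ← pow_succ']
  have h2 : twistVec F m = fun j => X j ^ Fintype.card F -
      X (lstIdx m) ^ (Fintype.card F - 1) * X j := rfl
  have h3 : pairing (fun j => (X j : MvPolynomial (Fin (2 * (m + 1))) F) ^ Fintype.card F ^ k) X ^
      Fintype.card F =
      pairing (fun j => X j ^ Fintype.card F ^ (k + 1)) (fun j => X j ^ Fintype.card F) := by
    refine (pairing_pow_card _ _).trans ?_
    simp only [← pow_mul, ← pow_succ]
  rw [h3]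
  exact (congrArg₂ pairing h1 h2).trans (pairing_sub_mul_sub_mul _ _ _ _ _ _)

theorem two_mul_phi_xi_zero : pairing (fun j => phi F m (X j)) (fun j => phi F m (X j)) =
    2 * phi F m (xi m F 0) := by
  have h : phi F m (2 * xi m F 0) = phi F m (pairing X X) :=
    congrArg (phi F m) two_mul_xi_zero
  rw [map_mul, map_ofNat] at h
  rw [h]
  exact (map_pairing (phi F m).toRingHom _ _).symm

theorem phi_xi_zero (hF : ringChar F ≠ 2) : phi F m (xi m F 0) =
    xi (m + 1) F 0 ^ Fintype.card F - X (lstIdx m) ^ (Fintype.card F - 1) * xi (m + 1) F 1 +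
      (X (lstIdx m) ^ (Fintype.card F - 1)) ^ 2 * xi (m + 1) F 0 := by
  have hexp := pairing_twistVec_expand (F := F) (m := m) 0
  rw [pairing_twistVec_pow] at hexp
  simp only [pow_zero, pow_one, zero_add] at hexp
  have h5 : pairing (fun j => (X j : MvPolynomial (Fin (2 * (m + 1))) F) ^ Fintype.card F) X =
      xi (m + 1) F 1 := by
    rw [xi_eq_pairing one_ne_zero, pow_one]
  have h4 : pairing (fun j => (X j : MvPolynomial (Fin (2 * (m + 1))) F))
      (fun j => X j ^ Fintype.card F) = xi (m + 1) F 1 := by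
    rw [pairing_comm]
    exact h5
  have h6 : pairing (fun j => (X j : MvPolynomial (Fin (2 * (m + 1))) F)) X =
      2 * xi (m + 1) F 0 := two_mul_xi_zero.symm
  have h6' : (2 * xi (m + 1) F 0) ^ Fintype.card F = 2 * xi (m + 1) F 0 ^ Fintype.card F := by
    rw [two_mul (xi (m + 1) F 0), add_pow_card, ← two_mul (xi (m + 1) F 0 ^ Fintype.card F)]
  rw [two_mul_phi_xi_zero, h4, h5, h6, h6'] at hexp
  apply mul_left_cancel₀ (two_ne_zero_mvPolynomial hF (σ := Fin (2 * (m + 1))))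
  rw [hexp]
  ring

theorem phi_xi {k : ℕ} (hk : k ≠ 0) : phi F m (xi m F k) =
    xi (m + 1) F k ^ Fintype.card F -
      X (lstIdx m) ^ (Fintype.card F - 1) * xi (m + 1) F (k + 1) -
      (X (lstIdx m) ^ (Fintype.card F - 1)) ^ Fintype.card F ^ k *
        (pairing (fun j => X j ^ Fintype.card F ^ k) (fun j => X j ^ Fintype.card F) -
        X (lstIdx m) ^ (Fintype.card F - 1) * xi (m + 1) F k) := by
  have hexp := pairing_twistVec_expand (F := F) (m := m) k
  rw [pairing_twistVec_pow, ← xi_eq_pairing hk, ← xi_eq_pairing (Nat.succ_ne_zero k)] at hexp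
  rw [← hexp, xi_eq_pairing hk]
  refine (map_pairing (phi F m).toRingHom _ _).trans ?_
  congr 1
  funext j
  exact map_pow (phi F m) _ _

/-- For k = l + 1 this pairing is the q-th power of ⟨X^{q^l}, X⟩, which is ξ_l, or 2ξ_0 when l = 0.
-/
theorem pairing_pow_mem {k : ℕ} (hk : k ≠ 0) (D : Subalgebra F (MvPolynomial (Fin (2 * m)) F))
    (hD : ∀ l < k, xi m F l ∈ D) :
    pairing (fun j => (X j : MvPolynomial (Fin (2 * m)) F) ^ Fintype.card F ^ k)
      (fun j => X j ^ Fintype.card F) ∈ D := by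
  obtain ⟨l, rfl⟩ := Nat.exists_eq_succ_of_ne_zero hk
  have : pairing (fun j => (X j : MvPolynomial (Fin (2 * m)) F) ^ Fintype.card F ^ (l + 1))
      (fun j => X j ^ Fintype.card F) =
      pairing (fun j => X j ^ Fintype.card F ^ l) X ^ Fintype.card F := by
    rw [pairing_pow_card]
    simp only [← pow_mul, ← pow_succ]
  rw [this]
  refine D.pow_mem ?_ _
  rcases Nat.eq_zero_or_pos l with rfl | hl
  · simp only [pow_zero, pow_one]
    have h6 : pairing (fun j => (X j : MvPolynomial (Fin (2 * m)) F)) X = 2 * xi m F 0 :=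
      two_mul_xi_zero.symm
    rw [h6, two_mul (xi m F 0)]
    exact D.add_mem (hD 0 (by omega)) (hD 0 (by omega))
  · rw [← xi_eq_pairing hl.ne']
    exact hD l (by omega)

/-- Modulo `x_1`, the `q`-th power of `ξ_k` is the image of the `ξ_k` of the smaller space. -/
theorem exists_xi_pow_card (hF : ringChar F ≠ 2) (k : ℕ)
    (D : Subalgebra F (MvPolynomial (Fin (2 * (m + 1))) F)) (hx : X (lstIdx m) ∈ D)
    (hD : ∀ l ≤ k + 1, xi (m + 1) F l ∈ D) : ∃ u ∈ D,
      xi (m + 1) F k ^ Fintype.card F = phi F m (xi m F k) + X (lstIdx m) * u := by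
  obtain ⟨r, hr⟩ : ∃ r, Fintype.card F - 1 = r + 1 :=
    Nat.exists_eq_succ_of_ne_zero (Nat.sub_ne_zero_of_lt Fintype.one_lt_card)
  obtain ⟨s, hs⟩ : ∃ s, Fintype.card F ^ k = s + 1 :=
    Nat.exists_eq_succ_of_ne_zero (pow_ne_zero _ Fintype.card_ne_zero)
  rcases eq_or_ne k 0 with rfl | hk
  · refine ⟨X (lstIdx m) ^ r * xi (m + 1) F 1 -
      X (lstIdx m) ^ r * X (lstIdx m) ^ (r + 1) * xi (m + 1) F 0, ?_, ?_⟩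
    · exact D.sub_mem (D.mul_mem (D.pow_mem hx _) (hD 1 (by omega)))
        (D.mul_mem (D.mul_mem (D.pow_mem hx _) (D.pow_mem hx _)) (hD 0 (by omega)))
    · rw [phi_xi_zero hF, hr]
      ring
  · have h4 := pairing_pow_mem hk D fun l hl => hD l (by omega)
    have h := phi_xi (F := F) (m := m) hk
    generalize pairing (fun j => (X j : MvPolynomial (Fin (2 * (m + 1))) F) ^ Fintype.card F ^ k)
      (fun j => X j ^ Fintype.card F) = w at h h4
    refine ⟨X (lstIdx m) ^ r * xi (m + 1) F (k + 1) + X (lstIdx m) ^ r *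
      (X (lstIdx m) ^ (r + 1)) ^ s * (w - X (lstIdx m) ^ (r + 1) * xi (m + 1) F k), ?_, ?_⟩
    · exact D.add_mem (D.mul_mem (D.pow_mem hx _) (hD _ le_rfl)) (D.mul_mem (D.mul_mem
        (D.pow_mem hx _) (D.pow_mem (D.pow_mem hx _) _)) (D.sub_mem h4
          (D.mul_mem (D.pow_mem hx _) (hD _ (by omega)))))
    · rw [h, hr, hs]
      ring

end PhiXi

/-! ### An invariant z that is monic in y_1 modulo x_1 -/

section MonicInvariant

variable {F : Type*} [Field F] [Fintype F] {m : ℕ}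

/-- The monomials in the first `2m` of the `ξ_k` of the space of dimension `2(m+1)`. -/
noncomputable def xiProd (F : Type*) [Field F] [Fintype F] (m : ℕ) (e : Fin (2 * m) → ℕ) :
    MvPolynomial (Fin (2 * (m + 1))) F :=
  ∏ k : Fin (2 * m), xi (m + 1) F k ^ e k

theorem rho_xiProd (e : Fin (2 * m) → ℕ) :
    rho F m (xiProd F m e) = Polynomial.C (xiMonomial F m e) := by
  simp [xiProd, xiMonomial, map_prod]

theorem xiProd_mem (e : Fin (2 * m) → ℕ) : xiProd F m e ∈ invariants (sylow (m + 1) F) :=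
  prod_mem fun _ _ => pow_mem (xi_mem _) _

/-- A group element turns the expansion into another one of the same polynomial, and expansions are
unique. -/
theorem act_mem_of_expansion (hF : ringChar F ≠ 2)
    {b : (Fin (2 * m) → Fin (Fintype.card F)) → MvPolynomial (Fin (2 * m)) F}
    (hb : ∑ d, b d ^ Fintype.card F * xiMonomial F m (fun k => d k) ∈ invariants (sylow m F))
    (d : Fin (2 * m) → Fin (Fintype.card F)) : b d ∈ invariants (sylow m F) := by
  intro h hh
  have h1 := hb h hh
  have hmon : ∀ e, act h (xiMonomial F m e) = xiMonomial F m e := fun e =>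
    (prod_mem fun _ _ => pow_mem (xi_mem _) _ : xiMonomial F m e ∈ invariants (sylow m F)) h hh
  simp only [map_sum, map_mul, map_pow, hmon] at h1
  rw [← sub_eq_zero, ← Finset.sum_sub_distrib] at h1
  simp only [← sub_mul, ← sub_pow_card] at h1
  have h2 := congrFun (eq_zero_of_sum_xiMonomial_eq_zero hF h1) d
  exact sub_eq_zero.mp h2

theorem expandAt_fst_of_X {φ : MvPolynomial (Fin (2 * m)) F →ₐ[F] MvPolynomial (Fin (2 * (m + 1))) F}
    (h : ∀ i, expandAt F (fstIdx m) (φ (X i)) = Polynomial.C (φ (X i)))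
    (f : MvPolynomial (Fin (2 * m)) F) :
    expandAt F (fstIdx m) (φ f) = Polynomial.C (φ f) := by
  have : (expandAt F (fstIdx m)).comp φ = (IsScalarTower.toAlgHom F
      (MvPolynomial (Fin (2 * (m + 1))) F) (Polynomial (MvPolynomial (Fin (2 * (m + 1))) F))).comp φ := by
    ext1 i
    exact h i
  exact DFunLike.congr_fun this f

theorem expandAt_inc (f : MvPolynomial (Fin (2 * m)) F) :
    expandAt F (fstIdx m) (inc F m f) = Polynomial.C (inc F m f) :=
  expandAt_fst_of_X (fun i => by rw [inc_X, expandAt_X_of_ne (mid_ne_fstIdx i)]) f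

theorem expandAt_lst : expandAt F (fstIdx m) (X (lstIdx m)) = Polynomial.C (X (lstIdx m)) :=
  expandAt_X_of_ne fstIdx_ne_lstIdx.symm

theorem expandAt_phi (f : MvPolynomial (Fin (2 * m)) F) :
    expandAt F (fstIdx m) (phi F m f) = Polynomial.C (phi F m f) :=
  expandAt_fst_of_X (fun i => by
    rw [phi_X, map_twist, expandAt_X_of_ne (mid_ne_fstIdx i), expandAt_lst]
    simp [twist_apply]) f

theorem natDegree_expandAt_xi_le (k : ℕ) :
    (expandAt F (fstIdx m) (xi (m + 1) F k)).natDegree ≤ Fintype.card F ^ k := by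
  have hq : 1 ≤ Fintype.card F ^ k := Nat.one_le_pow _ _ Fintype.card_pos
  rcases eq_or_ne k 0 with rfl | hk
  · rw [xi_succ_zero, map_add, map_mul, expandAt_X_self, expandAt_inc, expandAt_lst, pow_zero]
    refine Polynomial.natDegree_add_le_of_degree_le ?_ ?_
    · exact (Polynomial.natDegree_mul_C_le _ _).trans Polynomial.natDegree_X_le
    · rw [Polynomial.natDegree_C]
      exact zero_le
  · rw [xi_succ hk, map_add, map_add, map_mul, map_mul, map_pow, map_pow, expandAt_X_self,
      expandAt_inc, expandAt_lst, ← map_pow]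
    refine Polynomial.natDegree_add_le_of_degree_le (Polynomial.natDegree_add_le_of_degree_le ?_ ?_) ?_
    · exact (Polynomial.natDegree_mul_C_le _ _).trans (Polynomial.natDegree_X_pow_le _)
    · exact (Polynomial.natDegree_mul_C_le _ _).trans (Polynomial.natDegree_X_le.trans hq)
    · rw [Polynomial.natDegree_C]
      exact zero_le

/-- The degree in y_1 is at most ∑ d_k q^k, a number with 2m digits in base q. -/
theorem natDegree_expandAt_xiProd_lt (d : Fin (2 * m) → Fin (Fintype.card F)) :
    (expandAt F (fstIdx m) (xiProd F m fun k => d k)).natDegree < Fintype.card F ^ (2 * m) := by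
  refine lt_of_le_of_lt ?_ (finFunctionFinEquiv d).2
  rw [finFunctionFinEquiv_apply_val, xiProd, map_prod]
  refine (Polynomial.natDegree_prod_le _ _).trans (Finset.sum_le_sum fun k _ => ?_)
  rw [map_pow]
  exact Polynomial.natDegree_pow_le.trans (Nat.mul_le_mul_left _ (natDegree_expandAt_xi_le _))

theorem rho_eq_map_expandAt (f : MvPolynomial (Fin (2 * (m + 1))) F) :
    rho F m f = (expandAt F (fstIdx m) f).map
      (aeval (mkVec 0 X 0) : MvPolynomial (Fin (2 * (m + 1))) F →ₐ[F] _).toRingHom := by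
  have : rho F m = (Polynomial.mapAlgHom (aeval (mkVec 0 X 0))).comp
      (expandAt F (fstIdx m)) := by
    ext1 j
    rw [AlgHom.comp_apply]
    induction j using idx_cases with
    | h0 => simp [expandAt_X_self]
    | h1 i => simp [expandAt_X_of_ne (mid_ne_fstIdx i)]
    | h2 => simp [expandAt_lst]
  rw [this, AlgHom.comp_apply]
  rfl

/-- The leading term of ξ_{2m} in y_1 is x_1 y_1^{q^{2m}}. The case m = 0 is separate because ξ_0 is
not given by the formula for positive index. -/
theorem degree_expandAt_xi_sub_lt :
    (expandAt F (fstIdx m) (xi (m + 1) F (2 * m) -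
      X (lstIdx m) * X (fstIdx m) ^ Fintype.card F ^ (2 * m))).degree <
        (Fintype.card F ^ (2 * m) : ℕ) := by
  rcases Nat.eq_zero_or_pos (2 * m) with hm | hm
  · rw [hm, pow_zero, pow_one, xi_succ_zero, mul_comm (X (fstIdx m)) (X (lstIdx m)),
      add_sub_cancel_left, expandAt_inc]
    exact Polynomial.degree_C_le.trans_lt (by norm_num)
  · rw [xi_succ hm.ne', mul_comm (X (lstIdx m)) (X (fstIdx m) ^ _), add_assoc, add_sub_cancel_left,
      map_add, map_mul, map_pow, expandAt_X_self, expandAt_inc, expandAt_lst, ← map_pow]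
    have hq : 1 < Fintype.card F ^ (2 * m) := Nat.one_lt_pow hm.ne' Fintype.one_lt_card
    refine (Polynomial.degree_add_le _ _).trans_lt (max_lt ?_ ?_)
    · rw [mul_comm (Polynomial.X) (Polynomial.C _)]
      exact (Polynomial.degree_C_mul_X_le _).trans_lt (by exact_mod_cast hq)
    · exact Polynomial.degree_C_le.trans_lt (by exact_mod_cast zero_lt_one.trans hq)

/-- The expansion of `ξ_{2m}` yields an invariant that is monic in `y_1` modulo `x_1`. -/
theorem exists_monic_invariant (hF : ringChar F ≠ 2) :
    ∃ (b : (Fin (2 * m) → Fin (Fintype.card F)) → MvPolynomial (Fin (2 * m)) F)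
      (z : MvPolynomial (Fin (2 * (m + 1))) F),
      (∀ d, b d ∈ invariants (sylow m F)) ∧ z ∈ invariants (sylow (m + 1) F) ∧
      xi (m + 1) F (2 * m) = ∑ d, phi F m (b d) * xiProd F m (fun k => d k) + X (lstIdx m) * z ∧
      (rho F m z).Monic ∧ (rho F m z).natDegree = Fintype.card F ^ (2 * m) := by
  obtain ⟨b, hb⟩ := exists_sum_xiMonomial hF
    (Algebra.subset_adjoin (Set.mem_range_self (f := xi m F) (2 * m)) :
      xi m F (2 * m) ∈ Algebra.adjoin F (Set.range (xi m F)))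
  have hbm := act_mem_of_expansion hF (b := b) (by rw [← hb]; exact xi_mem _)
  -- Modulo x the map φ becomes the q-th power map, so the sum lifts the expansion of the smaller
  -- ξ_{2m}.
  have hdvd : X (lstIdx m) ∣ xi (m + 1) F (2 * m) -
      ∑ d, phi F m (b d) * xiProd F m (fun k => d k) := by
    rw [X_lst_dvd_iff, map_sub, rho_xi, hb, map_sum, map_sum]
    simp only [map_mul, rho_phi, rho_xiProd, sub_self]
  obtain ⟨z, hz⟩ := hdvd
  have hx : (X (lstIdx m) : MvPolynomial (Fin (2 * (m + 1))) F) ≠ 0 := X_ne_zero _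
  have hz' := sub_eq_iff_eq_add'.mp hz
  refine ⟨b, z, hbm, ?_, hz', ?_⟩
  · intro g hg
    apply mul_left_cancel₀ hx
    rw [← hz]
    conv_lhs => rw [← act_lst hg, ← map_mul, ← hz]
    exact (invariants (sylow (m + 1) F)).sub_mem (xi_mem _) (sum_mem fun d _ =>
      mul_mem (phi_mem (hbm d)) (xiProd_mem _)) g hg
  -- In xz only ξ_{2m} reaches degree q^{2m} in y_1, with coefficient x; dividing by x leaves
  -- leading coefficient 1.
  · have hu : (expandAt F (fstIdx m) (z - X (fstIdx m) ^ Fintype.card F ^ (2 * m))).degree <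
        (Fintype.card F ^ (2 * m) : ℕ) := by
      rw [← Polynomial.degree_C_mul hx, ← expandAt_lst, ← map_mul, mul_sub, ← hz, sub_right_comm,
        map_sub, map_sum, ← Polynomial.mem_degreeLT]
      refine Submodule.sub_mem _ (Polynomial.mem_degreeLT.mpr degree_expandAt_xi_sub_lt)
        (Submodule.sum_mem _ fun d _ => ?_)
      rw [Polynomial.mem_degreeLT, map_mul, expandAt_phi]
      refine Polynomial.degree_le_natDegree.trans_lt ?_
      exact_mod_cast (Polynomial.natDegree_C_mul_le _ _).trans_lt (natDegree_expandAt_xiProd_lt d)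
    have hr : (rho F m (z - X (fstIdx m) ^ Fintype.card F ^ (2 * m))).degree <
        (Fintype.card F ^ (2 * m) : ℕ) := by
      rw [rho_eq_map_expandAt]
      exact Polynomial.degree_map_le.trans_lt hu
    have hsum : rho F m z = Polynomial.X ^ Fintype.card F ^ (2 * m) +
        rho F m (z - X (fstIdx m) ^ Fintype.card F ^ (2 * m)) := by
      rw [map_sub, map_pow, rho_fst, add_sub_cancel]
    rw [hsum]
    exact ⟨Polynomial.monic_X_pow_add hr,
      Polynomial.natDegree_eq_of_degree_eq_some (by
        rw [Polynomial.degree_add_eq_left_of_degree_lt (by rwa [Polynomial.degree_X_pow]),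
          Polynomial.degree_X_pow])⟩

end MonicInvariant

/-! ### Spanning by small monomials modulo an element -/

section Adjoin

variable {F A ι : Type*} [Field F] [CommRing A] [Algebra F A] [Fintype ι] [DecidableEq ι]

/-- A variant of `exists_sum_of_mem_adjoin` modulo an element of the algebra. -/
theorem exists_sum_add_mul_of_mem_adjoin (E : Subalgebra F A) (x : A) {q : ℕ} (hq : 0 < q)
    (v : ι → A) (A₀ : Subalgebra F A)
    (hA₀ : A₀ = Algebra.adjoin F (insert x ((E : Set A) ∪ Set.range v)))
    (hv : ∀ k, ∃ e ∈ E, ∃ u ∈ A₀, v k ^ q = e + x * u) {f : A} (hf : f ∈ A₀) :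
    ∃ a : (ι → Fin q) → A, (∀ c, a c ∈ E) ∧
      ∃ u ∈ A₀, f = ∑ c, a c * ∏ k, v k ^ (c k : ℕ) + x * u := by
  have hx : x ∈ A₀ := hA₀ ▸ Algebra.subset_adjoin (Set.mem_insert _ _)
  have hE : ∀ e ∈ E, e ∈ A₀ := fun e he => hA₀ ▸ Algebra.subset_adjoin (Or.inr (Or.inl he))
  have hvm : ∀ k, v k ∈ A₀ := fun k => hA₀ ▸ Algebra.subset_adjoin (Or.inr (Or.inr ⟨k, rfl⟩))
  -- The ideal is taken inside A₀, so that the remainder x · u comes with u in A₀ and the expansion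
  -- can be iterated.
  set I : Ideal A₀ := Ideal.span {(⟨x, hx⟩ : A₀)} with hI
  set π : A₀ →ₐ[F] A₀ ⧸ I := Ideal.Quotient.mkₐ F I with hπ
  have hπx : π ⟨x, hx⟩ = 0 := Ideal.Quotient.eq_zero_iff_mem.mpr (Ideal.mem_span_singleton_self _)
  set D : Subalgebra F (A₀ ⧸ I) := (E.comap A₀.val).map π with hD
  have hDm : ∀ e (he : e ∈ E), π ⟨e, hE e he⟩ ∈ D := fun e he =>
    Subalgebra.mem_map.mpr ⟨⟨e, hE e he⟩, he, rfl⟩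
  set w : ι → A₀ ⧸ I := fun k => π ⟨v k, hvm k⟩ with hw
  have key : ∀ g, g ∈ Algebra.adjoin F (insert x ((E : Set A) ∪ Set.range v)) → ∀ hg : g ∈ A₀,
      π ⟨g, hg⟩ ∈ Algebra.adjoin F ((D : Set (A₀ ⧸ I)) ∪ Set.range w) := by
    intro g hg
    induction hg using Algebra.adjoin_induction with
    | mem g hg =>
      intro hg0
      rcases hg with rfl | hg | ⟨k, rfl⟩
      · rw [hπx]
        exact zero_mem _
      · exact Algebra.subset_adjoin (Or.inl (hDm g hg))
      · exact Algebra.subset_adjoin (Or.inr ⟨k, rfl⟩)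
    | algebraMap r =>
      intro hg0
      have : π ⟨algebraMap F A r, hg0⟩ = algebraMap F _ r := π.commutes r
      rw [this]
      exact Subalgebra.algebraMap_mem _ _
    | add a b ha hb iha ihb =>
      intro hg0
      rw [← hA₀] at ha hb
      have : π ⟨a + b, hg0⟩ = π ⟨a, ha⟩ + π ⟨b, hb⟩ := by
        rw [← map_add]
        rfl
      rw [this]
      exact add_mem (iha ha) (ihb hb)
    | mul a b ha hb iha ihb =>
      intro hg0
      rw [← hA₀] at ha hb
      have : π ⟨a * b, hg0⟩ = π ⟨a, ha⟩ * π ⟨b, hb⟩ := by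
        rw [← map_mul]
        rfl
      rw [this]
      exact mul_mem (iha ha) (ihb hb)
  obtain ⟨a, haD, ha⟩ := exists_sum_of_mem_adjoin D hq w (fun k => by
    obtain ⟨e, he, u, hu, hk⟩ := hv k
    have : w k ^ q = π ⟨e, hE e he⟩ + π ⟨x, hx⟩ * π ⟨u, hu⟩ := by
      rw [← map_mul, ← map_add, hw, ← map_pow]
      congr 1
      exact Subtype.ext hk
    rw [this, hπx, zero_mul, add_zero]
    exact hDm e he) (key f (hA₀ ▸ hf) hf)
  have haD' : ∀ c, ∃ e : A₀, (e : A) ∈ E ∧ π e = a c := fun c => by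
    obtain ⟨e, he, hec⟩ := Subalgebra.mem_map.mp (haD c)
    exact ⟨e, he, hec⟩
  choose e he hea using haD'
  have h0 : π (⟨f, hf⟩ - ∑ c, e c * ∏ k, (⟨v k, hvm k⟩ : A₀) ^ (c k : ℕ)) = 0 := by
    rw [map_sub, ha, map_sum, sub_eq_zero]
    refine Finset.sum_congr rfl fun c _ => ?_
    rw [map_mul, hea, map_prod]
    simp only [map_pow, hw]
  obtain ⟨u, hu⟩ := Ideal.mem_span_singleton'.mp (Ideal.Quotient.eq_zero_iff_mem.mp h0)
  refine ⟨fun c => e c, he, u, u.2, ?_⟩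
  have h1 := congrArg (A₀.val) hu
  simp only [map_mul, map_sub, map_sum, map_prod, map_pow, Subalgebra.coe_val] at h1
  rw [mul_comm, h1, add_sub_cancel]

end Adjoin

/-! ### The image of the invariants modulo x_1 -/

section Reduction

variable {F : Type*} [Field F] [Fintype F] {m : ℕ}

/-- The Frobenius map on the ring of invariants. -/
noncomputable def invFrobenius (F : Type*) [Field F] [Fintype F] (m : ℕ) :
    invariants (sylow m F) →ₐ[F] MvPolynomial (Fin (2 * m)) F :=
  (FiniteField.frobeniusAlgHom F _).comp (invariants (sylow m F)).val

/-- Evaluation at `z` of polynomials with invariant coefficients. -/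
noncomputable def evalPhi (z : MvPolynomial (Fin (2 * (m + 1))) F) :
    Polynomial (invariants (sylow m F)) →ₐ[F] MvPolynomial (Fin (2 * (m + 1))) F :=
  Polynomial.eval₂AlgHom ((phi F m).comp (invariants (sylow m F)).val) z fun _ => Commute.all _ _

theorem evalPhi_C (z : MvPolynomial (Fin (2 * (m + 1))) F) (a : invariants (sylow m F)) :
    evalPhi z (Polynomial.C a) = phi F m a := by
  simp [evalPhi]

theorem evalPhi_X (z : MvPolynomial (Fin (2 * (m + 1))) F) :
    evalPhi z Polynomial.X = z := by
  simp [evalPhi]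

theorem rho_evalPhi (z : MvPolynomial (Fin (2 * (m + 1))) F)
    (p : Polynomial (invariants (sylow m F))) :
    rho F m (evalPhi z p) = (p.map (invFrobenius F m).toRingHom).comp (rho F m z) := by
  induction p using Polynomial.induction_on' with
  | add p r hp hr => rw [map_add, map_add, hp, hr, Polynomial.map_add, Polynomial.add_comp]
  | monomial k a =>
    rw [← Polynomial.C_mul_X_pow_eq_monomial, map_mul, map_pow, evalPhi_C, evalPhi_X, map_mul,
      rho_phi, map_pow, Polynomial.map_mul, Polynomial.map_pow, Polynomial.map_C, Polynomial.map_X,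
      Polynomial.mul_comp, Polynomial.pow_comp, Polynomial.C_comp, Polynomial.X_comp,
      map_pow (rho F m), ← map_pow]
    exact congrArg (fun c => Polynomial.C c * rho F m z ^ k) rfl

theorem rho_sum_evalPhi (z : MvPolynomial (Fin (2 * (m + 1))) F)
    (a : (Fin (2 * m) → Fin (Fintype.card F)) → Polynomial (invariants (sylow m F))) :
    rho F m (∑ d, evalPhi z (a d) * xiProd F m fun k => d k) =
      (∑ d, (a d).map (invFrobenius F m).toRingHom *
        Polynomial.C (xiMonomial F m fun k => d k)).comp (rho F m z) := by
  rw [map_sum, Polynomial.sum_comp]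
  refine Finset.sum_congr rfl fun d _ => ?_
  rw [map_mul, rho_evalPhi, rho_xiProd, Polynomial.mul_comp, Polynomial.C_comp]

theorem eq_zero_of_comp_eq_zero {R : Type*} [CommRing R] [IsDomain R] {p w : Polynomial R}
    (hw : w.natDegree ≠ 0) (h : p.comp w = 0) : p = 0 := by
  rcases Polynomial.comp_eq_zero_iff.mp h with h | ⟨-, h⟩
  · exact h
  · rw [h, Polynomial.natDegree_C] at hw
    exact absurd rfl hw

/-- Substituting the nonconstant polynomial ρ(z) is injective; independence of the ξ^d over q-th
powers then applies to each coefficient. -/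
theorem eq_zero_of_rho_sum_evalPhi (hF : ringChar F ≠ 2) {z : MvPolynomial (Fin (2 * (m + 1))) F}
    (hz : (rho F m z).natDegree ≠ 0)
    {a : (Fin (2 * m) → Fin (Fintype.card F)) → Polynomial (invariants (sylow m F))}
    (h : rho F m (∑ d, evalPhi z (a d) * xiProd F m fun k => d k) = 0) : a = 0 := by
  rw [rho_sum_evalPhi] at h
  have h1 := eq_zero_of_comp_eq_zero hz h
  funext d
  ext1 j
  have h2 := congrArg (fun p => p.coeff j) h1
  simp only [Polynomial.finsetSum_coeff, Polynomial.coeff_mul_C, Polynomial.coeff_map,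
    Polynomial.coeff_zero] at h2
  have h3 := congrFun (eq_zero_of_sum_xiMonomial_eq_zero hF
    (a := fun d => ((a d).coeff j : MvPolynomial (Fin (2 * m)) F)) h2) d
  exact Subtype.ext h3

/-- The invariants modulo `x_1`, in terms of an invariant that is monic in `y_1`. -/
theorem exists_rho_eq_comp (hF : ringChar F ≠ 2) :
    ∃ z : MvPolynomial (Fin (2 * (m + 1))) F, (rho F m z).Monic ∧
      (rho F m z).natDegree = Fintype.card F ^ (2 * m) ∧
      ∀ f ∈ invariants (sylow (m + 1) F),
        ∃ a : (Fin (2 * m) → Fin (Fintype.card F)) → Polynomial (invariants (sylow m F)),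
          rho F m f = (∑ d, (a d).map (invFrobenius F m).toRingHom *
            Polynomial.C (xiMonomial F m fun k => d k)).comp (rho F m z) := by
  obtain ⟨b, z, hb, -, hbz, hmon, hdeg⟩ := exists_monic_invariant (m := m) hF
  refine ⟨z, hmon, hdeg, ?_⟩
  have hdeg0 : (rho F m z).natDegree ≠ 0 := by
    rw [hdeg]
    exact pow_ne_zero _ Fintype.card_ne_zero
  have hx0 : (X (lstIdx m) : MvPolynomial (Fin (2 * (m + 1))) F) ≠ 0 := X_ne_zero _
  -- A₀ is generated by x, z, the φ-images of invariants and ξ_0, …, ξ_{2m−1}. The goal is that it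
  -- contains every invariant.
  obtain ⟨A₀, hA₀⟩ : ∃ A₀ : Subalgebra F (MvPolynomial (Fin (2 * (m + 1))) F),
    A₀ = Algebra.adjoin F (insert (X (lstIdx m)) (((evalPhi z).range :
      Set (MvPolynomial (Fin (2 * (m + 1))) F)) ∪
        Set.range fun k : Fin (2 * m) => xi (m + 1) F k)) := ⟨_, rfl⟩
  have hx : X (lstIdx m) ∈ A₀ := hA₀ ▸ Algebra.subset_adjoin (Set.mem_insert _ _)
  have hE : ∀ p, evalPhi z p ∈ A₀ := fun p =>
    hA₀ ▸ Algebra.subset_adjoin (Or.inr (Or.inl ⟨p, rfl⟩))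
  have hphi : ∀ a ∈ invariants (sylow m F), phi F m a ∈ A₀ := fun a ha => by
    rw [← evalPhi_C z ⟨a, ha⟩]
    exact hE _
  have hz : z ∈ A₀ := by
    have := hE Polynomial.X
    rwa [evalPhi_X] at this
  have hxi' : ∀ k : Fin (2 * m), xi (m + 1) F k ∈ A₀ := fun k =>
    hA₀ ▸ Algebra.subset_adjoin (Or.inr (Or.inr ⟨k, rfl⟩))
  -- The bound includes l = 2m, supplied by the relation defining z: reducing the q-th power of
  -- ξ_{2m−1} involves ξ_{2m}.
  have hxi : ∀ l ≤ 2 * m, xi (m + 1) F l ∈ A₀ := by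
    intro l hl
    rcases hl.lt_or_eq with hl | rfl
    · exact hxi' ⟨l, hl⟩
    · rw [hbz]
      exact A₀.add_mem (sum_mem fun d _ => mul_mem (hphi _ (hb d))
        (prod_mem fun k _ => pow_mem (hxi' k) _)) (mul_mem hx hz)
  have hspan : ∀ f ∈ A₀, ∃ a : (Fin (2 * m) → Fin (Fintype.card F)) →
      Polynomial (invariants (sylow m F)), ∃ u ∈ A₀,
      f = ∑ d, evalPhi z (a d) * xiProd F m (fun k => d k) + X (lstIdx m) * u := by
    intro f hf
    obtain ⟨a, ha, u, hu, h⟩ := exists_sum_add_mul_of_mem_adjoin (evalPhi z).range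
      (X (lstIdx m)) (Fintype.card_pos (α := F)) (fun k : Fin (2 * m) => xi (m + 1) F k) A₀ hA₀
      (fun k => by
        obtain ⟨u, hu, h⟩ := exists_xi_pow_card hF k A₀ hx fun l hl => hxi l (by omega)
        refine ⟨phi F m (xi m F k), ⟨Polynomial.C ⟨_, xi_mem k⟩, evalPhi_C _ _⟩, u, hu, h⟩) hf
    choose p hp using ha
    refine ⟨p, u, hu, ?_⟩
    have hp' : ∀ d, evalPhi z (p d) = a d := hp
    simp only [hp']
    exact h
  -- Expanding xg and applying ρ kills every coefficient by independence, so xg = xu with u in A₀.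
  have hsat : ∀ g, X (lstIdx m) * g ∈ A₀ → g ∈ A₀ := by
    intro g hg
    obtain ⟨a, u, hu, h⟩ := hspan _ hg
    have h1 := congrArg (rho F m) h
    rw [map_add, map_mul, map_mul, rho_lst, zero_mul, zero_mul, add_zero] at h1
    have h2 := eq_zero_of_rho_sum_evalPhi hF hdeg0 h1.symm
    rw [h2] at h
    simp only [Pi.zero_apply, map_zero, zero_mul, Finset.sum_const_zero, zero_add] at h
    rw [mul_left_cancel₀ hx0 h]
    exact hu
  intro f hf
  have hfA : f ∈ A₀ := by
    obtain ⟨k, hk⟩ := exists_pow_mul_mem_adjoin hf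
    have hk' : X (lstIdx m) ^ k * f ∈ A₀ := by
      refine Algebra.adjoin_le ?_ hk
      rintro _ ((rfl | rfl) | ⟨a, ha, rfl⟩)
      · exact hxi 0 (Nat.zero_le _)
      · exact hx
      · exact hphi a ha
    clear hk
    induction k with
    | zero => simpa using hk'
    | succ k ih => exact ih (hsat _ (by rwa [← mul_assoc, ← pow_succ']))
  obtain ⟨a, u, hu, h⟩ := hspan f hfA
  refine ⟨a, ?_⟩
  rw [h, map_add, map_mul, rho_lst, zero_mul, add_zero, rho_sum_evalPhi]

/-- The algebra generated by the `q`-th powers of invariants and the first `2m` of the `ξ_k`. -/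
noncomputable def coeffAlgebra (F : Type*) [Field F] [Fintype F] (m : ℕ) :
    Subalgebra F (MvPolynomial (Fin (2 * m)) F) :=
  Algebra.adjoin F (((invFrobenius F m).range : Set (MvPolynomial (Fin (2 * m)) F)) ∪
    Set.range fun k : Fin (2 * m) => xi m F k)

theorem invFrobenius_mem_coeffAlgebra (a : invariants (sylow m F)) :
    invFrobenius F m a ∈ coeffAlgebra F m := Algebra.subset_adjoin (Or.inl ⟨a, rfl⟩)

theorem xiMonomial_mem_coeffAlgebra (e : Fin (2 * m) → ℕ) :
    xiMonomial F m e ∈ coeffAlgebra F m := by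
  have h : ∀ k : Fin (2 * m), xi m F k ∈ coeffAlgebra F m := fun k =>
    Algebra.subset_adjoin (Or.inr ⟨k, rfl⟩)
  exact prod_mem fun k _ => pow_mem (h k) _

theorem exists_sum_of_mem_coeffAlgebra {f : MvPolynomial (Fin (2 * m)) F}
    (hf : f ∈ coeffAlgebra F m) :
    ∃ a : (Fin (2 * m) → Fin (Fintype.card F)) → invariants (sylow m F),
      f = ∑ d, (a d : MvPolynomial (Fin (2 * m)) F) ^ Fintype.card F *
        xiMonomial F m fun k => d k := by
  obtain ⟨a, ha, h⟩ := exists_sum_of_mem_adjoin (invFrobenius F m).range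
    (Fintype.card_pos (α := F)) (fun k : Fin (2 * m) => xi m F k)
    (fun k => ⟨⟨_, xi_mem k⟩, rfl⟩) hf
  choose b hb using ha
  have hb' : ∀ d, (b d : MvPolynomial (Fin (2 * m)) F) ^ Fintype.card F = a d := hb
  refine ⟨b, ?_⟩
  simp only [hb']
  exact h

/-- Modulo `x_1`, every invariant is a polynomial in the orbit product of `y_1`. -/
theorem exists_rho_eq_sum (hF : ringChar F ≠ 2) {f : MvPolynomial (Fin (2 * (m + 1))) F}
    (hf : f ∈ invariants (sylow (m + 1) F)) :
    ∃ p : Polynomial (coeffAlgebra F m), rho F m f = (p.map (coeffAlgebra F m).val.toRingHom).comp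
      (rho F m (orbitProduct (sylow (m + 1) F) (X (fstIdx m)))) := by
  obtain ⟨z, hmon, hdeg, hz⟩ := exists_rho_eq_comp (m := m) hF
  have hz' : ∀ f ∈ invariants (sylow (m + 1) F), ∃ p : Polynomial (coeffAlgebra F m),
      rho F m f = (p.map (coeffAlgebra F m).val.toRingHom).comp (rho F m z) := by
    intro f hf
    obtain ⟨a, ha⟩ := hz f hf
    refine ⟨∑ d, (a d).map ((invFrobenius F m).codRestrict (coeffAlgebra F m)
      invFrobenius_mem_coeffAlgebra).toRingHom *
        Polynomial.C (⟨_, xiMonomial_mem_coeffAlgebra fun k => d k⟩ : coeffAlgebra F m), ?_⟩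
    rw [ha, Polynomial.map_sum]
    congr 1
    refine Finset.sum_congr rfl fun d _ => ?_
    rw [Polynomial.map_mul, Polynomial.map_map, Polynomial.map_C]
    rfl
  obtain ⟨r, hr⟩ := hz' _ (orbitProduct_mem (sylow (m + 1) F) (X (fstIdx m)))
  set N := rho F m (orbitProduct (sylow (m + 1) F) (X (fstIdx m))) with hN
  set r' := r.map (coeffAlgebra F m).val.toRingHom with hr'
  have hpos : 0 < Fintype.card F ^ (2 * m) := pow_pos Fintype.card_pos _
  -- The reductions of N(y_1) and z are both monic of degree q^{2m}, so they differ by a constant in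
  -- the coefficient algebra and one can be traded for the other.
  have hr1 : r'.natDegree = 1 := by
    have h1 := congrArg Polynomial.natDegree hr
    rw [Polynomial.natDegree_comp, hdeg, hN, rho_orbitProduct_fst_natDegree hF] at h1
    exact Nat.eq_of_mul_eq_mul_right hpos (by rw [one_mul]; exact h1.symm)
  have hlead : r'.coeff 1 = 1 := by
    have h1 := congrArg Polynomial.leadingCoeff hr
    rw [Polynomial.leadingCoeff_comp (by rw [hdeg]; exact hpos.ne'), hmon.leadingCoeff, one_pow,
      mul_one, hN, (rho_orbitProduct_fst_monic hF).leadingCoeff] at h1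
    rw [← hr1]
    exact h1.symm
  have hrz : rho F m z = N - Polynomial.C (r'.coeff 0) := by
    rw [Polynomial.eq_X_add_C_of_natDegree_le_one hr1.le, hlead] at hr
    rw [hr]
    simp
  obtain ⟨p, hp⟩ := hz' f hf
  refine ⟨p.comp (Polynomial.X - Polynomial.C (r.coeff 0)), ?_⟩
  rw [hp, hrz, Polynomial.map_comp, Polynomial.comp_assoc]
  congr 1
  rw [Polynomial.map_sub, Polynomial.map_X, Polynomial.map_C, Polynomial.sub_comp,
    Polynomial.X_comp, Polynomial.C_comp, hr', Polynomial.coeff_map]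

end Reduction

/-! ### Homogeneous components of invariants -/

section Graded

variable {F : Type*} [Field F] {n : ℕ}

theorem homogeneousComponent_of_isHomogeneous {f : MvPolynomial (Fin n) F} {D : ℕ}
    (hf : f.IsHomogeneous D) (d : ℕ) : homogeneousComponent d f = if d = D then f else 0 :=
  homogeneousComponent_of_mem ((mem_homogeneousSubmodule _ _).mpr hf)

theorem isHomogeneous_monomial_self (s : Fin n →₀ ℕ) (c : F) :
    (monomial s c).IsHomogeneous s.degree := isHomogeneous_monomial c rfl

theorem homogeneousComponent_act [Fintype F] (g : GL (Fin n) F) (d : ℕ)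
    (f : MvPolynomial (Fin n) F) :
    homogeneousComponent d (act g f) = act g (homogeneousComponent d f) := by
  induction f using MvPolynomial.induction_on' with
  | monomial s c =>
    have h : (act g (monomial s c)).IsHomogeneous s.degree :=
      linSubst_isHomogeneous (g : Matrix (Fin n) (Fin n) F) (isHomogeneous_monomial_self s c)
    rw [homogeneousComponent_of_isHomogeneous (isHomogeneous_monomial_self s c),
      homogeneousComponent_of_isHomogeneous h]
    split_ifs <;> simp
  | add p q hp hq => simp only [map_add, hp, hq]

theorem homogeneousComponent_mem_invariants [Fintype F] {G : Subgroup (GL (Fin n) F)}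
    {f : MvPolynomial (Fin n) F} (hf : f ∈ invariants G) (d : ℕ) :
    homogeneousComponent d f ∈ invariants G := fun g hg => by
  rw [← homogeneousComponent_act, hf g hg]

theorem homogeneousComponent_succ_X_mul (i : Fin n) (d : ℕ) (f : MvPolynomial (Fin n) F) :
    homogeneousComponent (d + 1) (X i * f) = X i * homogeneousComponent d f := by
  induction f using MvPolynomial.induction_on' with
  | monomial s c =>
    rw [homogeneousComponent_of_isHomogeneous (isHomogeneous_monomial_self s c),
      homogeneousComponent_of_isHomogeneous
        ((isHomogeneous_X F i).mul (isHomogeneous_monomial_self s c)), add_comm 1 s.degree]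
    simp only [add_left_inj]
    split_ifs <;> simp
  | add p q hp hq => simp only [map_add, mul_add, hp, hq]

theorem homogeneousComponent_zero_X_mul (i : Fin n) (f : MvPolynomial (Fin n) F) :
    homogeneousComponent 0 (X i * f) = 0 := by
  rw [homogeneousComponent_zero, ← constantCoeff_eq, map_mul, constantCoeff_X, zero_mul, map_zero]

theorem eq_zero_of_forall_X_pow_dvd (i : Fin n) {f : MvPolynomial (Fin n) F}
    (h : ∀ k, X i ^ k ∣ f) : f = 0 := by
  by_contra hf
  obtain ⟨g, hg⟩ := h (f.totalDegree + 1)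
  have hg0 : g ≠ 0 := fun h0 => hf (by rw [hg, h0, mul_zero])
  have h1 := congrArg totalDegree hg
  rw [totalDegree_mul_of_isDomain (pow_ne_zero _ (X_ne_zero i)) hg0, totalDegree_X_pow] at h1
  omega

end Graded

/-! ### The inductive construction of a basis of ξ-monomials -/

section Basis

variable {F : Type*} [Field F] [Fintype F] {m : ℕ}

/-- The orbit products of the variables. -/
noncomputable def norms (F : Type*) [Field F] [Fintype F] (m : ℕ) (i : Fin (2 * m)) :
    MvPolynomial (Fin (2 * m)) F := orbitProduct (sylow m F) (X i)

theorem norms_mem (i : Fin (2 * m)) : norms F m i ∈ invariants (sylow m F) := orbitProduct_mem _ _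

theorem aeval_norms_mem (p : MvPolynomial (Fin (2 * m)) F) :
    aeval (norms F m) p ∈ invariants (sylow m F) := by
  have h : aeval (norms F m) = (invariants (sylow m F)).val.comp
      (aeval fun i => (⟨norms F m i, norms_mem i⟩ : invariants (sylow m F))) := by
    ext1 i
    simp
  rw [h]
  exact Subtype.property _

theorem xiMonomial_mem_invariants (e : Fin (2 * m) → ℕ) :
    xiMonomial F m e ∈ invariants (sylow m F) := prod_mem fun _ _ => pow_mem (xi_mem _) _

/-- Linear combinations of monomials in the `ξ_k` with coefficients polynomials in the orbit
products. -/
noncomputable def combination {ι : Type*} [Fintype ι] (F : Type*) [Field F] [Fintype F]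
    (e : ι → Fin (2 * m) → ℕ) (p : ι → MvPolynomial (Fin (2 * m)) F) :
    MvPolynomial (Fin (2 * m)) F :=
  ∑ i, aeval (norms F m) (p i) * xiMonomial F m (e i)

/-- The ring of invariants is free over the polynomials in the orbit products, with a basis of
monomials in the `ξ_k`, `k ≤ 2m - 3`. -/
def HasXiBasis (F : Type*) [Field F] [Fintype F] (m : ℕ) : Prop :=
  ∃ (ι : Type) (_ : Fintype ι) (e : ι → Fin (2 * m) → ℕ),
    (∀ i k, e i k ≠ 0 → (k : ℕ) + 3 ≤ 2 * m) ∧ (∀ p, combination F e p = 0 → p = 0) ∧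
      ∀ f ∈ invariants (sylow m F), ∃ p, combination F e p = f

theorem hasXiBasis_zero : HasXiBasis F 0 := by
  have : IsEmpty (Fin (2 * 0)) := inferInstanceAs (IsEmpty (Fin 0))
  have hid : aeval (norms F 0) = AlgHom.id F _ := by
    ext1 i
    exact isEmptyElim i
  have hc : ∀ p : Unit → MvPolynomial (Fin (2 * 0)) F,
      combination F (fun _ _ => 0) p = p () := by
    intro p
    simp [combination, hid, xiMonomial]
  refine ⟨Unit, inferInstance, fun _ _ => 0, fun i k h => absurd rfl h, fun p hp => ?_,
    fun f _ => ⟨fun _ => f, hc _⟩⟩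
  rw [hc] at hp
  funext i
  exact hp

variable {ι : Type*} [Fintype ι]

theorem combination_mem (e : ι → Fin (2 * m) → ℕ) (p : ι → MvPolynomial (Fin (2 * m)) F) :
    combination F e p ∈ invariants (sylow m F) :=
  sum_mem fun _ _ => mul_mem (aeval_norms_mem _) (xiMonomial_mem_invariants _)

theorem combination_add (e : ι → Fin (2 * m) → ℕ) (p r : ι → MvPolynomial (Fin (2 * m)) F) :
    combination F e (p + r) = combination F e p + combination F e r := by
  simp [combination, add_mul, Finset.sum_add_distrib]

theorem combination_mul (e : ι → Fin (2 * m) → ℕ) (r : MvPolynomial (Fin (2 * m)) F)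
    (p : ι → MvPolynomial (Fin (2 * m)) F) :
    combination F e (fun i => r * p i) = aeval (norms F m) r * combination F e p := by
  simp [combination, mul_assoc, Finset.mul_sum]

theorem combination_sum {κ : Type*} (s : Finset κ) (e : ι → Fin (2 * m) → ℕ)
    (p : κ → ι → MvPolynomial (Fin (2 * m)) F) :
    combination F e (fun i => ∑ j ∈ s, p j i) = ∑ j ∈ s, combination F e (p j) := by
  simp only [combination, map_sum, Finset.sum_mul]
  exact Finset.sum_comm

theorem combination_single [DecidableEq ι] (e : ι → Fin (2 * m) → ℕ) (i : ι)
    (r : MvPolynomial (Fin (2 * m)) F) :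
    combination F e (Pi.single i r) = aeval (norms F m) r * xiMonomial F m (e i) := by
  rw [combination, Finset.sum_eq_single i]
  · rw [Pi.single_eq_same]
  · intro j _ hj
    rw [Pi.single_eq_of_ne hj, map_zero, zero_mul]
  · simp

theorem combination_zero (e : ι → Fin (2 * m) → ℕ) :
    combination F e 0 = 0 := by simp [combination]

theorem exists_isHomogeneous_aeval_norms_monomial (s : Fin (2 * m) →₀ ℕ) (c : F) :
    ∃ D, (aeval (norms F m) (monomial s c)).IsHomogeneous D := by
  have h : ∀ i, ∃ d, (norms F m i).IsHomogeneous d := fun i =>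
    (orbitProduct_X_isHomogeneous _ i).imp fun _ h => h.2
  choose d hd using h
  refine ⟨0 + ∑ i ∈ s.support, d i * s i, ?_⟩
  rw [aeval_monomial]
  exact (isHomogeneous_C _ c).mul (IsHomogeneous.prod _ _ _ fun i _ => (hd i).pow _)

/-- Orbit products and the ξ_k are homogeneous, so a component is obtained by discarding monomials
from the coefficients. -/
theorem exists_combination_eq_homogeneousComponent [DecidableEq ι] (e : ι → Fin (2 * m) → ℕ) (d : ℕ)
    (p : ι → MvPolynomial (Fin (2 * m)) F) :
    ∃ r, combination F e r = homogeneousComponent d (combination F e p) := by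
  have key : ∀ (i : ι) (f : MvPolynomial (Fin (2 * m)) F), ∃ r, combination F e r =
      homogeneousComponent d (aeval (norms F m) f * xiMonomial F m (e i)) := by
    intro i f
    induction f using MvPolynomial.induction_on' with
    | monomial s c =>
      obtain ⟨D, hD⟩ := exists_isHomogeneous_aeval_norms_monomial (F := F) s c
      rw [homogeneousComponent_of_isHomogeneous (hD.mul (xiMonomial_isHomogeneous (e i)))]
      split_ifs
      · exact ⟨_, combination_single e i _⟩
      · exact ⟨0, combination_zero e⟩
    | add f g hf hg =>
      obtain ⟨r, hr⟩ := hf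
      obtain ⟨s, hs⟩ := hg
      exact ⟨r + s, by rw [combination_add, hr, hs, map_add, add_mul, map_add]⟩
  choose r hr using fun i => key i (p i)
  refine ⟨fun j => ∑ i, r i j, ?_⟩
  rw [combination_sum, combination, map_sum]
  exact Finset.sum_congr rfl fun i _ => hr i

theorem aeval_norms_X_lst :
    aeval (norms F (m + 1)) (X (lstIdx m) : MvPolynomial (Fin (2 * (m + 1))) F) =
      X (lstIdx m) := by
  rw [aeval_X]
  exact orbitProduct_lst

/-- A graded form of Nakayama's lemma. -/
theorem exists_combination_of_forall [DecidableEq ι] (e : ι → Fin (2 * (m + 1)) → ℕ)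
    (h : ∀ f ∈ invariants (sylow (m + 1) F), ∃ p, ∃ u ∈ invariants (sylow (m + 1) F),
      f = combination F e p + X (lstIdx m) * u)
    {f : MvPolynomial (Fin (2 * (m + 1))) F} (hf : f ∈ invariants (sylow (m + 1) F)) :
    ∃ p, combination F e p = f := by
  have key : ∀ d, ∀ f ∈ invariants (sylow (m + 1) F), f.IsHomogeneous d →
      ∃ p, combination F e p = f := by
    intro d
    induction d with
    | zero =>
      intro f hf hfd
      obtain ⟨p, u, -, hu⟩ := h f hf
      obtain ⟨r, hr⟩ := exists_combination_eq_homogeneousComponent e 0 p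
      refine ⟨r, ?_⟩
      have h1 := congrArg (homogeneousComponent 0) hu
      rw [homogeneousComponent_of_isHomogeneous hfd, if_pos rfl, map_add,
        homogeneousComponent_zero_X_mul, add_zero] at h1
      rw [hr, h1]
    | succ d ih =>
      intro f hf hfd
      obtain ⟨p, u, hum, hu⟩ := h f hf
      obtain ⟨r, hr⟩ := exists_combination_eq_homogeneousComponent e (d + 1) p
      obtain ⟨s, hs⟩ := ih (homogeneousComponent d u) (homogeneousComponent_mem_invariants hum d)
        (homogeneousComponent_isHomogeneous d u)
      -- Since x has degree 1, only the degree d component of u contributes, which induction covers;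
      -- x is its own orbit product and is absorbed into the coefficients.
      refine ⟨r + fun i => X (lstIdx m) * s i, ?_⟩
      have h1 := congrArg (homogeneousComponent (d + 1)) hu
      rw [homogeneousComponent_of_isHomogeneous hfd, if_pos rfl, map_add,
        homogeneousComponent_succ_X_mul] at h1
      rw [combination_add, hr, combination_mul, hs, aeval_norms_X_lst, h1]
  choose r hr using fun d => key d _ (homogeneousComponent_mem_invariants hf d)
    (homogeneousComponent_isHomogeneous d f)
  refine ⟨fun i => ∑ d ∈ Finset.range (f.totalDegree + 1), r d i, ?_⟩
  rw [combination_sum]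
  simp only [hr]
  exact sum_homogeneousComponent f

/-- The exponents `q e + d`. -/
def extendExponent (q : ℕ) (e : ι → Fin (2 * m) → ℕ) (j : ι × (Fin (2 * m) → Fin q)) :
    Fin (2 * (m + 1)) → ℕ :=
  fun k => if h : (k : ℕ) < 2 * m then q * e j.1 ⟨k, h⟩ + j.2 ⟨k, h⟩ else 0

theorem xiMonomial_extendExponent (q : ℕ) (e : ι → Fin (2 * m) → ℕ)
    (j : ι × (Fin (2 * m) → Fin q)) : xiMonomial F (m + 1) (extendExponent q e j) =
      xiProd F m fun k => q * e j.1 k + j.2 k := by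
  rw [xiMonomial, xiProd]
  refine (Fin.prod_univ_castSucc (n := 2 * m + 1) _).trans ?_
  rw [Fin.prod_univ_castSucc (n := 2 * m)]
  simp [extendExponent]

/-- Modulo x, the orbit product of a middle variable is the q-th power of the smaller one, x itself
disappears, and only N(y_1) still involves y_1. -/
theorem rho_aeval_norms (p : MvPolynomial (Fin (2 * (m + 1))) F) :
    rho F m (aeval (norms F (m + 1)) p) =
      ((rho F m p).map ((FiniteField.frobeniusAlgHom F _).comp
        (aeval (norms F m))).toRingHom).comp (rho F m (norms F (m + 1) (fstIdx m))) := by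
  induction p using MvPolynomial.induction_on with
  | C a =>
    rw [aeval_C, show rho F m (C a) = Polynomial.C (C a) from algHom_C _ _, Polynomial.map_C,
      Polynomial.C_comp, AlgHom.commutes]
    simp [FiniteField.frobeniusAlgHom_apply, ← map_pow, FiniteField.pow_card]
  | add p r hp hr => simp only [map_add, hp, hr, Polynomial.map_add, Polynomial.add_comp]
  | mul_X p j hp =>
    rw [map_mul, map_mul, hp, map_mul, Polynomial.map_mul, Polynomial.mul_comp, aeval_X]
    refine congrArg₂ (· * ·) rfl ?_
    induction j using idx_cases with
    | h0 => rw [rho_fst, Polynomial.map_X, Polynomial.X_comp]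
    | h1 i =>
      rw [rho_mid, Polynomial.map_C, Polynomial.C_comp, norms, orbitProduct_mid, rho_phi]
      refine congrArg Polynomial.C ?_
      change _ = FiniteField.frobeniusAlgHom F _ (aeval (norms F m) (X i))
      rw [aeval_X, FiniteField.frobeniusAlgHom_apply, norms]
    | h2 =>
      rw [norms, orbitProduct_lst, rho_lst, Polynomial.map_zero, Polynomial.zero_comp]

/-- The reduction of a combination, as a polynomial in the orbit product of `y_1`. -/
noncomputable def reducedCombination (e : ι → Fin (2 * m) → ℕ)
    (p : ι × (Fin (2 * m) → Fin (Fintype.card F)) → MvPolynomial (Fin (2 * (m + 1))) F) :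
    Polynomial (MvPolynomial (Fin (2 * m)) F) :=
  ∑ j, (rho F m (p j)).map ((FiniteField.frobeniusAlgHom F _).comp
    (aeval (norms F m))).toRingHom *
      Polynomial.C (xiMonomial F m fun k => Fintype.card F * e j.1 k + j.2 k)

theorem rho_combination (e : ι → Fin (2 * m) → ℕ)
    (p : ι × (Fin (2 * m) → Fin (Fintype.card F)) → MvPolynomial (Fin (2 * (m + 1))) F) :
    rho F m (combination F (extendExponent (Fintype.card F) e) p) =
      (reducedCombination e p).comp (rho F m (norms F (m + 1) (fstIdx m))) := by
  rw [combination, reducedCombination, map_sum, Polynomial.sum_comp]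
  refine Finset.sum_congr rfl fun j _ => ?_
  rw [map_mul, rho_aeval_norms, xiMonomial_extendExponent, rho_xiProd, Polynomial.mul_comp,
    Polynomial.C_comp]

theorem xiMonomial_mul_add (q : ℕ) (e d : Fin (2 * m) → ℕ) :
    xiMonomial F m (fun k => q * e k + d k) = xiMonomial F m e ^ q * xiMonomial F m d := by
  simp only [xiMonomial, pow_add, Finset.prod_mul_distrib, ← Finset.prod_pow, ← pow_mul,
    mul_comm q]

/-- Since ξ^{qe+d} = (ξ^e)^q ξ^d, grouping by d produces q-th powers of combinations at the smaller
level. -/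
theorem coeff_reducedCombination (e : ι → Fin (2 * m) → ℕ)
    (p : ι × (Fin (2 * m) → Fin (Fintype.card F)) → MvPolynomial (Fin (2 * (m + 1))) F) (k : ℕ) :
    (reducedCombination e p).coeff k =
      ∑ d : Fin (2 * m) → Fin (Fintype.card F),
        combination F e (fun i => (rho F m (p (i, d))).coeff k) ^ Fintype.card F *
          xiMonomial F m fun k => d k := by
  rw [reducedCombination, Polynomial.finsetSum_coeff, Fintype.sum_prod_type_right]
  refine Finset.sum_congr rfl fun d _ => ?_
  rw [combination, sum_pow_card, Finset.sum_mul]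
  refine Finset.sum_congr rfl fun i _ => ?_
  rw [Polynomial.coeff_mul_C, Polynomial.coeff_map, xiMonomial_mul_add, mul_pow, mul_assoc]
  rfl

theorem rho_rhoSection (u : Polynomial (MvPolynomial (Fin (2 * m)) F)) :
    rho F m (rhoSection F m u) = u := by
  induction u using Polynomial.induction_on' with
  | add p r hp hr => rw [map_add, map_add, hp, hr]
  | monomial k a =>
    simp [rhoSection, ← Polynomial.C_mul_X_pow_eq_monomial]

theorem natDegree_rho_norms_ne_zero (hF : ringChar F ≠ 2) :
    (rho F m (norms F (m + 1) (fstIdx m))).natDegree ≠ 0 := by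
  rw [norms, rho_orbitProduct_fst_natDegree hF]
  exact pow_ne_zero _ Fintype.card_ne_zero

/-- Two independence statements are used in turn: that of the ξ^d over q-th powers, then that of the
ξ^e at the smaller level. -/
theorem X_lst_dvd_of_combination_eq_zero (hF : ringChar F ≠ 2) {e : ι → Fin (2 * m) → ℕ}
    (he : ∀ p, combination F e p = 0 → p = 0)
    {p : ι × (Fin (2 * m) → Fin (Fintype.card F)) → MvPolynomial (Fin (2 * (m + 1))) F}
    (hp : combination F (extendExponent (Fintype.card F) e) p = 0)
    (j : ι × (Fin (2 * m) → Fin (Fintype.card F))) : X (lstIdx m) ∣ p j := by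
  rw [X_lst_dvd_iff]
  have h1 := rho_combination e p
  rw [hp, map_zero] at h1
  have h2 := eq_zero_of_comp_eq_zero (natDegree_rho_norms_ne_zero hF) h1.symm
  ext1 k
  have h3 := coeff_reducedCombination e p k
  rw [h2, Polynomial.coeff_zero] at h3
  have h4 := congrFun (he _ (congrFun (eq_zero_of_sum_xiMonomial_eq_zero hF h3.symm) j.2)) j.1
  exact h4

/-- All coefficients of a relation are divisible by x; dividing by x gives another relation, so they
are divisible by every power of x. -/
theorem eq_zero_of_combination_eq_zero (hF : ringChar F ≠ 2) {e : ι → Fin (2 * m) → ℕ}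
    (he : ∀ p, combination F e p = 0 → p = 0)
    (p : ι × (Fin (2 * m) → Fin (Fintype.card F)) → MvPolynomial (Fin (2 * (m + 1))) F)
    (hp : combination F (extendExponent (Fintype.card F) e) p = 0) : p = 0 := by
  have key : ∀ k p, combination F (extendExponent (Fintype.card F) e) p = 0 →
      ∀ j, X (lstIdx m) ^ k ∣ p j := by
    intro k
    induction k with
    | zero => intro p _ j; simp
    | succ k ih =>
      intro p hp j
      choose r hr using X_lst_dvd_of_combination_eq_zero hF he hp
      obtain rfl : p = fun j => X (lstIdx m) * r j := funext hr
      rw [combination_mul, aeval_norms_X_lst] at hp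
      have h1 := ih r ((mul_eq_zero.mp hp).resolve_left (X_ne_zero _)) j
      rw [pow_succ']
      exact mul_dvd_mul_left _ h1
  funext j
  exact eq_zero_of_forall_X_pow_dvd _ fun k => key k p hp j

theorem mem_invariants_of_X_lst_mul_mem {f : MvPolynomial (Fin (2 * (m + 1))) F}
    (hf : X (lstIdx m) * f ∈ invariants (sylow (m + 1) F)) :
    f ∈ invariants (sylow (m + 1) F) := by
  intro g hg
  have h := hf g hg
  rw [map_mul, act_lst hg] at h
  exact mul_left_cancel₀ (X_ne_zero _) h

theorem exists_combination_add (hF : ringChar F ≠ 2) {e : ι → Fin (2 * m) → ℕ}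
    (he : ∀ f ∈ invariants (sylow m F), ∃ p, combination F e p = f)
    {f : MvPolynomial (Fin (2 * (m + 1))) F} (hf : f ∈ invariants (sylow (m + 1) F)) :
    ∃ p, ∃ u ∈ invariants (sylow (m + 1) F),
      f = combination F (extendExponent (Fintype.card F) e) p + X (lstIdx m) * u := by
  obtain ⟨P, hP⟩ := exists_rho_eq_sum hF hf
  choose a ha using fun k => exists_sum_of_mem_coeffAlgebra (P.coeff k).2
  choose r hr using fun k d => he (a k d) (a k d).2
  -- The coefficients found at the smaller level are lifted to polynomials whose variable y_1 stands
  -- for the orbit product N(y_1).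
  set p : ι × (Fin (2 * m) → Fin (Fintype.card F)) → MvPolynomial (Fin (2 * (m + 1))) F :=
    fun j => rhoSection F m (∑ k ∈ P.support, Polynomial.monomial k (r k j.2 j.1)) with hp
  have hred : reducedCombination e p = P.map (coeffAlgebra F m).val.toRingHom := by
    ext1 k
    have hcoeff : ∀ j, (rho F m (p j)).coeff k = if k ∈ P.support then r k j.2 j.1 else 0 := by
      intro j
      rw [hp, rho_rhoSection, Polynomial.finsetSum_coeff]
      simp [Polynomial.coeff_monomial]
    rw [coeff_reducedCombination, Polynomial.coeff_map]
    simp only [hcoeff]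
    by_cases hk : k ∈ P.support
    · simp only [if_pos hk]
      refine Eq.trans ?_ (ha k).symm
      refine Finset.sum_congr rfl fun d _ => ?_
      exact congrArg (fun w => w ^ Fintype.card F * _) (hr k d)
    · simp only [if_neg hk]
      have h0 : combination F e (fun _ => 0) = 0 := combination_zero e
      simp [h0, Polynomial.notMem_support_iff.mp hk]
  have hdvd : X (lstIdx m) ∣ f - combination F (extendExponent (Fintype.card F) e) p := by
    rw [X_lst_dvd_iff, map_sub, rho_combination, hred, hP, sub_eq_zero]
    rfl
  obtain ⟨u, hu⟩ := hdvd
  refine ⟨p, u, mem_invariants_of_X_lst_mul_mem ?_, sub_eq_iff_eq_add'.mp hu⟩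
  rw [← hu]
  exact sub_mem hf (combination_mem _ _)

theorem hasXiBasis_succ (hF : ringChar F ≠ 2) (h : HasXiBasis F m) : HasXiBasis F (m + 1) := by
  classical
  obtain ⟨ι, _, e, he, hind, hspan⟩ := h
  refine ⟨ι × (Fin (2 * m) → Fin (Fintype.card F)), inferInstance,
    extendExponent (Fintype.card F) e, fun j k hk => ?_,
    eq_zero_of_combination_eq_zero hF hind,
    fun f hf => exists_combination_of_forall _ (fun f hf => exists_combination_add hF hspan hf) hf⟩
  -- The new exponents are supported on k < 2m, that is, k ≤ 2(m + 1) − 3.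
  rw [extendExponent] at hk
  split_ifs at hk with h
  · omega
  · exact absurd rfl hk

theorem hasXiBasis (hF : ringChar F ≠ 2) (m : ℕ) : HasXiBasis F m := by
  induction m with
  | zero => exact hasXiBasis_zero
  | succ m ih => exact hasXiBasis_succ hF ih

end Basis

/-! ### Finite free algebras over polynomial rings are Cohen–Macaulay -/

section CohenMacaulay

variable {F : Type*} [Field F] {n : ℕ}

/-- After reducing coefficients modulo I, a monic polynomial is a nonzerodivisor. -/
theorem mem_of_monic_mul_mem {R : Type*} [CommRing R] {I : Ideal R} {p f : Polynomial R}
    (hp : p.Monic) (h : p * f ∈ I.map Polynomial.C) : f ∈ I.map Polynomial.C := by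
  have key : ∀ g : Polynomial R, g ∈ I.map Polynomial.C ↔
      g.map (Ideal.Quotient.mk I) = 0 := by
    intro g
    rw [Ideal.mem_map_C_iff, Polynomial.ext_iff]
    simp only [Polynomial.coeff_map, Polynomial.coeff_zero, Ideal.Quotient.eq_zero_iff_mem]
  rw [key, Polynomial.map_mul] at h
  rw [key]
  rcases subsingleton_or_nontrivial (R ⧸ I) with _ | _
  · exact Subsingleton.elim _ _
  · exact (hp.map (Ideal.Quotient.mk I)).mul_right_eq_zero_iff.mp h

/-- Since s does not involve X_k, membership in its span can be tested on the coefficients of powers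
of X_k, where p(X_k) becomes a monic polynomial. -/
theorem mem_span_of_aeval_X_mul_mem {k : Fin n} {s : Set (MvPolynomial (Fin n) F)}
    (hs : ∀ g ∈ s, expandAt F k g = Polynomial.C g) {p : Polynomial F} (hp : p.Monic)
    {f : MvPolynomial (Fin n) F} (hf : Polynomial.aeval (X k) p * f ∈ Ideal.span s) :
    f ∈ Ideal.span s := by
  have hmap : ∀ g ∈ Ideal.span s, expandAt F k g ∈ (Ideal.span s).map Polynomial.C := by
    intro g hg
    have h1 : (Ideal.span s).map (expandAt F k) ≤ (Ideal.span s).map Polynomial.C := by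
      rw [Ideal.map_span, Ideal.span_le]
      rintro _ ⟨g, hg, rfl⟩
      rw [hs g hg]
      exact Ideal.mem_map_of_mem _ (Ideal.subset_span hg)
    exact h1 (Ideal.mem_map_of_mem _ hg)
  have hpk : expandAt F k (Polynomial.aeval (X k) p) =
      p.map (algebraMap F (MvPolynomial (Fin n) F)) := by
    rw [← Polynomial.aeval_algHom_apply, expandAt_X_self, Polynomial.aeval_X_left_eq_map]
  have h := hmap _ hf
  rw [map_mul, hpk] at h
  have h2 := mem_of_monic_mul_mem (hp.map _) h
  rw [← eval_expandAt k f, Polynomial.eval_eq_sum_range]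
  exact Ideal.sum_mem _ fun i _ => Ideal.mul_mem_right _ _ (Ideal.mem_map_C_iff.mp h2 i)

/-- Monic polynomials in the individual variables form a weakly regular sequence. -/
theorem isWeaklyRegular_aeval_X (p : Fin n → Polynomial F) (hp : ∀ i, (p i).Monic) :
    RingTheory.Sequence.IsWeaklyRegular (MvPolynomial (Fin n) F)
      (List.ofFn fun i => Polynomial.aeval (X i : MvPolynomial (Fin n) F) (p i)) := by
  refine ⟨fun i hi => ?_⟩
  rw [isSMulRegular_quotient_iff_mem_of_smul_mem]
  have hi' : i < n := by simpa using hi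
  intro f hf
  rw [smul_eq_mul, Ideal.mul_top, List.getElem_ofFn, smul_eq_mul] at *
  refine mem_span_of_aeval_X_mul_mem (k := ⟨i, hi'⟩) (fun g hg => ?_) (hp _) hf
  obtain ⟨j, hj, rfl⟩ := List.mem_take_iff_getElem.mp hg
  rw [List.getElem_ofFn, ← Polynomial.aeval_algHom_apply, expandAt_X_of_ne]
  · exact Polynomial.aeval_algHom_apply (IsScalarTower.toAlgHom F (MvPolynomial (Fin n) F)
      (Polynomial (MvPolynomial (Fin n) F))) _ _
  · intro h
    have := congrArg Fin.val h
    simp only at this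
    omega

theorem ringKrullDim_le_of_isIntegral (R A : Type*) [CommRing R] [CommRing A] [Algebra R A]
    [Algebra.IsIntegral R A] : ringKrullDim A ≤ ringKrullDim R := by
  refine Order.krullDim_le_of_strictMono (fun p : PrimeSpectrum A =>
    PrimeSpectrum.comap (algebraMap R A) p) fun p r h => ?_
  exact Ideal.IsIntegral.comap_lt_comap (R := R) h

/-- An algebra that is finite and free over a polynomial subalgebra is Cohen–Macaulay. -/
theorem isCohenMacaulayRing_of_free {A : Type*} [CommRing A] [Algebra F A] {t : Fin n → A}
    (ht : AlgebraicIndependent F t) [Module.Finite (Algebra.adjoin F (Set.range t)) A]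
    [Module.Free (Algebra.adjoin F (Set.range t)) A] : IsCohenMacaulayRing A := by
  have hB : IsNoetherianRing (Algebra.adjoin F (Set.range t)) :=
    isNoetherianRing_of_ringEquiv (MvPolynomial (Fin n) F) ht.aevalEquiv.toRingEquiv
  have hA : IsNoetherianRing A := IsNoetherianRing.of_finite (Algebra.adjoin F (Set.range t)) A
  refine ⟨hA, fun M hM => ?_⟩
  have hBft : Algebra.FiniteType F (Algebra.adjoin F (Set.range t)) :=
    Algebra.FiniteType.equiv inferInstance ht.aevalEquiv
  have hAft : Algebra.FiniteType F A :=
    Algebra.FiniteType.trans hBft inferInstance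
  let _ : Field (A ⧸ M) := Ideal.Quotient.field M
  have hKft : Algebra.FiniteType F (A ⧸ M) :=
    hAft.of_surjective (Ideal.Quotient.mkₐ F M) (Ideal.Quotient.mkₐ_surjective F M)
  have hK : Module.Finite F (A ⧸ M) := finite_of_finite_type_of_isJacobsonRing F (A ⧸ M)
  -- By Zariski's lemma A/M is finite over F, so each t_i has a minimal polynomial modulo M; its
  -- value at t_i lies in M. This avoids assuming that t_i itself does.
  set p : Fin n → Polynomial F := fun i => minpoly F (Ideal.Quotient.mkₐ F M (t i)) with hp
  have hmon : ∀ i, (p i).Monic := fun i => minpoly.monic (Algebra.IsIntegral.isIntegral _)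
  have hmem : ∀ i, Polynomial.aeval (t i) (p i) ∈ M := fun i => by
    rw [← Ideal.Quotient.eq_zero_iff_mem]
    exact (Polynomial.aeval_algHom_apply (Ideal.Quotient.mkₐ F M) (t i) (p i)).symm.trans
      (minpoly.aeval F _)
  let _ : Algebra (MvPolynomial (Fin n) F) A := (aeval t).toRingHom.toAlgebra
  have hflat : Module.Flat (MvPolynomial (Fin n) F) A := by
    have h1 : (algebraMap (Algebra.adjoin F (Set.range t)) A).Flat :=
      (RingHom.flat_algebraMap_iff).mpr inferInstance
    have h2 : (ht.aevalEquiv : MvPolynomial (Fin n) F →+* Algebra.adjoin F (Set.range t)).Flat :=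
      RingHom.Flat.of_bijective ht.aevalEquiv.bijective
    have h3 := RingHom.Flat.comp h2 h1
    rw [← RingHom.flat_algebraMap_iff]
    have h4 : algebraMap (MvPolynomial (Fin n) F) A =
        (algebraMap (Algebra.adjoin F (Set.range t)) A).comp
          (ht.aevalEquiv : MvPolynomial (Fin n) F →+* Algebra.adjoin F (Set.range t)) :=
      RingHom.ext fun f => (ht.algebraMap_aevalEquiv f).symm
    rw [h4]
    exact h3
  -- The p_i(X_i) form a weakly regular sequence in the polynomial ring, and flatness carries it to
  -- A.
  have hreg : RingTheory.Sequence.IsWeaklyRegular A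
      (List.ofFn fun i => Polynomial.aeval (t i) (p i)) := by
    have h1 := (isWeaklyRegular_aeval_X p hmon).of_flat (S := A)
    rw [List.map_ofFn] at h1
    convert h1 using 3 with i
    rw [Function.comp_apply]
    change _ = aeval t (Polynomial.aeval (X i) (p i))
    rw [← Polynomial.aeval_algHom_apply, aeval_X]
  have hloc := hreg.isRegular_of_isLocalization_of_mem (Localization.AtPrime M) M (fun r hr => by
    obtain ⟨i, rfl⟩ := List.mem_ofFn.mp hr
    exact hmem i)
  refine ⟨_, hloc, ?_⟩
  have hlen : ((List.ofFn fun i => Polynomial.aeval (t i) (p i)).map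
      (algebraMap A (Localization.AtPrime M))).length = n := by simp
  -- A regular sequence is never longer than the dimension. Conversely the local dimension is at
  -- most dim A, which by integrality is at most n.
  refine le_antisymm ?_ ?_
  · have h1 := ringKrullDim_add_length_eq_ringKrullDim_of_isRegular _ hloc
    have h2 : Nontrivial (Localization.AtPrime M ⧸ Ideal.ofList
        ((List.ofFn fun i => Polynomial.aeval (t i) (p i)).map
          (algebraMap A (Localization.AtPrime M)))) := by
      rw [Ideal.Quotient.nontrivial_iff]
      intro h
      exact hloc.top_ne_smul (by rw [h]; simp)
    rw [← h1]
    exact le_add_of_nonneg_left ringKrullDim_nonneg_of_nontrivial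
  · rw [hlen, IsLocalization.AtPrime.ringKrullDim_eq_height M (Localization.AtPrime M)]
    refine (Ideal.height_le_ringKrullDim_of_ne_top hM.ne_top).trans ?_
    have hint : Algebra.IsIntegral (Algebra.adjoin F (Set.range t)) A := inferInstance
    refine (ringKrullDim_le_of_isIntegral (Algebra.adjoin F (Set.range t)) A).trans ?_
    rw [← ringKrullDim_eq_of_ringEquiv ht.aevalEquiv.toRingEquiv,
      MvPolynomial.ringKrullDim_of_isNoetherianRing, ringKrullDim_eq_zero_of_field, zero_add,
      Nat.card_fin]

end CohenMacaulay

/-! ### Independence, freeness and generators from the basis -/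

section Consequences

variable {F : Type*} [Field F] [Fintype F] {m : ℕ}

theorem coe_aeval_variableNorm (p : MvPolynomial (Fin (2 * m)) F) :
    ((aeval (variableNorm (sylow m F)) p : invariants (sylow m F)) :
      MvPolynomial (Fin (2 * m)) F) = aeval (norms F m) p := by
  have h : (invariants (sylow m F)).val.comp (aeval (variableNorm (sylow m F))) =
      aeval (norms F m) := by
    ext1 i
    rw [AlgHom.comp_apply, aeval_X, aeval_X]
    rfl
  exact DFunLike.congr_fun h p

/-- Since 1 is a combination, the basis is nonempty. An algebraic relation among the orbit products
would annihilate a basis element, contradicting its independence. -/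
theorem algebraicIndependent_variableNorm (h : HasXiBasis F m) :
    AlgebraicIndependent F (variableNorm (sylow m F)) := by
  classical
  obtain ⟨ι, _, e, -, hind, hspan⟩ := h
  rw [algebraicIndependent_iff]
  intro p hp
  have hp' : aeval (norms F m) p = 0 := by
    rw [← coe_aeval_variableNorm, hp]
    rfl
  obtain ⟨r, hr⟩ := hspan 1 (one_mem _)
  have hι : Nonempty ι := by
    by_contra hι
    rw [not_nonempty_iff] at hι
    rw [combination, Fintype.sum_empty] at hr
    exact zero_ne_one hr
  obtain ⟨i⟩ := hι
  have h1 := hind (Pi.single i p) (by rw [combination_single, hp', zero_mul])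
  have h2 := congrFun h1 i
  rwa [Pi.single_eq_same] at h2

theorem exists_basis_invariants (h : HasXiBasis F m) :
    ∃ (ι : Type) (_ : Finite ι), Nonempty (Module.Basis ι
      (Algebra.adjoin F (Set.range (variableNorm (sylow m F)))) (invariants (sylow m F))) := by
  obtain ⟨ι, _, e, -, hind, hspan⟩ := h
  have hadj : ∀ b : Algebra.adjoin F (Set.range (variableNorm (sylow m F))),
      ∃ p, aeval (variableNorm (sylow m F)) p = (b : invariants (sylow m F)) := fun b => by
    have hb := (Algebra.adjoin_range_eq_range_aeval F (variableNorm (sylow m F))).le b.2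
    exact hb
  set v : ι → invariants (sylow m F) :=
    fun i => ⟨xiMonomial F m (e i), xiMonomial_mem_invariants _⟩ with hv
  refine ⟨ι, inferInstance, ⟨Module.Basis.mk (v := v) ?_ ?_⟩⟩
  · refine (Fintype.linearIndependent_iff
      (R := Algebra.adjoin F (Set.range (variableNorm (sylow m F))))
      (M := invariants (sylow m F)) (v := v)).mpr fun g hg i => ?_
    choose p hp using fun i => hadj (g i)
    have h1 : combination F e p = 0 := by
      have h2 := congrArg (invariants (sylow m F)).val hg
      rw [map_sum, map_zero] at h2
      rw [← h2, combination]
      refine Finset.sum_congr rfl fun i _ => ?_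
      rw [← coe_aeval_variableNorm, hp]
      rfl
    have h2 := congrFun (hind p h1) i
    apply Subtype.ext
    rw [← hp, h2, Pi.zero_apply, map_zero]
    rfl
  · rintro f -
    obtain ⟨p, hp⟩ := hspan f f.2
    have h1 : f = ∑ i, (⟨aeval (variableNorm (sylow m F)) (p i), by
        rw [Algebra.adjoin_range_eq_range_aeval]
        exact ⟨p i, rfl⟩⟩ : Algebra.adjoin F (Set.range (variableNorm (sylow m F)))) • v i := by
      apply Subtype.ext
      rw [← hp, combination, ← Subalgebra.coe_val, map_sum]
      refine Finset.sum_congr rfl fun i _ => ?_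
      rw [← coe_aeval_variableNorm]
      rfl
    rw [h1]
    exact Submodule.sum_mem _ fun i _ => Submodule.smul_mem _ _ (Submodule.subset_span ⟨i, rfl⟩)

theorem adjoin_norms_union_xi (h : HasXiBasis F m) :
    Algebra.adjoin F (Set.range (fun i : Fin (2 * m) => orbitProduct (sylow m F) (X i)) ∪
      xi m F '' {k | k + 3 ≤ 2 * m}) = invariants (sylow m F) := by
  obtain ⟨ι, _, e, he, -, hspan⟩ := h
  apply le_antisymm
  · refine Algebra.adjoin_le ?_
    rintro _ (⟨i, rfl⟩ | ⟨k, -, rfl⟩)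
    · exact orbitProduct_mem _ _
    · exact xi_mem k
  · intro f hf
    obtain ⟨p, rfl⟩ := hspan f hf
    refine sum_mem fun i _ => mul_mem ?_ ?_
    · refine Algebra.adjoin_mono Set.subset_union_left ?_
      rw [Algebra.adjoin_range_eq_range_aeval]
      exact ⟨p i, rfl⟩
    · rw [xiMonomial]
      refine Subalgebra.prod_mem _ fun k _ => ?_
      by_cases hk : e i k = 0
      · rw [hk, pow_zero]
        exact one_mem _
      · refine Subalgebra.pow_mem _ ?_ _
        exact Algebra.subset_adjoin (Set.mem_union_right _ ⟨(k : ℕ), he i k hk, rfl⟩)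

end Consequences

end OrthPlus

theorem theorem5p7 (m : ℕ) (hm : 1 ≤ m) (F : Type*) [Field F] [Fintype F]
    (hF : ringChar F ≠ 2) :
    OrthPlus.IsCohenMacaulayRing (OrthPlus.invariants (OrthPlus.sylow m F)) ∧
    AlgebraicIndependent F (OrthPlus.variableNorm (OrthPlus.sylow m F)) ∧
    Module.Finite
      (Algebra.adjoin F (Set.range (OrthPlus.variableNorm (OrthPlus.sylow m F))))
      (OrthPlus.invariants (OrthPlus.sylow m F)) ∧
    Module.Free
      (Algebra.adjoin F (Set.range (OrthPlus.variableNorm (OrthPlus.sylow m F))))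
      (OrthPlus.invariants (OrthPlus.sylow m F)) ∧
    Algebra.adjoin F
      (Set.range (fun i : Fin (2 * m) =>
          OrthPlus.orbitProduct (OrthPlus.sylow m F) (MvPolynomial.X i)) ∪
        OrthPlus.xi m F '' {k | k + 3 ≤ 2 * m}) =
      OrthPlus.invariants (OrthPlus.sylow m F) := by
  have h := OrthPlus.hasXiBasis hF m
  obtain ⟨ι, _, ⟨b⟩⟩ := OrthPlus.exists_basis_invariants h
  have hfin : Module.Finite
      (Algebra.adjoin F (Set.range (OrthPlus.variableNorm (OrthPlus.sylow m F))))
      (OrthPlus.invariants (OrthPlus.sylow m F)) := Module.Finite.of_basis b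
  have hfree : Module.Free
      (Algebra.adjoin F (Set.range (OrthPlus.variableNorm (OrthPlus.sylow m F))))
      (OrthPlus.invariants (OrthPlus.sylow m F)) := Module.Free.of_basis b
  have hind := OrthPlus.algebraicIndependent_variableNorm h
  exact ⟨OrthPlus.isCohenMacaulayRing_of_free hind, hind, hfin, hfree,
    OrthPlus.adjoin_norms_union_xi h⟩
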